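/- Let $m\ge 0$ be an integer. An $m$-equivariant function on $\mathbb R^2\cong\mathbb C$, $F(re^{i\theta})=f(r)e^{im\theta}$, is identified with its radial part $f:(0,\infty)\to\mathbb C$. Write $\int=2\pi\int_0^\infty r\,dr$, $L^2=L^2(2\pi r\,dr)$, $(f,g)_r=\int\mathrm{Re}(f\bar g)$, $\Lambda=1+r\partial_r$, and $$Q(r)=\sqrt8\,(m+1)\frac{r^m}{1+r^{2(m+1)}},\quad A_\theta[u]=-\tfrac12\int_0^r|u|^2r'dr',\quad A_0[u]=-\int_r^\infty(m+A_\theta[u])|u|^2\tfrac{dr'}{r'},$$ $$B_fg=\tfrac1r\int_0^r\mathrm{Re}(\bar fg)\,r'dr',\quad B_w^*f=w\int_r^\infty\mathrm{Re}f\,dr',\quad D_+^{(w)}u=\partial_ru-\tfrac{m+A_\theta[w]}{r}u,$$ $$L_w=D_+^{(w)}+wB_w,\qquad L_w^*f=-\partial_rf-\tfrac{1+m+A_\theta[w]}{r}f+B_w^*(\bar wf),$$ $$\mathcal L_w\epsilon=L_w^*L_w\epsilon+(B_w\epsilon)D_+^{(w)}w+B_w^*[\bar\epsilon D_+^{(w)}w]+B_\epsilon^*[\bar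 wD_+^{(w)}w].$$ (1) (Linearization and factorization.) $(L_Q\varphi,\chi)_r=(\varphi,L_Q^*\chi)_r$ for all $\varphi,\chi\in C_c^\infty((0,\infty);\mathbb C)$. For every smooth $m$-equivariant $\epsilon$ with $\epsilon,\partial_r\epsilon\in L^2$ and every $r>0$, $\mathcal L_Q\epsilon(r)$ is the derivative at $s=0$ of $s\mapsto\mathcal N(Q+s\epsilon)(r)$, where $$\mathcal N(u)=-\big(\partial_{rr}+\tfrac1r\partial_r-\tfrac{m^2}{r^2}\big)u-|u|^2u+\tfrac{2m}{r^2}A_\theta[u]u+\tfrac{1}{r^2}A_\theta[u]^2u+A_0[u]u$$ is the right-hand side of the self-dual Chern–Simons–Schrödinger equation $i\partial_tu=\mathcal N(u)$. Moreover $\mathcal L_Q=L_Q^*L_Q$. (2) (Kernel.) The space of smooth $m$-equivariant functions $f$ on $\mathbb R^2$ with $L_Qf=0$ is $\mathrm{span}_{\mathbb R}\{iQ,\Lambda Q\}$. (3) (Generalized null space.) There is a smooth $\rho:(0,\infty)\to\mathbb R$ with $L_Q^*L_Q\rho=Q$ (the integral in $L_Q^*$ being absolutely convergent) and $|\rho|\le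 C\,r^2Q$ for some $C$; if $m\ge1$, then $(\rho,Q)_r=\|L_Q\rho\|_{L^2}^2\ne0$, both sides being finite. It satisfies $$i\mathcal L_Q\rho=iQ,\quad i\mathcal L_Q(ir^2Q)=4\Lambda Q,\quad i\mathcal L_Q(iQ)=0,\quad i\mathcal L_Q\Lambda Q=0.$$ The ($m$-equivariant extensions of the) functions $iQ,\Lambda Q,ir^2Q,\rho$ are linearly independent over $\mathbb R$ and span the generalized null space of $i\mathcal L_Q$. Here, for any fixed real $\sigma$ with $-m\le\sigma<m+2$ (the result is the same for each), the generalized null space is the set of $f$ for which there are $k\ge0$ and $f_0=f,f_1,\dots,f_k=0$ with $f_{j+1}=i\mathcal L_Qf_j$ and each $f_j$ in the class of smooth $m$-equivariant functions such that $|f_j|\le C(1+r)^\sigma$ for some $C$ and $\mathrm{Re}(Q\,L_Qf_j)\in L^1((0,\infty),dr)$. (4) (Boundedness and coercivity.) For $m\ge1$ let $\dot{\mathcal H}_m=\dot H^1_m$ be the space of $f:(0,\infty)\to\mathbb C$ with weak derivative $\partial_rf\in L^2$ and $r^{-1}f\in L^2$, with $\|f\|_{\dot H^1_m}^2=\|\partial_rf\|_{L^2}^2+m^2\|r^{-1}f\|_{L^2}^2$.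 For $m=0$ let $\dot{\mathcal H}_0$ be the space of $f$ with $\partial_rf,(1+r)^{-1}f\in L^2$ and $\|f\|_{\dot{\mathcal H}_0}^2=\|\partial_rf\|_{L^2}^2+\|(1+r)^{-1}f\|_{L^2}^2$. Then there is $C=C(m)$ with $\|L_Qf\|_{L^2}\le C\|f\|_{\dot{\mathcal H}_m}$ for all $f\in\dot{\mathcal H}_m$. The functions $iQ,\Lambda Q$ belong to $\dot{\mathcal H}_m$, and if $\psi_1,\psi_2$ are bounded real-linear functionals on $\dot{\mathcal H}_m$, with pairing written $(\cdot,\psi_j)_r$, such that $$\det\begin{bmatrix}(iQ,\psi_1)_r&(\Lambda Q,\psi_1)_r\\(iQ,\psi_2)_r&(\Lambda Q,\psi_2)_r\end{bmatrix}\ne0,$$ then there is $c=c(m,\psi_1,\psi_2)>0$ with $\|L_Qf\|_{L^2}^2\ge c\,\|f\|_{\dot{\mathcal H}_m}^2$ for all $f\in\dot{\mathcal H}_m$ with $(f,\psi_1)_r=(f,\psi_2)_r=0$. -/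

import Mathlib

open Complex MeasureTheory Set
open scoped ContDiff ComplexConjugate

noncomputable section

namespace CSS

/-! Functions on `(0, ∞)` are represented by functions on `ℝ`, of which only the values at
positive arguments matter. The plane `ℝ²` is identified with `ℂ`. -/

/-- The measure `2π r dr` on `(0, ∞)`. -/
def radMeasure : Measure ℝ :=
  (volume.restrict (Ioi 0)).withDensity (fun r => ENNReal.ofReal (2 * Real.pi * r))

/-- The `L²(2π r dr)` norm. -/
def l2norm (f : ℝ → ℂ) : ℝ := (eLpNorm f 2 radMeasure).toReal

/-- The real inner product `(f, g)_r = ∫ Re (f ḡ)`, with `∫ = 2π ∫₀^∞ r dr`. -/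
def rinner (f g : ℝ → ℂ) : ℝ := ∫ r, (f r * conj (g r)).re ∂radMeasure

/-- The static solution `Q(r) = √8 (m+1) r^m / (1 + r^(2(m+1)))`. -/
def Q (m : ℕ) (r : ℝ) : ℂ :=
  ((Real.sqrt 8 * (m + 1) * r ^ m / (1 + r ^ (2 * (m + 1))) : ℝ) : ℂ)

/-- The generator `Λ = 1 + r ∂_r` of the `L²` scaling. -/
def Lam (f : ℝ → ℂ) (r : ℝ) : ℂ := f r + r * deriv f r

/-- `A_θ[u](r) = -½ ∫₀^r |u|² r' dr'`. -/
def Atheta (u : ℝ → ℂ) (r : ℝ) : ℝ := -(1 / 2) * ∫ s in (0 : ℝ)..r, ‖u s‖ ^ 2 * s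

/-- `A₀[u](r) = -∫_r^∞ (m + A_θ[u]) |u|² dr'/r'`. -/
def Azero (m : ℕ) (u : ℝ → ℂ) (r : ℝ) : ℝ :=
  -∫ s in Ioi r, (m + Atheta u s) * ‖u s‖ ^ 2 / s

/-- `Δ_m = ∂_rr + r⁻¹ ∂_r - m² r⁻²`. -/
def Lap (m : ℕ) (u : ℝ → ℂ) (r : ℝ) : ℂ :=
  deriv (deriv u) r + 1 / r * deriv u r - (m : ℂ) ^ 2 / r ^ 2 * u r

/-- The right-hand side of the self-dual equivariant Chern-Simons-Schrödinger equation
written as `i ∂_t u = cssRHS m u`. -/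
def cssRHS (m : ℕ) (u : ℝ → ℂ) (r : ℝ) : ℂ :=
  -Lap m u r - ‖u r‖ ^ 2 * u r + 2 * m / r ^ 2 * Atheta u r * u r
    + (Atheta u r) ^ 2 / r ^ 2 * u r + Azero m u r * u r

/-- `B_f g (r) = r⁻¹ ∫₀^r Re (f̄ g) r' dr'`. -/
def B (f g : ℝ → ℂ) (r : ℝ) : ℝ := 1 / r * ∫ s in (0 : ℝ)..r, (conj (f s) * g s).re * s

/-- `B_w^* f (r) = w(r) ∫_r^∞ Re f dr'`. -/
def Bstar (w f : ℝ → ℂ) (r : ℝ) : ℂ := w r * ((∫ s in Ioi r, (f s).re : ℝ) : ℂ)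

/-- The expression `u' - r⁻¹ (m + A_θ[w]) u + w B_w u`, where `u'` is a given (classical or weak)
derivative of `u`. -/
def Lgen (m : ℕ) (w u u' : ℝ → ℂ) (r : ℝ) : ℂ :=
  u' r - (m + Atheta w r) / r * u r + w r * B w u r

/-- `D_+^{(w)} u = ∂_r u - r⁻¹ (m + A_θ[w]) u`. -/
def Dplus (m : ℕ) (w u : ℝ → ℂ) (r : ℝ) : ℂ := deriv u r - (m + Atheta w r) / r * u r

/-- `L_w = D_+^{(w)} + w B_w`. -/
def L (m : ℕ) (w u : ℝ → ℂ) : ℝ → ℂ := Lgen m w u (deriv u)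

/-- `L_w^* f = -∂_r f - r⁻¹ (1 + m + A_θ[w]) f + B_w^* (w̄ f)`. -/
def Lstar (m : ℕ) (w f : ℝ → ℂ) (r : ℝ) : ℂ :=
  -deriv f r - (1 + m + Atheta w r) / r * f r + Bstar w (fun s => conj (w s) * f s) r

/-- The linearized operator `𝓛_w`:
`𝓛_w ε = L_w^* L_w ε + [(B_w ε) + B_w^*[ε̄ ·] + B_ε^*[w̄ ·]] D_+^{(w)} w`. -/
def linOp (m : ℕ) (w ε : ℝ → ℂ) (r : ℝ) : ℂ :=
  Lstar m w (L m w ε) r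
    + (B w ε r * Dplus m w w r
      + Bstar w (fun s => conj (ε s) * Dplus m w w s) r
      + Bstar ε (fun s => conj (w s) * Dplus m w w s) r)

/-- Smooth `m`-equivariant functions on the plane: `F (r e^{iθ}) = g(r) e^{imθ}`. -/
def SmoothEquivariant (m : ℕ) (F : ℂ → ℂ) : Prop :=
  ContDiff ℝ ∞ F ∧ ∃ g : ℝ → ℂ, ∀ r : ℝ, 0 < r → ∀ θ : ℝ,
    F (r * exp (θ * I)) = g r * exp (m * θ * I)

/-- The radial part of an equivariant function. -/
def rad (F : ℂ → ℂ) (r : ℝ) : ℂ := F r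

/-- The `m`-equivariant extension `g(r) e^{imθ}` of a radial profile. -/
def ext (m : ℕ) (g : ℝ → ℂ) (z : ℂ) : ℂ := g ‖z‖ * exp (m * arg z * I)

/-- The radial profile `iQ`. -/
def iQ (m : ℕ) (r : ℝ) : ℂ := I * Q m r

/-- The radial profile `ΛQ`. -/
def LamQ (m : ℕ) : ℝ → ℂ := Lam (Q m)

/-- The radial profile `i r² Q`. -/
def irrQ (m : ℕ) (r : ℝ) : ℂ := I * (r : ℂ) ^ 2 * Q m r

/-- The kernel of `L_Q` among smooth `m`-equivariant functions. -/
def kerL (m : ℕ) : Set (ℂ → ℂ) :=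
  {F | SmoothEquivariant m F ∧ ∀ r : ℝ, 0 < r → L m (Q m) (rad F) r = 0}

/-- Smooth `m`-equivariant functions of growth at most `(1 + r)^σ` for which the nonlocal
term `∫_r^∞ Re (Q L_Q f) dr'` of `L_Q^* L_Q f` converges absolutely. -/
def genDomain (m : ℕ) (σ : ℝ) : Set (ℂ → ℂ) :=
  {F | SmoothEquivariant m F ∧ (∃ C : ℝ, ∀ z : ℂ, ‖F z‖ ≤ C * (1 + ‖z‖) ^ σ) ∧
    IntegrableOn (fun r => (conj (Q m r) * L m (Q m) (rad F) r).re) (Ioi 0)}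

/-- The generalized null space `⋃ₖ ker (i𝓛_Q)^k` of `i𝓛_Q` in `genDomain m σ`: it contains `0`,
and an `F` in the domain whenever it contains `G = i𝓛_Q F`. -/
inductive GenNull (m : ℕ) (σ : ℝ) : (ℂ → ℂ) → Prop
  | zero : GenNull m σ 0
  | step (F G : ℂ → ℂ) (hF : F ∈ genDomain m σ) (hG : GenNull m σ G)
      (h : ∀ r : ℝ, 0 < r → rad G r = I * linOp m (Q m) (rad F) r) : GenNull m σ F

/-- The defining properties of the generalized eigenmode `ρ`: a smooth real-valued solution on
`(0, ∞)` of `L_Q^* L_Q ρ = Q` with `|ρ| ≲ r² Q` (and hence extended by `ρ(0) = 0`). -/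
structure IsRho (m : ℕ) (ρ : ℝ → ℝ) : Prop where
  smooth : ContDiffOn ℝ ∞ ρ (Ioi 0)
  tail : IntegrableOn
    (fun r => (conj (Q m r) * L m (Q m) (fun s => (ρ s : ℂ)) r).re) (Ioi 0)
  eqn : ∀ r : ℝ, 0 < r → Lstar m (Q m) (L m (Q m) (fun s => (ρ s : ℂ))) r = Q m r
  bound : ∃ C : ℝ, ∀ r : ℝ, 0 ≤ r → |ρ r| ≤ C * (r ^ 2 * ‖Q m r‖)

/-- `C_c^∞((0, ∞))`, the radial parts of smooth equivariant functions compactly supported in the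
punctured plane. -/
def IsTest (φ : ℝ → ℂ) : Prop :=
  ContDiff ℝ ∞ φ ∧ HasCompactSupport φ ∧ tsupport φ ⊆ Ioi 0

/-- `f'` is a weak derivative of `f` on `(0, ∞)`. -/
structure IsWeakDeriv (f f' : ℝ → ℂ) : Prop where
  loc : LocallyIntegrableOn f (Ioi 0)
  loc' : LocallyIntegrableOn f' (Ioi 0)
  eqn : ∀ φ : ℝ → ℂ, IsTest φ →
    ∫ r in Ioi (0 : ℝ), deriv φ r * f r = -∫ r in Ioi (0 : ℝ), φ r * f' r

open Classical in
/-- The weak derivative (unique almost everywhere where it exists). -/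
def weakDeriv (f : ℝ → ℂ) : ℝ → ℂ :=
  if h : ∃ f', IsWeakDeriv f f' then h.choose else 0

/-- The weight `r⁻¹` for `m ≥ 1` and `(1 + r)⁻¹` for `m = 0`. -/
def weight (m : ℕ) (r : ℝ) : ℝ := if m = 0 then (1 + r)⁻¹ else r⁻¹

lemma IsTest.integrable_mul {φ f : ℝ → ℂ} (hφ : IsTest φ)
    (hf : LocallyIntegrableOn f (Ioi 0)) :
    IntegrableOn (fun r => φ r * f r) (Ioi 0) := by
  obtain ⟨h1, h2, h3⟩ := hφ
  have hK : IntegrableOn (fun r => φ r * f r) (tsupport φ) :=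
    IntegrableOn.continuousOn_mul h1.continuous.continuousOn
      (hf.integrableOn_compact_subset h3 h2) h2
  refine ((integrableOn_iff_integrable_of_support_subset ?_).1 hK).integrableOn
  intro r hr
  exact subset_tsupport φ (left_ne_zero_of_mul hr)

lemma IsTest.deriv {φ : ℝ → ℂ} (hφ : IsTest φ) : IsTest (deriv φ) := by
  obtain ⟨h1, h2, h3⟩ := hφ
  exact ⟨(contDiff_infty_iff_deriv.1 h1).2, h2.deriv,
    (closure_minimal (support_deriv_subset (f := φ)) (isClosed_tsupport φ)).trans h3⟩

lemma IsWeakDeriv.add {f f' g g' : ℝ → ℂ} (hf : IsWeakDeriv f f') (hg : IsWeakDeriv g g') :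
    IsWeakDeriv (f + g) (f' + g') where
  loc := hf.loc.add hg.loc
  loc' := hf.loc'.add hg.loc'
  eqn φ hφ := by
    simp only [Pi.add_apply, mul_add]
    rw [integral_add (hφ.deriv.integrable_mul hf.loc) (hφ.deriv.integrable_mul hg.loc),
      integral_add (hφ.integrable_mul hf.loc') (hφ.integrable_mul hg.loc'),
      hf.eqn φ hφ, hg.eqn φ hφ]
    ring

lemma IsWeakDeriv.smul {f f' : ℝ → ℂ} (c : ℝ) (hf : IsWeakDeriv f f') :
    IsWeakDeriv (c • f) (c • f') where
  loc := hf.loc.smul c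
  loc' := hf.loc'.smul c
  eqn φ hφ := by
    simp only [Pi.smul_apply, mul_smul_comm]
    rw [integral_smul, integral_smul, hf.eqn φ hφ, smul_neg]

lemma isWeakDeriv_zero : IsWeakDeriv 0 0 where
  loc := locallyIntegrableOn_zero
  loc' := locallyIntegrableOn_zero
  eqn φ _ := by simp

/-- The energy space in radial form. For `m ≥ 1` this is `Ḣ¹_m`: the `f` with weak derivative
such that `∂_r f` and `r⁻¹ f` are in `L²(2π r dr)`. For `m = 0` the weight `r⁻¹` is replaced by
`(1 + r)⁻¹`. -/
def energySpace (m : ℕ) : Submodule ℝ (ℝ → ℂ) where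
  carrier := {f | ∃ f', IsWeakDeriv f f' ∧ MemLp f' 2 radMeasure ∧
    MemLp (fun r => weight m r • f r) 2 radMeasure}
  zero_mem' := ⟨0, isWeakDeriv_zero, MemLp.zero, by simp⟩
  add_mem' := by
    rintro f g ⟨f', h1, h2, h3⟩ ⟨g', k1, k2, k3⟩
    refine ⟨f' + g', h1.add k1, h2.add k2, ?_⟩
    have h : (fun r => weight m r • (f + g) r)
        = (fun r => weight m r • f r) + fun r => weight m r • g r := by
      funext r
      exact smul_add _ _ _
    rw [h]
    exact h3.add k3
  smul_mem' := by
    rintro c f ⟨f', h1, h2, h3⟩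
    refine ⟨c • f', h1.smul c, h2.const_smul c, ?_⟩
    have h : (fun r => weight m r • (c • f) r) = c • fun r => weight m r • f r := by
      funext r
      exact smul_comm (weight m r) c (f r)
    rw [h]
    exact h3.const_smul c

/-- The square of the norm of the energy space: `‖∂_r f‖² + m² ‖r⁻¹ f‖²` if `m ≥ 1`, and
`‖∂_r f‖² + ‖(1 + r)⁻¹ f‖²` if `m = 0`. -/
def energySq (m : ℕ) (f : ℝ → ℂ) : ℝ :=
  l2norm (weakDeriv f) ^ 2
    + (if m = 0 then 1 else (m : ℝ) ^ 2) * l2norm (fun r => weight m r • f r) ^ 2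

/-- `L_Q` on the energy space, with the weak derivative. -/
def weakL (m : ℕ) (f : ℝ → ℂ) : ℝ → ℂ := Lgen m (Q m) f (weakDeriv f)

/-- The (real) topological dual of the energy space. -/
def IsBoundedFunctional (m : ℕ) (ψ : energySpace m →ₗ[ℝ] ℝ) : Prop :=
  ∃ C : ℝ, ∀ f : energySpace m, |ψ f| ≤ C * Real.sqrt (energySq m f)

end CSS

end

noncomputable section

namespace CSS

open Filter Topology
open scoped ENNReal

/-! Everything reduces to an explicitly solvable first-order system. Write ψ = `psi`, E = `en`. Then
m + A_θ[Q] = (m+1)ψ - 1 and rQ' = ((m+1)ψ - 1)Q. So Q solves the Bogomolny equation D_+Q = 0, which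
kills the three extra terms of 𝓛_Q and leaves the factorization L_Q^* L_Q. For the linearization, A₀
along Q + sε is a polynomial in s, and integrating (Q Re ε)' by parts matches its linear coefficient
with the nonlocal term of L_Q^* L_Q.

Since B_Q sees only real parts, L_Q f = h splits. For the imaginary part, with f = Qg, it says g' =
h/Q. For the real part, with f = Qg, T = ∫₀^r Q f s ds and r²Q² = 2(m+1)E, it becomes g' = h/Q -
T/r, T' = 2(m+1)E g/r. For h = 0 this system has the solutions (ψ, E) and (`psiLog`, `enLog`), with
constant Wronskian m+1 (`wronskian`). Hence gE - Tψ and g·enLog - T·psiLog are primitives of hE/Q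
and h·enLog/Q (`hasDerivAt_variation`, `hasDerivAt_variation_log`, and `IsPrimitive.variation` for
weak solutions). Regularity at the origin excludes the logarithmic solution, so the kernel consists
of iQ and ΛQ = (m+1)ψQ.

The mode ρ is Q times the variation-of-constants solution of L_Q ρ = rQ/(2(m+1)), because L_Q^*(rQ)
= 2(m+1)Q; likewise L_Q(ir²Q) = 2irQ and L_Q^*(irQ) = -2iΛQ. Its logarithms combine into log(r/s),
which gives |ρ| ≲ r²Q, and ray averages give smoothness on the plane. For the generalized null space
it suffices that any admissible preimage under i𝓛_Q of a combination of the four modes is again one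
(`eq_comb_of_step`). An ir²Q component in the target would force |Q Re L_Q F| ≳ 1/r, against
integrability (`real_inhomogeneous`); a ρ component would force growth r^(m+2), against σ < m + 2
(`imag_inhomogeneous`).

Boundedness is Cauchy-Schwarz for the zeroth-order part. For coercivity, variation of constants on
absolutely continuous representatives, together with a weighted Hardy inequality (`hardy`), bounds f
modulo span{iQ, ΛQ} by L_Q f (`exists_energy_bound`). The two orthogonality conditions then control
the kernel component by Cramer's rule (`weakL_coercive`). -/

/-- The real-valued profile of `Q`. -/
def profile (m : ℕ) (r : ℝ) : ℝ :=
  Real.sqrt 8 * (m + 1) * r ^ m / (1 + r ^ (2 * (m + 1)))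

/-- `ψ = (1 - r^(2(m+1))) / (1 + r^(2(m+1)))`, so that `ΛQ = (m + 1) ψ Q`. -/
def psi (m : ℕ) (r : ℝ) : ℝ := (1 - r ^ (2 * (m + 1))) / (1 + r ^ (2 * (m + 1)))

/-- `-r ψ'`, which equals `r² Q² / (2 (m + 1))`. -/
def en (m : ℕ) (r : ℝ) : ℝ := 4 * (m + 1) * r ^ (2 * (m + 1)) / (1 + r ^ (2 * (m + 1))) ^ 2

/-- The solution of `(r g')' = - r Q² g` that is independent of `ψ`. -/
def psiLog (m : ℕ) (r : ℝ) : ℝ := 1 + (m + 1) * Real.log r * psi m r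

/-- `-r ∂_r psiLog`. -/
def enLog (m : ℕ) (r : ℝ) : ℝ := (m + 1) * (-psi m r + Real.log r * en m r)

/-! ### Algebra and derivatives of the explicit profiles -/

lemma Q_eq (m : ℕ) (r : ℝ) : Q m r = (profile m r : ℂ) := rfl

lemma den_pos (m : ℕ) (r : ℝ) : 0 < 1 + r ^ (2 * (m + 1)) := by
  have : 0 ≤ r ^ (2 * (m + 1)) := by rw [pow_mul]; positivity
  linarith

lemma contDiff_profile (m : ℕ) : ContDiff ℝ ∞ (profile m) := by
  unfold profile
  exact ContDiff.div (by fun_prop) (by fun_prop) fun r => (den_pos m r).ne'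

lemma contDiff_psi (m : ℕ) : ContDiff ℝ ∞ (psi m) := by
  unfold psi
  exact ContDiff.div (by fun_prop) (by fun_prop) fun r => (den_pos m r).ne'

lemma contDiff_en (m : ℕ) : ContDiff ℝ ∞ (en m) := by
  unfold en
  exact ContDiff.div (by fun_prop) (by fun_prop) fun r => (pow_pos (den_pos m r) 2).ne'

@[fun_prop] lemma continuous_profile (m : ℕ) : Continuous (profile m) :=
  (contDiff_profile m).continuous

@[fun_prop] lemma continuous_psi (m : ℕ) : Continuous (psi m) := (contDiff_psi m).continuous

@[fun_prop] lemma continuous_en (m : ℕ) : Continuous (en m) := (contDiff_en m).continuous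

lemma profile_pos (m : ℕ) {r : ℝ} (hr : 0 < r) : 0 < profile m r := by
  unfold profile
  have := den_pos m r
  positivity

lemma profile_nonneg (m : ℕ) {r : ℝ} (hr : 0 ≤ r) : 0 ≤ profile m r := by
  unfold profile
  have := den_pos m r
  positivity

lemma en_pos (m : ℕ) {r : ℝ} (hr : 0 < r) : 0 < en m r := by
  unfold en
  have := den_pos m r
  positivity

/-- This trades the weight `r Q²` for `en / r`; many of the later `linear_combination` calls close
with a multiple of it. -/
lemma sq_mul_profile_sq (m : ℕ) (r : ℝ) : r ^ 2 * profile m r ^ 2 = 2 * (m + 1) * en m r := by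
  unfold profile en
  have h8 : Real.sqrt 8 ^ 2 = 8 := Real.sq_sqrt (by norm_num)
  have := (den_pos m r).ne'
  field_simp
  rw [h8]; ring

/-- With t = r^(2(m+1)) this is (1 - t)² + 4t = (1 + t)². -/
lemma psi_sq_add (m : ℕ) (r : ℝ) : (m + 1) * psi m r ^ 2 + en m r = m + 1 := by
  unfold psi en
  have := (den_pos m r).ne'
  field_simp
  ring

lemma abs_psi_le (m : ℕ) (r : ℝ) : |psi m r| ≤ 1 := by
  unfold psi
  have h := den_pos m r
  have h0 : 0 ≤ r ^ (2 * (m + 1)) := by rw [pow_mul]; positivity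
  rw [abs_div, abs_of_pos h, div_le_one h, abs_le]
  constructor <;> linarith

lemma en_nonneg (m : ℕ) (r : ℝ) : 0 ≤ en m r := by
  unfold en
  have h := den_pos m r
  have h0 : 0 ≤ r ^ (2 * (m + 1)) := by rw [pow_mul]; positivity
  positivity

lemma en_le (m : ℕ) (r : ℝ) : en m r ≤ m + 1 := by
  have := psi_sq_add m r
  nlinarith [mul_nonneg (Nat.cast_nonneg (α := ℝ) m) (sq_nonneg (psi m r)), sq_nonneg (psi m r)]

/-- Both pairs solve g' = -T/r, T' = 2(m+1) en g/r, so their determinant is constant; the logarithms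
cancel and `psi_sq_add` remains. Its nonvanishing lets g and T be recovered from the two
variation-of-constants quantities. -/
lemma wronskian (m : ℕ) (r : ℝ) :
    en m r * psiLog m r - enLog m r * psi m r = m + 1 := by
  have := psi_sq_add m r
  unfold psiLog enLog
  linear_combination this

lemma hasDerivAt_psi (m : ℕ) {r : ℝ} (hr : 0 < r) :
    HasDerivAt (psi m) (-(en m r) / r) r := by
  have h := (den_pos m r).ne'
  have h1 : HasDerivAt (fun x : ℝ => x ^ (2 * (m + 1))) _ r := hasDerivAt_pow (2 * (m + 1)) r
  have := (h1.const_sub 1).div (h1.const_add 1) h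
  refine this.congr_deriv ?_
  have e : r ^ (2 * (m + 1)) = r ^ (2 * (m + 1) - 1) * r := by
    rw [← pow_succ]; congr 1
  unfold en
  rw [e] at h ⊢
  push_cast
  field_simp
  ring

lemma hasDerivAt_profile (m : ℕ) {r : ℝ} (hr : 0 < r) :
    HasDerivAt (profile m) (((m + 1) * psi m r - 1) / r * profile m r) r := by
  have h := (den_pos m r).ne'
  have h1 : HasDerivAt (fun x : ℝ => x ^ (2 * (m + 1))) _ r := hasDerivAt_pow (2 * (m + 1)) r
  have h2 : HasDerivAt (fun x : ℝ => Real.sqrt 8 * (m + 1) * x ^ m)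
      (Real.sqrt 8 * (m + 1) * (m * r ^ m / r)) r := by
    refine ((hasDerivAt_pow m r).const_mul _).congr_deriv ?_
    -- The derivative of x^m is written m r^m / r to avoid the truncated exponent m - 1, which needs
    -- m = 0 apart.
    rcases m with _ | m
    · simp
    · push_cast
      simp only [pow_succ]
      field_simp
  have := h2.div (h1.const_add 1) h
  refine this.congr_deriv ?_
  have e : r ^ (2 * (m + 1)) = r ^ (2 * (m + 1) - 1) * r := by
    rw [← pow_succ]; congr 1
  unfold psi profile
  rw [e] at h ⊢
  push_cast
  field_simp
  ring

lemma hasDerivAt_en (m : ℕ) {r : ℝ} (hr : 0 < r) :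
    HasDerivAt (en m) (2 * (m + 1) * en m r * psi m r / r) r := by
  have h : en m = fun r => (m + 1) - (m + 1) * psi m r ^ 2 := by
    funext x; linarith [psi_sq_add m x]
  have := (((hasDerivAt_psi m hr).pow 2).const_mul ((m : ℝ) + 1)).const_sub ((m : ℝ) + 1)
  refine (this.congr_of_eventuallyEq (.of_forall fun x => congrFun h x)).congr_deriv ?_
  push_cast
  field_simp

lemma hasDerivAt_psiLog (m : ℕ) {r : ℝ} (hr : 0 < r) :
    HasDerivAt (psiLog m) (-(enLog m r) / r) r := by
  have := ((((Real.hasDerivAt_log hr.ne').const_mul ((m : ℝ) + 1)).mul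
    (hasDerivAt_psi m hr))).const_add 1
  refine this.congr_deriv ?_
  unfold enLog
  field_simp
  ring

lemma hasDerivAt_enLog (m : ℕ) {r : ℝ} (hr : 0 < r) :
    HasDerivAt (enLog m) (2 * (m + 1) * en m r * psiLog m r / r) r := by
  have := (((hasDerivAt_psi m hr).neg).add ((Real.hasDerivAt_log hr.ne').mul
    (hasDerivAt_en m hr))).const_mul ((m : ℝ) + 1)
  refine this.congr_deriv ?_
  unfold psiLog
  field_simp
  ring

lemma psi_zero (m : ℕ) : psi m 0 = 1 := by simp [psi]

lemma en_zero (m : ℕ) : en m 0 = 0 := by simp [en]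

lemma integral_profile_sq (m : ℕ) {r : ℝ} (hr : 0 ≤ r) :
    ∫ s in (0 : ℝ)..r, profile m s ^ 2 * s = 2 * (m + 1) * (1 - psi m r) := by
  have := intervalIntegral.integral_eq_sub_of_hasDerivAt_of_le hr
    (f := fun s => -(2 * (m + 1) * psi m s)) (f' := fun s => profile m s ^ 2 * s)
    (by fun_prop) (fun x hx => ?_) (Continuous.intervalIntegrable (by fun_prop) _ _)
  · rw [this, psi_zero]; ring
  · refine ((hasDerivAt_psi m hx.1).const_mul (2 * ((m : ℝ) + 1))).neg.congr_deriv ?_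
    have := sq_mul_profile_sq m x
    have hx0 := hx.1.ne'
    field_simp
    linarith

lemma norm_Q_sq (m : ℕ) (r : ℝ) : ‖Q m r‖ ^ 2 = profile m r ^ 2 := by
  rw [Q_eq, Complex.norm_real, Real.norm_eq_abs, sq_abs]

lemma Atheta_Q (m : ℕ) {r : ℝ} (hr : 0 ≤ r) :
    Atheta (Q m) r = (m + 1) * psi m r - (m + 1) := by
  unfold Atheta
  simp only [norm_Q_sq]
  rw [integral_profile_sq m hr]
  ring

/-- The coefficient `m + A_θ[Q]` equals `(m + 1) ψ - 1`. -/
lemma add_Atheta_Q (m : ℕ) {r : ℝ} (hr : 0 ≤ r) :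
    (m : ℂ) + Atheta (Q m) r = (((m + 1) * psi m r - 1 : ℝ) : ℂ) := by
  rw [Atheta_Q m hr]; push_cast; ring

lemma hasDerivAt_Q (m : ℕ) {r : ℝ} (hr : 0 < r) :
    HasDerivAt (Q m) ((((m + 1) * psi m r - 1) / r * profile m r : ℝ) : ℂ) r :=
  (hasDerivAt_profile m hr).ofReal_comp

/-- The Bogomolny equation: Q has exactly the logarithmic derivative (m + A_θ[Q])/r. This is what
makes the linearization factorize. -/
lemma Dplus_Q (m : ℕ) {r : ℝ} (hr : 0 < r) : Dplus m (Q m) (Q m) r = 0 := by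
  unfold Dplus
  rw [(hasDerivAt_Q m hr).deriv, add_Atheta_Q m hr.le, Q_eq]
  push_cast; ring

lemma LamQ_eq (m : ℕ) {r : ℝ} (hr : 0 ≤ r) :
    LamQ m r = (((m + 1) * psi m r * profile m r : ℝ) : ℂ) := by
  unfold LamQ Lam
  rcases hr.eq_or_lt with rfl | hr
  -- The value at r = 0 matters because `ext` evaluates the profile at ‖z‖ = 0.
  · rcases m with _ | m <;> simp [Q, psi, profile]
  · rw [(hasDerivAt_Q m hr).deriv, Q_eq]
    have : (r : ℂ) ≠ 0 := by exact_mod_cast hr.ne'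
    push_cast; field_simp; ring

/-- The factorization `𝓛_Q = L_Q^* L_Q`. -/
lemma linOp_eq (m : ℕ) (ε : ℝ → ℂ) {r : ℝ} (hr : 0 < r) :
    linOp m (Q m) ε r = Lstar m (Q m) (L m (Q m) ε) r := by
  unfold linOp Bstar
  have h1 : ∀ g : ℝ → ℂ, ∫ s in Ioi r, (conj (g s) * Dplus m (Q m) (Q m) s).re = 0 := fun g => by
    rw [setIntegral_congr_fun measurableSet_Ioi (g := fun _ => (0 : ℝ))]
    · simp
    · intro s hs
      simp [Dplus_Q m (hr.trans hs)]
  rw [Dplus_Q m hr, h1, h1]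
  simp

/-! ### The measure 2π r dr and improper integrals -/

lemma radDensity_measurable : Measurable fun r : ℝ => ENNReal.ofReal (2 * Real.pi * r) := by
  fun_prop

lemma integral_radMeasure (f : ℝ → ℝ) :
    ∫ r, f r ∂radMeasure = 2 * Real.pi * ∫ r in Ioi (0 : ℝ), f r * r := by
  unfold radMeasure
  rw [integral_withDensity_eq_integral_toReal_smul radDensity_measurable
    (.of_forall fun _ => ENNReal.ofReal_lt_top), ← integral_const_mul]
  refine setIntegral_congr_fun measurableSet_Ioi fun r hr => ?_
  have : 0 ≤ 2 * Real.pi * r := by have := Real.pi_pos; have : 0 < r := hr; positivity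
  simp only [ENNReal.toReal_ofReal this, smul_eq_mul]
  ring

lemma integrable_radMeasure_iff {f : ℝ → ℝ} :
    Integrable f radMeasure ↔ IntegrableOn (fun r => f r * r) (Ioi 0) := by
  unfold radMeasure
  rw [integrable_withDensity_iff_integrable_smul' radDensity_measurable
    (.of_forall fun _ => ENNReal.ofReal_lt_top), IntegrableOn]
  have h : (fun r => (ENNReal.ofReal (2 * Real.pi * r)).toReal • f r)
      =ᵐ[volume.restrict (Ioi 0)] fun r => (2 * Real.pi) * (f r * r) := by
    filter_upwards [ae_restrict_mem measurableSet_Ioi] with r hr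
    have : 0 ≤ 2 * Real.pi * r := by have := Real.pi_pos; have : 0 < r := hr; positivity
    simp only [ENNReal.toReal_ofReal this, smul_eq_mul]
    ring
  rw [integrable_congr h]
  exact integrable_const_mul_iff (Ne.isUnit (by positivity)) _

lemma radMeasure_ac : radMeasure ≪ volume.restrict (Ioi 0) :=
  withDensity_absolutelyContinuous _ _

lemma ac_radMeasure : volume.restrict (Ioi 0) ≪ radMeasure := by
  refine withDensity_absolutelyContinuous' radDensity_measurable.aemeasurable ?_
  filter_upwards [ae_restrict_mem measurableSet_Ioi] with r hr
  have : 0 < 2 * Real.pi * r := by have := Real.pi_pos; have : 0 < r := hr; positivity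
  simpa using this

lemma memLp_radMeasure_iff {E : Type*} [NormedAddCommGroup E] {f : ℝ → E} :
    MemLp f 2 radMeasure ↔ AEStronglyMeasurable f (volume.restrict (Ioi 0)) ∧
      IntegrableOn (fun r => ‖f r‖ ^ 2 * r) (Ioi 0) := by
  constructor
  · intro h
    exact ⟨h.1.mono_ac ac_radMeasure, integrable_radMeasure_iff.1 (h.integrable_norm_pow two_ne_zero)⟩
  · rintro ⟨h1, h2⟩
    have h1' := h1.mono_ac radMeasure_ac
    refine (memLp_two_iff_integrable_sq_norm h1').2 (integrable_radMeasure_iff.2 h2)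

lemma l2norm_sq {f : ℝ → ℂ} (hf : MemLp f 2 radMeasure) :
    l2norm f ^ 2 = 2 * Real.pi * ∫ r in Ioi (0 : ℝ), ‖f r‖ ^ 2 * r := by
  rw [← integral_radMeasure (fun r => ‖f r‖ ^ 2)]
  unfold l2norm
  rw [hf.eLpNorm_eq_integral_rpow_norm two_ne_zero ENNReal.ofNat_ne_top]
  have h0 : 0 ≤ ∫ r, ‖f r‖ ^ 2 ∂radMeasure := integral_nonneg fun r => by positivity
  simp only [ENNReal.toReal_ofNat, Real.rpow_ofNat]
  rw [ENNReal.toReal_ofReal (by positivity), ← Real.rpow_natCast, ← Real.rpow_mul h0]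
  norm_num

lemma hasDerivAt_integral_Ioi {u : ℝ → ℝ} {a r : ℝ} (hu : IntegrableOn u (Ioi a))
    (hc : ContinuousOn u (Ioi a)) (hr : a < r) :
    HasDerivAt (fun x => ∫ s in Ioi x, u s) (-u r) r := by
  obtain ⟨b, hab, hbr⟩ := exists_between hr
  have hb : IntegrableOn u (Ioi b) := hu.mono_set (Ioi_subset_Ioi hab.le)
  have h1 : HasDerivAt (fun x => ∫ s in b..x, u s) (u r) r := by
    refine intervalIntegral.integral_hasDerivAt_right ?_ ?_ (hc.continuousAt (Ioi_mem_nhds hr))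
    · refine (intervalIntegrable_iff_integrableOn_Ioc_of_le hbr.le).2 (hb.mono_set Ioc_subset_Ioi_self)
    · exact hc.stronglyMeasurableAtFilter isOpen_Ioi r hr
  refine (h1.const_sub (∫ s in Ioi b, u s)).congr_of_eventuallyEq ?_
  filter_upwards [Ioi_mem_nhds hbr] with x hx
  rw [← intervalIntegral.integral_Ioi_sub_Ioi hb (le_of_lt hx)]
  ring

lemma tendsto_integral_Ioi {u : ℝ → ℝ} {a : ℝ} (hu : IntegrableOn u (Ioi a)) :
    Tendsto (fun x => ∫ s in Ioi x, u s) atTop (𝓝 0) := by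
  have h := intervalIntegral_tendsto_integral_Ioi a hu tendsto_id
  have := h.const_sub (∫ s in Ioi a, u s)
  rw [sub_self] at this
  refine this.congr' ?_
  filter_upwards [eventually_ge_atTop a] with x hx
  rw [id, ← intervalIntegral.integral_Ioi_sub_Ioi hu hx]
  ring

/-! ### The operators at Q in terms of `psi`, `profile` and `massInt` -/

/-- The primitive `∫₀^r Q Re(f) s ds`, which is `r B_Q f`. -/
def massInt (m : ℕ) (f : ℝ → ℝ) (r : ℝ) : ℝ := ∫ s in (0 : ℝ)..r, profile m s * f s * s

lemma B_Q (m : ℕ) (f : ℝ → ℂ) (r : ℝ) :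
    B (Q m) f r = massInt m (fun s => (f s).re) r / r := by
  unfold B massInt
  simp only [Q_eq, Complex.conj_ofReal, Complex.re_ofReal_mul]
  ring

lemma Lgen_Q (m : ℕ) (f f' : ℝ → ℂ) {r : ℝ} (hr : 0 ≤ r) :
    Lgen m (Q m) f f' r = f' r - (((m + 1) * psi m r - 1) / r : ℝ) * f r
      + (profile m r * (massInt m (fun s => (f s).re) r / r) : ℝ) := by
  unfold Lgen
  rw [add_Atheta_Q m hr, B_Q, Q_eq]
  push_cast
  ring

lemma L_Q (m : ℕ) (f : ℝ → ℂ) {r : ℝ} (hr : 0 ≤ r) :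
    L m (Q m) f r = deriv f r - (((m + 1) * psi m r - 1) / r : ℝ) * f r
      + (profile m r * (massInt m (fun s => (f s).re) r / r) : ℝ) := Lgen_Q m f _ hr

lemma Lstar_Q (m : ℕ) (h : ℝ → ℂ) {r : ℝ} (hr : 0 ≤ r) :
    Lstar m (Q m) h r = -deriv h r - ((m + 1) * psi m r / r : ℝ) * h r
      + (profile m r * ∫ s in Ioi r, profile m s * (h s).re : ℝ) := by
  unfold Lstar Bstar
  rw [add_assoc 1, add_Atheta_Q m hr, Q_eq]
  simp only [Q_eq, Complex.conj_ofReal, Complex.re_ofReal_mul]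
  push_cast
  ring

lemma hasDerivAt_massInt {m : ℕ} {f : ℝ → ℝ} (hf : Continuous f) (r : ℝ) :
    HasDerivAt (massInt m f) (profile m r * f r * r) r := by
  have hc : Continuous fun s => profile m s * f s * s := by fun_prop
  exact intervalIntegral.integral_hasDerivAt_right (hc.intervalIntegrable _ _)
    (hc.stronglyMeasurableAtFilter _ _) hc.continuousAt

lemma massInt_zero (m : ℕ) (f : ℝ → ℝ) : massInt m f 0 = 0 := by simp [massInt]

lemma hasDerivAt_re {f : ℝ → ℂ} {f' : ℂ} {r : ℝ} (h : HasDerivAt f f' r) :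
    HasDerivAt (fun x => (f x).re) f'.re r :=
  Complex.reCLM.hasFDerivAt.comp_hasDerivAt r h

lemma hasDerivAt_im {f : ℝ → ℂ} {f' : ℂ} {r : ℝ} (h : HasDerivAt f f' r) :
    HasDerivAt (fun x => (f x).im) f'.im r :=
  Complex.imCLM.hasFDerivAt.comp_hasDerivAt r h

/-! ### Formal adjointness -/

/-- `L_Q^*` is the formal adjoint of `L_Q` for `(·,·)_r`. -/
lemma rinner_L (m : ℕ) {φ χ : ℝ → ℂ} (hφ : IsTest φ) (hχ : IsTest χ) :
    rinner (L m (Q m) φ) χ = rinner φ (Lstar m (Q m) χ) := by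
  obtain ⟨p1, p2, -⟩ := hφ
  obtain ⟨c1, c2, -⟩ := hχ
  have dφ : ∀ r, HasDerivAt φ (deriv φ r) r := fun r =>
    (p1.differentiable (by simp)).differentiableAt.hasDerivAt
  have dχ : ∀ r, HasDerivAt χ (deriv χ r) r := fun r =>
    (c1.differentiable (by simp)).differentiableAt.hasDerivAt
  have cφ := p1.continuous
  have cχ := c1.continuous
  have cφ' : Continuous (deriv φ) := p1.continuous_deriv (by simp)
  have cχ' : Continuous (deriv χ) := c1.continuous_deriv (by simp)
  set T : ℝ → ℝ := massInt m fun s => (φ s).re with hT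
  set H : ℝ → ℝ := fun r => ∫ s in Ioi r, profile m s * (χ s).re with hH
  have dT : ∀ r, HasDerivAt T (profile m r * (φ r).re * r) r := fun r =>
    hasDerivAt_massInt (by fun_prop) r
  have cu : Continuous fun s => profile m s * (χ s).re := by fun_prop
  have su : HasCompactSupport fun s => profile m s * (χ s).re := by
    refine c2.mono fun x hx => ?_
    simp only [Function.mem_support] at hx ⊢
    intro h; simp [h] at hx
  have iu : Integrable fun s => profile m s * (χ s).re := cu.integrable_of_hasCompactSupport su
  have dH : ∀ r, HasDerivAt H (-(profile m r * (χ r).re)) r := fun r =>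
    hasDerivAt_integral_Ioi (a := r - 1) iu.integrableOn cu.continuousOn (by linarith)
  have cT : Continuous T := continuous_iff_continuousAt.2 fun r => (dT r).continuousAt
  have cH : Continuous H := continuous_iff_continuousAt.2 fun r => (dH r).continuousAt
  set f₁ : ℝ → ℝ := fun r => r * (deriv φ r * conj (χ r)).re
    - ((m + 1) * psi m r - 1) * (φ r * conj (χ r)).re + profile m r * T r * (χ r).re with hf₁
  set f₂ : ℝ → ℝ := fun r => -(r * (φ r * conj (deriv χ r)).re)
    - ((m + 1) * psi m r) * (φ r * conj (χ r)).re + r * profile m r * H r * (φ r).re with hf₂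
  have i₁ : Integrable f₁ := by
    refine Continuous.integrable_of_hasCompactSupport (by fun_prop) (c2.mono fun x hx => ?_)
    simp only [Function.mem_support, hf₁] at hx ⊢
    intro h; simp [h] at hx
  have i₂ : Integrable f₂ := by
    refine Continuous.integrable_of_hasCompactSupport (by fun_prop) (p2.mono fun x hx => ?_)
    simp only [Function.mem_support, hf₂] at hx ⊢
    intro h; simp [h] at hx
  have e₁ : ∫ r in Ioi (0 : ℝ), (L m (Q m) φ r * conj (χ r)).re * r = ∫ r in Ioi (0 : ℝ), f₁ r := by
    refine setIntegral_congr_fun measurableSet_Ioi fun r hr => ?_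
    have hr' : r ≠ 0 := (ne_of_gt hr)
    simp only [L_Q m φ (le_of_lt hr), hf₁, ← hT]
    simp only [Complex.mul_re, Complex.add_re, Complex.sub_re, Complex.conj_re, Complex.conj_im,
      Complex.add_im, Complex.sub_im, Complex.ofReal_re, Complex.ofReal_im, Complex.mul_im]
    field_simp
    ring
  have e₂ : ∫ r in Ioi (0 : ℝ), (φ r * conj (Lstar m (Q m) χ r)).re * r
      = ∫ r in Ioi (0 : ℝ), f₂ r := by
    refine setIntegral_congr_fun measurableSet_Ioi fun r hr => ?_
    have hr' : r ≠ 0 := (ne_of_gt hr)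
    simp only [Lstar_Q m χ (le_of_lt hr), hf₂, hH]
    simp only [Complex.mul_re, Complex.add_re, Complex.sub_re, Complex.conj_re, Complex.conj_im,
      Complex.add_im, Complex.sub_im, Complex.ofReal_re, Complex.ofReal_im, Complex.mul_im,
      Complex.neg_re, Complex.neg_im]
    field_simp
    ring
  unfold rinner
  rw [integral_radMeasure, integral_radMeasure, e₁, e₂]
  congr 1
  rw [← sub_eq_zero, ← integral_sub i₁.integrableOn i₂.integrableOn]
  -- `Z` is the boundary term. Its first part comes from integrating r φ' χ̄ by parts, and -T H from
  -- exchanging the two nested integrals, so the integrands differ by exactly Z'.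
  set Z : ℝ → ℝ := fun r => r * ((φ r).re * (χ r).re + (φ r).im * (χ r).im) - T r * H r with hZ
  have dZ : ∀ r ∈ Ioi (0 : ℝ), HasDerivAt Z (f₁ r - f₂ r) r := by
    intro r _
    have a1 := hasDerivAt_re (dφ r)
    have a2 := hasDerivAt_im (dφ r)
    have b1 := hasDerivAt_re (dχ r)
    have b2 := hasDerivAt_im (dχ r)
    refine (((hasDerivAt_id r).mul ((a1.mul b1).add (a2.mul b2))).sub
      ((dT r).mul (dH r))).congr_deriv ?_
    simp only [hf₁, hf₂, Complex.mul_re, Complex.conj_re, Complex.conj_im, id, Pi.add_apply, Pi.mul_apply]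
    ring
  have hZ0 : Z 0 = 0 := by simp [hZ, hT, massInt_zero]
  -- `T` need not vanish at infinity, but `H` does beyond the support of χ.
  have hev : Z =ᶠ[atTop] fun _ => 0 := by
    obtain ⟨R, hR⟩ := (c2.isCompact.isBounded).subset_closedBall 0
    filter_upwards [eventually_gt_atTop R] with r hr
    have hz : ∀ s, R < s → χ s = 0 := fun s hs => by
      by_contra h
      have := hR (subset_tsupport χ h)
      rw [Metric.mem_closedBall, dist_zero_right, Real.norm_eq_abs] at this
      linarith [le_abs_self s]
    have : H r = 0 := by
      rw [hH]
      refine (setIntegral_congr_fun measurableSet_Ioi (g := fun _ => (0 : ℝ)) fun s hs => ?_).trans (by simp)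
      simp [hz s (hr.trans hs)]
    simp [hZ, this, hz r hr]
  have := integral_Ioi_of_hasDerivAt_of_tendsto (a := (0 : ℝ)) (f := Z) (m := 0)
    (by fun_prop) dZ (i₁.sub i₂).integrableOn (tendsto_const_nhds.congr' hev.symm)
  rw [hZ0] at this
  simpa using this

/-! ### Behaviour at infinity and the potential A₀[Q] -/

lemma tendsto_psi (m : ℕ) : Tendsto (psi m) atTop (𝓝 (-1)) := by
  have h : psi m = fun r => 2 / (1 + r ^ (2 * (m + 1))) - 1 := by
    funext r
    have := (den_pos m r).ne'
    unfold psi; field_simp; ring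
  have h1 : Tendsto (fun r : ℝ => 1 + r ^ (2 * (m + 1))) atTop atTop :=
    tendsto_atTop_add_const_left _ _ (tendsto_pow_atTop (by omega))
  rw [h]
  simpa using (h1.const_div_atTop 2).sub_const 1

lemma tendsto_en (m : ℕ) : Tendsto (en m) atTop (𝓝 0) := by
  have h : en m = fun r => (m + 1) - (m + 1) * psi m r ^ 2 := by
    funext x; linarith [psi_sq_add m x]
  rw [h]
  have := (((tendsto_psi m).pow 2).const_mul ((m : ℝ) + 1)).const_sub ((m : ℝ) + 1)
  simpa using this

lemma integrableOn_profile_sq (m : ℕ) :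
    IntegrableOn (fun r => profile m r ^ 2 * r) (Ioi 0) := by
  refine integrableOn_Ioi_deriv_of_nonneg (g := fun s => -(2 * (m + 1) * psi m s))
    (l := -(2 * (m + 1) * (-1))) (Continuous.continuousWithinAt (by fun_prop)) (fun x hx => ?_)
    (fun x hx => ?_) ?_
  · refine ((hasDerivAt_psi m hx).const_mul (2 * ((m : ℝ) + 1))).neg.congr_deriv ?_
    have := sq_mul_profile_sq m x
    have hx0 : x ≠ 0 := ne_of_gt hx
    field_simp
    linarith
  · have : 0 < x := hx
    positivity
  · exact ((tendsto_psi m).const_mul _).neg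

lemma integrableOn_mul_of_sq {f g : ℝ → ℝ} {w : ℝ → ℝ} {s : Set ℝ} (hs : MeasurableSet s)
    (hw : ∀ x ∈ s, 0 ≤ w x)
    (hf : AEStronglyMeasurable f (volume.restrict s))
    (hg : AEStronglyMeasurable g (volume.restrict s))
    (hwm : AEStronglyMeasurable w (volume.restrict s))
    (hf2 : IntegrableOn (fun x => f x ^ 2 * w x) s)
    (hg2 : IntegrableOn (fun x => g x ^ 2 * w x) s) :
    IntegrableOn (fun x => f x * g x * w x) s := by
  refine Integrable.mono' (hf2.add hg2) ((hf.mul hg).mul hwm) ?_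
  filter_upwards [ae_restrict_mem hs] with x hx
  have := hw x hx
  rw [Real.norm_eq_abs, abs_mul, abs_mul, abs_of_nonneg this]
  simp only [Pi.add_apply]
  rw [← add_mul]
  refine mul_le_mul_of_nonneg_right ?_ this
  nlinarith [sq_nonneg (|f x| - |g x|), sq_abs (f x), sq_abs (g x), abs_nonneg (f x),
    abs_nonneg (g x)]

/-- A weighted integrable function remains integrable, away from the origin, after removing
the weight and multiplying by a bounded continuous function. -/
lemma integrableOn_bdd_mul_of_radial {b u : ℝ → ℝ} {r C : ℝ} (hr : 0 < r)
    (hu : IntegrableOn (fun x => u x * x) (Ioi 0)) (hb : ContinuousOn b (Ioi r))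
    (hC : ∀ x ∈ Ioi r, |b x| ≤ C) : IntegrableOn (fun x => b x * u x) (Ioi r) := by
  have h1 : IntegrableOn (fun x => u x * x) (Ioi r) := hu.mono_set (Ioi_subset_Ioi hr.le)
  have h2 : IntegrableOn (fun x => (b x / x) * (u x * x)) (Ioi r) := by
    refine Integrable.bdd_mul (c := C / r) h1 ?_ ?_
    · refine ContinuousOn.aestronglyMeasurable (hb.div continuousOn_id fun x hx => ?_)
        measurableSet_Ioi
      exact (hr.trans hx).ne'
    · filter_upwards [ae_restrict_mem measurableSet_Ioi] with x hx
      have hx0 : 0 < x := hr.trans hx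
      rw [Real.norm_eq_abs, abs_div, abs_of_pos hx0]
      exact div_le_div₀ ((abs_nonneg _).trans (hC x hx)) (hC x hx) hr (le_of_lt hx)
  refine h2.congr_fun (fun x hx => ?_) measurableSet_Ioi
  have hx0 : x ≠ 0 := (hr.trans hx).ne'
  simp only
  field_simp

lemma abs_intervalIntegral_le_integral_Ioi {u : ℝ → ℝ} (hu : IntegrableOn u (Ioi 0)) {r : ℝ}
    (hr : 0 ≤ r) : |∫ s in (0 : ℝ)..r, u s| ≤ ∫ s in Ioi (0 : ℝ), |u s| := by
  refine (intervalIntegral.abs_integral_le_integral_abs hr).trans ?_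
  rw [intervalIntegral.integral_of_le hr]
  exact setIntegral_mono_set hu.abs (.of_forall fun x => abs_nonneg _)
    (Ioc_subset_Ioi_self.eventuallyLE)

lemma contDiff_Q (m : ℕ) : ContDiff ℝ ∞ (Q m) :=
  Complex.ofRealCLM.contDiff.comp (contDiff_profile m)

/-- `A₀[Q] = Q² / 2`. -/
lemma Azero_Q (m : ℕ) {r : ℝ} (hr : 0 < r) : Azero m (Q m) r = profile m r ^ 2 / 2 := by
  unfold Azero
  simp only [norm_Q_sq]
  have hi := integrableOn_profile_sq m
  -- By the Bogomolny equation (m + A_θ[Q])Q²/x is half the derivative of Q², so the defining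
  -- integral telescopes.
  have hd : ∀ x ∈ Ioi r, HasDerivAt (fun x => profile m x ^ 2)
      (2 * (((m + 1) * psi m x - 1) / x) * profile m x ^ 2) x := fun x hx => by
    refine ((hasDerivAt_profile m (hr.trans hx)).pow 2).congr_deriv ?_
    push_cast; ring
  have hb : IntegrableOn (fun x => (2 * (((m + 1) * psi m x - 1) / x)) * profile m x ^ 2)
      (Ioi r) := by
    refine integrableOn_bdd_mul_of_radial (C := 2 * ((m + 2) / r)) hr hi ?_ fun x hx => ?_
    · refine ContinuousOn.mul continuousOn_const (ContinuousOn.div (by fun_prop) continuousOn_id ?_)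
      exact fun x hx => (hr.trans hx).ne'
    · have hx0 : 0 < x := hr.trans hx
      rw [abs_mul, abs_div, abs_of_pos hx0, abs_two]
      have h1 := abs_le.1 (abs_psi_le m x)
      have hm : (0 : ℝ) ≤ m := Nat.cast_nonneg m
      have : |((m : ℝ) + 1) * psi m x - 1| ≤ m + 2 := by
        rw [abs_le]; constructor <;> nlinarith [h1.1, h1.2]
      gcongr
      exact le_of_lt hx
  have h1 : IntegrableOn (fun x => profile m x ^ 2) (Ioi r) := by
    simpa using integrableOn_bdd_mul_of_radial (b := fun _ => 1) (C := 1) hr hi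
      continuousOn_const (by simp)
  have := integral_Ioi_of_hasDerivAt_of_tendsto (a := r) (f := fun x => profile m x ^ 2)
    (Continuous.continuousWithinAt (by fun_prop)) hd hb
    (tendsto_zero_of_hasDerivAt_of_integrableOn_Ioi hd hb h1)
  have h2 : ∫ s in Ioi r, (m + Atheta (Q m) s) * profile m s ^ 2 / s
      = 2⁻¹ * ∫ x in Ioi r, 2 * (((m + 1) * psi m x - 1) / x) * profile m x ^ 2 := by
    rw [← integral_const_mul]
    refine setIntegral_congr_fun measurableSet_Ioi fun x hx => ?_
    rw [Atheta_Q m (hr.trans hx).le]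
    ring
  rw [h2, this]
  ring

/-! ### Linearization of the equation at Q -/

lemma norm_perturb_sq (q s : ℝ) (z : ℂ) :
    ‖(q : ℂ) + (s : ℂ) * z‖ ^ 2 = q ^ 2 + s * (2 * (q * z.re)) + s ^ 2 * ‖z‖ ^ 2 := by
  rw [← Complex.normSq_eq_norm_sq, ← Complex.normSq_eq_norm_sq, Complex.normSq_apply,
    Complex.normSq_apply]
  simp
  ring

lemma Atheta_perturb (m : ℕ) {ε : ℝ → ℂ} (hε : Continuous ε) (s x : ℝ) :
    Atheta (fun y => Q m y + (s : ℂ) * ε y) x = Atheta (Q m) x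
      - s * massInt m (fun y => (ε y).re) x + s ^ 2 * Atheta ε x := by
  unfold Atheta massInt
  simp only [Q_eq, norm_perturb_sq, Complex.norm_real, Real.norm_eq_abs, sq_abs]
  have h : ∀ y : ℝ, (profile m y ^ 2 + s * (2 * (profile m y * (ε y).re)) + s ^ 2 * ‖ε y‖ ^ 2) * y
      = profile m y ^ 2 * y + (2 * s) * (profile m y * (ε y).re * y)
        + s ^ 2 * (‖ε y‖ ^ 2 * y) := fun y => by ring
  simp only [h]
  rw [intervalIntegral.integral_add, intervalIntegral.integral_add,
    intervalIntegral.integral_const_mul, intervalIntegral.integral_const_mul]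
  · ring
  all_goals exact Continuous.intervalIntegrable (by fun_prop) _ _

lemma Lap_perturb (m : ℕ) {ε : ℝ → ℂ} (hε : ContDiff ℝ 2 ε) (s r : ℝ) :
    Lap m (fun y => Q m y + (s : ℂ) * ε y) r = Lap m (Q m) r + s * Lap m ε r := by
  have hQ : ContDiff ℝ 2 (Q m) := contDiff_infty.1 (contDiff_Q m) 2
  have dQ := hQ.differentiable (by simp)
  have dε := hε.differentiable (by simp)
  have hQ' : ContDiff ℝ 1 (deriv (Q m)) := (contDiff_succ_iff_deriv (n := 1).1 hQ).2.2
  have hε' : ContDiff ℝ 1 (deriv ε) := (contDiff_succ_iff_deriv (n := 1).1 hε).2.2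
  have h1 : deriv (fun y => Q m y + (s : ℂ) * ε y) = fun y => deriv (Q m) y + s * deriv ε y := by
    funext y
    exact ((dQ y).hasDerivAt.add ((dε y).hasDerivAt.const_mul (s : ℂ))).deriv
  have h2 : deriv (deriv (fun y => Q m y + (s : ℂ) * ε y)) r
      = deriv (deriv (Q m)) r + s * deriv (deriv ε) r := by
    rw [h1]
    exact (((hQ'.differentiable (by simp)) r).hasDerivAt.add
      (((hε'.differentiable (by simp)) r).hasDerivAt.const_mul (s : ℂ))).deriv
  unfold Lap
  rw [h2, h1]
  ring

section linearization

variable {m : ℕ} {ε : ℝ → ℂ} {r : ℝ}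

lemma abs_massInt_le (m : ℕ) {f : ℝ → ℝ}
    (hi : IntegrableOn (fun x => profile m x * f x * x) (Ioi 0)) :
    ∃ C, ∀ x, 0 ≤ x → |massInt m f x| ≤ C :=
  ⟨_, fun _ hx => abs_intervalIntegral_le_integral_Ioi hi hx⟩

lemma abs_coef_le (m : ℕ) (x : ℝ) : |((m : ℝ) + 1) * psi m x - 1| ≤ m + 2 := by
  have h1 := abs_le.1 (abs_psi_le m x)
  have hm : (0 : ℝ) ≤ m := Nat.cast_nonneg m
  rw [abs_le]; constructor <;> nlinarith [h1.1, h1.2]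

/-- The linear coefficient of `s ↦ A₀[Q + s ε]`. -/
def AzeroLin (m : ℕ) (ε : ℝ → ℂ) (r : ℝ) : ℝ :=
  ∫ x in Ioi r, (profile m x ^ 2 * massInt m (fun y => (ε y).re) x
    - 2 * ((m + 1) * psi m x - 1) * (profile m x * (ε x).re)) / x

lemma integrableOn_profile_mul_re (hc : Continuous ε) (h2 : IntegrableOn (fun x => ‖ε x‖ ^ 2 * x) (Ioi 0)) :
    IntegrableOn (fun x => profile m x * (ε x).re * x) (Ioi 0) := by
  refine integrableOn_mul_of_sq measurableSet_Ioi (fun x hx => le_of_lt hx)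
    (Continuous.aestronglyMeasurable (by fun_prop))
    (Continuous.aestronglyMeasurable (by fun_prop))
    (Continuous.aestronglyMeasurable (by fun_prop)) (integrableOn_profile_sq m) ?_
  refine Integrable.mono' h2 (Continuous.aestronglyMeasurable (by fun_prop)) ?_
  filter_upwards [ae_restrict_mem measurableSet_Ioi] with x hx
  have hx0 : 0 < x := hx
  rw [Real.norm_eq_abs, abs_of_nonneg (by positivity)]
  gcongr ?_ * x
  rw [← sq_abs]
  gcongr
  exact Complex.abs_re_le_norm _

/-- Both |Q + sε|² and A_θ[Q + sε] are quadratic in s, so A₀[Q + sε](r) is a polynomial of degree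
four in s. Its coefficients are convergent integrals, so nothing has to be differentiated under the
integral sign. -/
lemma hasDerivAt_Azero (hε : Continuous ε) (h2 : IntegrableOn (fun x => ‖ε x‖ ^ 2 * x) (Ioi 0))
    (hr : 0 < r) :
    HasDerivAt (fun s : ℝ => Azero m (fun x => Q m x + (s : ℂ) * ε x) r) (AzeroLin m ε r) 0 := by
  set T := massInt m fun y => (ε y).re with hT
  set c : ℝ → ℝ := fun x => (m + 1) * psi m x - 1 with hc
  set q := profile m with hq
  have cT : Continuous T := continuous_iff_continuousAt.2 fun x =>
    (hasDerivAt_massInt (by fun_prop) x).continuousAt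
  have cA : Continuous (Atheta ε) := by
    unfold Atheta
    exact continuous_const.mul (intervalIntegral.continuous_primitive
      (fun a b => Continuous.intervalIntegrable (by fun_prop) _ _) 0)
  have cq : Continuous q := continuous_profile m
  have cc : Continuous c := by rw [hc]; fun_prop
  have i0 := integrableOn_profile_sq m
  have i1 : IntegrableOn (fun x => q x * (ε x).re * x) (Ioi 0) := integrableOn_profile_mul_re hε h2
  obtain ⟨CT, hCT⟩ := abs_massInt_le m i1
  obtain ⟨CA, hCA⟩ : ∃ C, ∀ x, 0 ≤ x → |Atheta ε x| ≤ C := by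
    refine ⟨1 / 2 * ∫ x in Ioi (0 : ℝ), |‖ε x‖ ^ 2 * x|, fun x hx => ?_⟩
    unfold Atheta
    have := abs_intervalIntegral_le_integral_Ioi h2 hx
    have e : |(-(1 / 2) : ℝ)| = 1 / 2 := by norm_num
    rw [abs_mul, e]
    linarith
  -- Every coefficient is a bounded function times Q², Q Re ε or |ε|², all integrable against x dx.
  -- On (r, ∞) the weight x may be replaced by 1/x at the cost of a constant.
  have key : ∀ {b u : ℝ → ℝ}, Continuous b → (∃ C, ∀ x, 0 ≤ x → |b x| ≤ C) →
      IntegrableOn (fun x => u x * x) (Ioi 0) → IntegrableOn (fun x => b x * u x / x) (Ioi r) := by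
    rintro b u hb ⟨C, hC⟩ hu
    have : IntegrableOn (fun x => (b x / x) * u x) (Ioi r) := by
      refine integrableOn_bdd_mul_of_radial (C := C / r) hr hu
        (hb.continuousOn.div continuousOn_id fun x hx => (hr.trans hx).ne') fun x hx => ?_
      have hx0 : 0 < x := hr.trans hx
      rw [abs_div, abs_of_pos hx0]
      exact div_le_div₀ ((abs_nonneg _).trans (hC x hx0.le)) (hC x hx0.le) hr (le_of_lt hx)
    refine this.congr_fun (fun x _ => ?_) measurableSet_Ioi
    ring
  have bc : ∃ C, ∀ x, 0 ≤ x → |c x| ≤ C := ⟨_, fun x _ => abs_coef_le m x⟩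
  have bT : ∃ C, ∀ x, 0 ≤ x → |T x| ≤ C := ⟨CT, hCT⟩
  have bA : ∃ C, ∀ x, 0 ≤ x → |Atheta ε x| ≤ C := ⟨CA, hCA⟩
  have c0 := key cc bc i0
  have c1 := key cc bc i1
  have c2 := key cc bc h2
  have t0 := key cT bT i0
  have t1 := key cT bT i1
  have t2 := key cT bT h2
  have a0 := key cA bA i0
  have a1 := key cA bA i1
  have a2 := key cA bA h2
  have hpoly : ∀ s : ℝ, Azero m (fun x => Q m x + (s : ℂ) * ε x) r
      = -(∫ x in Ioi r, c x * q x ^ 2 / x)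
        + s * AzeroLin m ε r
        + s ^ 2 * (-(∫ x in Ioi r, (c x * ‖ε x‖ ^ 2 / x - 2 * (T x * (q x * (ε x).re) / x)
            + Atheta ε x * q x ^ 2 / x)))
        + s ^ 3 * (-(∫ x in Ioi r, (2 * (Atheta ε x * (q x * (ε x).re) / x)
            - T x * ‖ε x‖ ^ 2 / x)))
        + s ^ 4 * (-(∫ x in Ioi r, Atheta ε x * ‖ε x‖ ^ 2 / x)) := by
    intro s
    have e1 : Azero m (fun x => Q m x + (s : ℂ) * ε x) r
        = -∫ x in Ioi r, (c x * q x ^ 2 / x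
          + s * (-(((T x * q x ^ 2 / x) - 2 * (c x * (q x * (ε x).re) / x))))
          + s ^ 2 * (c x * ‖ε x‖ ^ 2 / x - 2 * (T x * (q x * (ε x).re) / x)
            + Atheta ε x * q x ^ 2 / x)
          + s ^ 3 * (2 * (Atheta ε x * (q x * (ε x).re) / x) - T x * ‖ε x‖ ^ 2 / x)
          + s ^ 4 * (Atheta ε x * ‖ε x‖ ^ 2 / x)) := by
      unfold Azero
      congr 1
      refine setIntegral_congr_fun measurableSet_Ioi fun x hx => ?_
      have hx0 : 0 < x := hr.trans hx
      simp only
      rw [Atheta_perturb m hε, Q_eq, norm_perturb_sq, Atheta_Q m hx0.le]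
      simp only [← hT, hc, ← hq]
      ring
    have e2 : AzeroLin m ε r
        = ∫ x in Ioi r, ((T x * q x ^ 2 / x) - 2 * (c x * (q x * (ε x).re) / x)) := by
      unfold AzeroLin
      refine setIntegral_congr_fun measurableSet_Ioi fun x hx => ?_
      simp only [← hT, hc, ← hq]
      ring
    have j1 := t0.sub (c1.const_mul 2)
    have j2 := (c2.sub (t1.const_mul 2)).add a0
    have j3 := (a1.const_mul 2).sub t2
    rw [e1, e2, integral_add, integral_add, integral_add, integral_add, integral_const_mul,
      integral_const_mul, integral_const_mul, integral_const_mul, integral_neg]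
    · ring
    · exact c0
    · exact j1.neg.const_mul s
    · exact c0.add (j1.neg.const_mul s)
    · exact j2.const_mul _
    · exact (c0.add (j1.neg.const_mul s)).add (j2.const_mul _)
    · exact j3.const_mul _
    · exact ((c0.add (j1.neg.const_mul s)).add (j2.const_mul _)).add (j3.const_mul _)
    · exact a2.const_mul _
  rw [funext hpoly]
  have hs := hasDerivAt_id (0 : ℝ)
  have := (((((hasDerivAt_const (0 : ℝ) (-(∫ x in Ioi r, c x * q x ^ 2 / x))).add
    (hs.mul_const (AzeroLin m ε r))).add ((hs.pow 2).mul_const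
      (-(∫ x in Ioi r, (c x * ‖ε x‖ ^ 2 / x - 2 * (T x * (q x * (ε x).re) / x)
            + Atheta ε x * q x ^ 2 / x))))).add ((hs.pow 3).mul_const
        (-(∫ x in Ioi r, (2 * (Atheta ε x * (q x * (ε x).re) / x)
            - T x * ‖ε x‖ ^ 2 / x))))).add ((hs.pow 4).mul_const
          (-(∫ x in Ioi r, Atheta ε x * ‖ε x‖ ^ 2 / x))))
  exact this.congr_deriv (by simp)

/-- Integrating (Q Re ε)' over (r, ∞) replaces Q Re ∂_r ε by the boundary value and a second copy of
the potential term. This yields the factor 2 in `AzeroLin`, so the nonlocal part of L_Q^* L_Q is the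
variation of A₀ up to a local term. -/
lemma integral_profile_mul_L (hε : ContDiff ℝ 2 ε)
    (h2 : IntegrableOn (fun x => ‖ε x‖ ^ 2 * x) (Ioi 0))
    (h2' : IntegrableOn (fun x => ‖deriv ε x‖ ^ 2 * x) (Ioi 0)) (hr : 0 < r) :
    ∫ x in Ioi r, profile m x * (L m (Q m) ε x).re
      = AzeroLin m ε r - profile m r * (ε r).re := by
  have cε := hε.continuous
  have cε' : Continuous (deriv ε) := hε.continuous_deriv (by simp)
  have dε : ∀ x, HasDerivAt ε (deriv ε x) x := fun x =>
    (hε.differentiable (by simp)).differentiableAt.hasDerivAt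
  set T := massInt m fun y => (ε y).re with hT
  have cT : Continuous T := continuous_iff_continuousAt.2 fun x =>
    (hasDerivAt_massInt (by fun_prop) x).continuousAt
  have i0 := integrableOn_profile_sq m
  have i1 : IntegrableOn (fun x => profile m x * (ε x).re * x) (Ioi 0) :=
    integrableOn_profile_mul_re cε h2
  have i1' : IntegrableOn (fun x => profile m x * (deriv ε x).re * x) (Ioi 0) :=
    integrableOn_profile_mul_re cε' h2'
  obtain ⟨CT, hCT⟩ := abs_massInt_le m i1
  have cdiv : ∀ {b : ℝ → ℝ}, Continuous b → ContinuousOn (fun x => b x / x) (Ioi r) := fun hb =>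
    hb.continuousOn.div continuousOn_id fun x hx => (hr.trans hx).ne'
  have bdiv : ∀ {b : ℝ → ℝ} {C : ℝ}, (∀ x, 0 ≤ x → |b x| ≤ C) → ∀ x ∈ Ioi r, |b x / x| ≤ C / r := by
    intro b C hC x hx
    have hx0 : 0 < x := hr.trans hx
    rw [abs_div, abs_of_pos hx0]
    exact div_le_div₀ ((abs_nonneg _).trans (hC x hx0.le)) (hC x hx0.le) hr (le_of_lt hx)
  have j1 : IntegrableOn (fun x => ((m + 1) * psi m x - 1) / x * (profile m x * (ε x).re)) (Ioi r) :=
    integrableOn_bdd_mul_of_radial hr i1 (cdiv (by fun_prop)) (bdiv fun x _ => abs_coef_le m x)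
  have j2 : IntegrableOn (fun x => T x / x * profile m x ^ 2) (Ioi r) :=
    integrableOn_bdd_mul_of_radial hr i0 (cdiv cT) (bdiv hCT)
  have j3 : IntegrableOn (fun x => profile m x * (deriv ε x).re) (Ioi r) := by
    simpa using integrableOn_bdd_mul_of_radial (b := fun _ => 1) (C := 1) hr i1'
      continuousOn_const (by simp)
  have j4 : IntegrableOn (fun x => profile m x * (ε x).re) (Ioi r) := by
    simpa using integrableOn_bdd_mul_of_radial (b := fun _ => 1) (C := 1) hr i1
      continuousOn_const (by simp)
  have hd : ∀ x ∈ Ioi r, HasDerivAt (fun x => profile m x * (ε x).re)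
      (((m + 1) * psi m x - 1) / x * (profile m x * (ε x).re) + profile m x * (deriv ε x).re) x :=
    fun x hx => by
      refine ((hasDerivAt_profile m (hr.trans hx)).mul (hasDerivAt_re (dε x))).congr_deriv ?_
      ring
  have h0 := integral_Ioi_of_hasDerivAt_of_tendsto
    (Continuous.continuousWithinAt (by fun_prop)) hd (j1.add j3)
    (tendsto_zero_of_hasDerivAt_of_integrableOn_Ioi hd (j1.add j3) j4)
  have e1 : ∫ x in Ioi r, profile m x * (L m (Q m) ε x).re
      = ∫ x in Ioi r, ((((m + 1) * psi m x - 1) / x * (profile m x * (ε x).re)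
          + profile m x * (deriv ε x).re)
        + (T x / x * profile m x ^ 2
          - 2 * (((m + 1) * psi m x - 1) / x * (profile m x * (ε x).re)))) := by
    refine setIntegral_congr_fun measurableSet_Ioi fun x hx => ?_
    rw [L_Q m ε (hr.trans hx).le, ← hT]
    simp only [Complex.add_re, Complex.sub_re, Complex.ofReal_re, Complex.re_ofReal_mul]
    ring
  have e2 : AzeroLin m ε r = ∫ x in Ioi r, (T x / x * profile m x ^ 2
          - 2 * (((m + 1) * psi m x - 1) / x * (profile m x * (ε x).re))) := by
    refine setIntegral_congr_fun measurableSet_Ioi fun x hx => ?_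
    simp only [← hT]
    ring
  have j5 := j2.sub (j1.const_mul 2)
  have j6 := j1.add j3
  rw [e1, e2, integral_add, h0]
  · ring
  · exact j6
  · exact j5

/-- The operator `𝓛_Q` is the linearization of the equation at `Q`. -/
lemma hasDerivAt_cssRHS (hε : ContDiff ℝ 2 ε) (h1 : MemLp ε 2 radMeasure)
    (h1' : MemLp (deriv ε) 2 radMeasure) (hr : 0 < r) :
    HasDerivAt (fun s : ℝ => cssRHS m (fun x => Q m x + (s : ℂ) * ε x) r)
      (linOp m (Q m) ε r) 0 := by
  have h2 := (memLp_radMeasure_iff.1 h1).2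
  have h2' := (memLp_radMeasure_iff.1 h1').2
  have cε := hε.continuous
  have dε : ∀ x, HasDerivAt ε (deriv ε x) x := fun x =>
    (hε.differentiable (by simp)).differentiableAt.hasDerivAt
  have hε' : ContDiff ℝ 1 (deriv ε) := (contDiff_succ_iff_deriv (n := 1).1 hε).2.2
  have dε' : HasDerivAt (deriv ε) (deriv (deriv ε) r) r :=
    ((hε'.differentiable (by simp)) r).hasDerivAt
  set T := massInt m fun y => (ε y).re with hT
  have hs := hasDerivAt_id (0 : ℝ)
  have hs' : HasDerivAt (fun s : ℝ => (s : ℂ)) 1 0 := by simpa using hs.ofReal_comp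
  have hLap := (hs'.mul_const (Lap m ε r)).const_add (Lap m (Q m) r)
  have hu := (hs'.mul_const (ε r)).const_add (Q m r)
  have hn : HasDerivAt (fun s : ℝ => profile m r ^ 2 + s * (2 * (profile m r * (ε r).re))
      + s ^ 2 * ‖ε r‖ ^ 2) (2 * (profile m r * (ε r).re)) 0 := by
    refine (((hs.mul_const (2 * (profile m r * (ε r).re))).const_add (profile m r ^ 2)).add
      ((hs.pow 2).mul_const (‖ε r‖ ^ 2))).congr_deriv ?_
    simp
  have hA : HasDerivAt (fun s : ℝ => Atheta (Q m) r - s * T r + s ^ 2 * Atheta ε r) (-T r) 0 := by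
    refine (((hs.mul_const (T r)).const_sub (Atheta (Q m) r)).add
      ((hs.pow 2).mul_const (Atheta ε r))).congr_deriv ?_
    simp
  have hZ := hasDerivAt_Azero (m := m) cε h2 hr
  have hfun : (fun s : ℝ => cssRHS m (fun x => Q m x + (s : ℂ) * ε x) r) = fun s : ℝ =>
      -(Lap m (Q m) r + s * Lap m ε r)
      - ((profile m r ^ 2 + s * (2 * (profile m r * (ε r).re)) + s ^ 2 * ‖ε r‖ ^ 2 : ℝ) : ℂ)
        * (Q m r + s * ε r)
      + 2 * m / r ^ 2 * ((Atheta (Q m) r - s * T r + s ^ 2 * Atheta ε r : ℝ) : ℂ)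
        * (Q m r + s * ε r)
      + ((Atheta (Q m) r - s * T r + s ^ 2 * Atheta ε r : ℝ) : ℂ) ^ 2 / r ^ 2
        * (Q m r + s * ε r)
      + (Azero m (fun x => Q m x + (s : ℂ) * ε x) r : ℂ) * (Q m r + s * ε r) := by
    funext s
    unfold cssRHS
    rw [Lap_perturb m hε, Atheta_perturb m cε]
    rw [show ((‖Q m r + (s : ℂ) * ε r‖ : ℂ)) ^ 2 = ((‖Q m r + (s : ℂ) * ε r‖ ^ 2 : ℝ) : ℂ) by
      push_cast; rfl, Q_eq, norm_perturb_sq, ← Q_eq]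
  rw [hfun]
  have total := (((hLap.neg.sub (hn.ofReal_comp.mul hu)).add
    ((hA.ofReal_comp.const_mul (2 * (m : ℂ) / r ^ 2)).mul hu)).add
    (((hA.ofReal_comp.pow 2).div_const ((r : ℂ) ^ 2)).mul hu)).add (hZ.ofReal_comp.mul hu)
  refine total.congr_deriv ?_
  have dL : HasDerivAt (L m (Q m) ε) (deriv (deriv ε) r
      - ((((m + 1) * (-(en m r) / r) * r - ((m + 1) * psi m r - 1)) / r ^ 2 : ℝ) * ε r
        + (((m + 1) * psi m r - 1) / r : ℝ) * deriv ε r)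
      + ((((m + 1) * psi m r - 1) / r * profile m r * (T r / r)
        + profile m r * ((profile m r * (ε r).re * r * r - T r) / r ^ 2) : ℝ) : ℂ)) r := by
    have c1 : HasDerivAt (fun x => ((m + 1) * psi m x - 1) / x)
        (((m + 1) * (-(en m r) / r) * r - ((m + 1) * psi m r - 1)) / r ^ 2) r := by
      refine ((((hasDerivAt_psi m hr).const_mul ((m : ℝ) + 1)).sub_const 1).div
        (hasDerivAt_id r) hr.ne').congr_deriv ?_
      simp
    have c2 : HasDerivAt (fun x => profile m x * (T x / x))
        (((m + 1) * psi m r - 1) / r * profile m r * (T r / r)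
        + profile m r * ((profile m r * (ε r).re * r * r - T r) / r ^ 2)) r := by
      refine ((hasDerivAt_profile m hr).mul
        ((hasDerivAt_massInt (f := fun y => (ε y).re) (by fun_prop) r).div
          (hasDerivAt_id r) hr.ne')).congr_deriv ?_
      simp [hT]
    refine ((dε'.sub (c1.ofReal_comp.mul (dε r))).add c2.ofReal_comp).congr_of_eventuallyEq ?_
    filter_upwards [Ioi_mem_nhds hr] with x hx
    rw [L_Q m ε (le_of_lt hx)]
    rfl
  rw [linOp_eq m ε hr, Lstar_Q m _ hr.le, dL.deriv, integral_profile_mul_L hε h2 h2' hr,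
    L_Q m ε hr.le, ← hT]
  have hz0 : Azero m (fun x => Q m x + ((0 : ℝ) : ℂ) * ε x) r = profile m r ^ 2 / 2 := by
    rw [← Azero_Q m hr]
    congr 1
    funext x; simp
  have hq : (profile m r : ℂ) ^ 2 * (r : ℂ) ^ 2 = 2 * (m + 1) * (en m r : ℂ) := by
    have := sq_mul_profile_sq m r
    rw [mul_comm]
    exact_mod_cast this
  have hr0 : (r : ℂ) ≠ 0 := by exact_mod_cast hr.ne'
  rw [hz0, Atheta_Q m hr.le]
  unfold Lap
  simp only [Q_eq]
  push_cast
  simp only [zero_mul, add_zero, sub_zero, one_mul, ne_eq, OfNat.ofNat_ne_zero,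
    not_false_eq_true, zero_pow, Pi.pow_apply, Complex.ofReal_zero]
  field_simp
  -- All nonlocal terms already agree; what is left is a multiple of r²Q² = 2(m+1) en.
  linear_combination (-ε r) * hq

end linearization

/-! ### Variation of constants for classical solutions -/

lemma const_of_hasDerivAt_zero {f : ℝ → ℝ} (h : ∀ r, 0 < r → HasDerivAt f 0 r) :
    ∀ r, 0 < r → f r = f 1 := by
  intro r hr
  have := (convex_Ioi (0 : ℝ)).norm_image_sub_le_of_norm_hasDerivWithin_le (f := f)
    (f' := fun _ => 0) (C := 0) (fun x hx => (h x hx).hasDerivWithinAt) (by simp)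
    (show (1 : ℝ) ∈ Ioi 0 by simp) (show r ∈ Ioi 0 from hr)
  simpa [sub_eq_zero] using this

lemma eq_of_hasDerivAt_zero_of_tendsto {f : ℝ → ℝ} {l : ℝ} (h : ∀ r, 0 < r → HasDerivAt f 0 r)
    (hl : Tendsto f (𝓝[>] 0) (𝓝 l)) : ∀ r, 0 < r → f r = l := by
  intro r hr
  rw [const_of_hasDerivAt_zero h r hr]
  refine tendsto_nhds_unique (tendsto_const_nhds.congr' ?_) hl
  filter_upwards [self_mem_nhdsWithin] with x hx
  exact (const_of_hasDerivAt_zero h x hx).symm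

section variation

variable {m : ℕ} {f f' h : ℝ → ℝ}

/-- Since D_+Q = 0, division by Q conjugates D_+ to ∂_r. -/
lemma hasDerivAt_div_profile {r v : ℝ} (hr : 0 < r) (hf : HasDerivAt f v r) :
    HasDerivAt (fun x => f x / profile m x)
      ((v - ((m + 1) * psi m r - 1) / r * f r) / profile m r) r := by
  have hq := (profile_pos m hr).ne'
  refine (hf.div (hasDerivAt_profile m hr) hq).congr_deriv ?_
  field_simp

lemma continuous_massInt (hf : Continuous f) : Continuous (massInt m f) :=
  continuous_iff_continuousAt.2 fun x => (hasDerivAt_massInt hf x).continuousAt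

/-- Variation of constants for `f' - r⁻¹ (m + A_θ[Q]) f + Q B_Q f = h`, against `ψ`. -/
lemma hasDerivAt_variation {r v : ℝ} (hr : 0 < r) (hc : Continuous f) (hf : HasDerivAt f v r) :
    HasDerivAt (fun x => f x / profile m x * en m x - massInt m f x * psi m x)
      ((v - ((m + 1) * psi m r - 1) / r * f r + profile m r * (massInt m f r / r))
        * (en m r / profile m r)) r := by
  have hq := (profile_pos m hr).ne'
  refine (((hasDerivAt_div_profile hr hf).mul (hasDerivAt_en m hr)).sub
    ((hasDerivAt_massInt hc r).mul (hasDerivAt_psi m hr))).congr_deriv ?_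
  have := sq_mul_profile_sq m r
  field_simp
  linear_combination (-(f r * psi m r)) * this

/-- Variation of constants against the logarithmic solution. -/
lemma hasDerivAt_variation_log {r v : ℝ} (hr : 0 < r) (hc : Continuous f)
    (hf : HasDerivAt f v r) :
    HasDerivAt (fun x => f x / profile m x * enLog m x - massInt m f x * psiLog m x)
      ((v - ((m + 1) * psi m r - 1) / r * f r + profile m r * (massInt m f r / r))
        * (enLog m r / profile m r)) r := by
  have hq := (profile_pos m hr).ne'
  refine (((hasDerivAt_div_profile hr hf).mul (hasDerivAt_enLog m hr)).sub
    ((hasDerivAt_massInt hc r).mul (hasDerivAt_psiLog m hr))).congr_deriv ?_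
  have := sq_mul_profile_sq m r
  field_simp
  linear_combination (-(f r * psiLog m r)) * this

lemma en_div_profile (m : ℕ) {r : ℝ} (hr : 0 < r) :
    en m r / profile m r = r ^ 2 * profile m r / (2 * (m + 1)) := by
  have := sq_mul_profile_sq m r
  have hq := (profile_pos m hr).ne'
  field_simp
  linarith

/-- The quotient `en / Q` is a multiple of r²Q and `massInt` vanishes at 0. For f continuous up to
the origin this fixes the integration constant in the variation against ψ. -/
lemma tendsto_variation_zero (hc : Continuous f) :
    Tendsto (fun x => f x / profile m x * en m x - massInt m f x * psi m x) (𝓝[>] 0) (𝓝 0) := by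
  have hT := continuous_massInt (m := m) hc
  have h1 : Continuous fun x => f x * (x ^ 2 * profile m x / (2 * (m + 1)))
      - massInt m f x * psi m x := by fun_prop
  have h2 := (h1.tendsto 0).mono_left (nhdsWithin_le_nhds (s := Ioi 0))
  simp only [massInt_zero, ne_eq, OfNat.ofNat_ne_zero, not_false_eq_true, zero_pow, zero_mul,
    zero_div, mul_zero, sub_zero] at h2
  refine h2.congr' ?_
  filter_upwards [self_mem_nhdsWithin] with x hx
  rw [← en_div_profile m hx]
  ring

/-- Real solutions of `L_Q f = 0` that are continuous up to the origin are multiples of `ΛQ`. -/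
lemma eq_mul_of_real_kernel (hc : Continuous f) (hf : ∀ r, 0 < r → HasDerivAt f (f' r) r)
    (h0 : ∀ r, 0 < r → f' r - ((m + 1) * psi m r - 1) / r * f r
      + profile m r * (massInt m f r / r) = 0) :
    ∃ c : ℝ, ∀ r, 0 < r → f r = c * (psi m r * profile m r) := by
  have h1 : ∀ r, 0 < r → f r / profile m r * en m r - massInt m f r * psi m r = 0 := by
    refine eq_of_hasDerivAt_zero_of_tendsto (fun r hr => ?_) (tendsto_variation_zero hc)
    refine (hasDerivAt_variation hr hc (hf r hr)).congr_deriv ?_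
    rw [h0 r hr, zero_mul]
  have h2 := const_of_hasDerivAt_zero (f := fun x => f x / profile m x * enLog m x
    - massInt m f x * psiLog m x) (fun r hr => by
      refine (hasDerivAt_variation_log hr hc (hf r hr)).congr_deriv ?_
      rw [h0 r hr, zero_mul])
  set c := f 1 / profile m 1 * enLog m 1 - massInt m f 1 * psiLog m 1 with hcdef
  refine ⟨-c / (m + 1), fun r hr => ?_⟩
  have hq := (profile_pos m hr).ne'
  have hw := wronskian m r
  have a1 := h1 r hr
  have a2 : f r / profile m r * enLog m r - massInt m f r * psiLog m r = c := h2 r hr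
  -- The two conserved quantities form a linear system for f/Q and the mass; the Wronskian
  -- eliminates the mass.
  have : (m + 1) * (f r / profile m r) = -c * psi m r := by
    linear_combination (-(f r / profile m r)) * hw + psiLog m r * a1 - psi m r * a2
  have hm : (m : ℝ) + 1 ≠ 0 := by positivity
  have e : f r = (f r / profile m r) * profile m r := by field_simp
  rw [e]
  field_simp at this ⊢
  linarith

/-- Real solutions of `D_+ f = 0` are multiples of `Q`. -/
lemma eq_mul_of_imag_kernel (hf : ∀ r, 0 < r → HasDerivAt f (f' r) r)
    (h0 : ∀ r, 0 < r → f' r - ((m + 1) * psi m r - 1) / r * f r = 0) :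
    ∃ c : ℝ, ∀ r, 0 < r → f r = c * profile m r := by
  have h2 := const_of_hasDerivAt_zero (f := fun x => f x / profile m x) (fun r hr => by
      refine (hasDerivAt_div_profile hr (hf r hr)).congr_deriv ?_
      rw [h0 r hr, zero_div])
  refine ⟨f 1 / profile m 1, fun r hr => ?_⟩
  have : f r / profile m r = f 1 / profile m 1 := h2 r hr
  rw [← this, div_mul_cancel₀ _ (profile_pos m hr).ne']

end variation

/-! ### Decoupling into real and imaginary parts -/

lemma L_Q_re (m : ℕ) (f : ℝ → ℂ) {r : ℝ} (hr : 0 ≤ r) :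
    (L m (Q m) f r).re = (deriv f r).re - ((m + 1) * psi m r - 1) / r * (f r).re
      + profile m r * (massInt m (fun s => (f s).re) r / r) := by
  rw [L_Q m f hr]
  simp only [Complex.add_re, Complex.sub_re, Complex.ofReal_re, Complex.re_ofReal_mul]

lemma L_Q_im (m : ℕ) (f : ℝ → ℂ) {r : ℝ} (hr : 0 ≤ r) :
    (L m (Q m) f r).im = (deriv f r).im - ((m + 1) * psi m r - 1) / r * (f r).im := by
  rw [L_Q m f hr]
  simp only [Complex.add_im, Complex.sub_im, Complex.ofReal_im, Complex.im_ofReal_mul, add_zero]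

lemma Lstar_Q_re (m : ℕ) (h : ℝ → ℂ) {r : ℝ} (hr : 0 ≤ r) :
    (Lstar m (Q m) h r).re = -(deriv h r).re - (m + 1) * psi m r / r * (h r).re
      + profile m r * ∫ s in Ioi r, profile m s * (h s).re := by
  rw [Lstar_Q m h hr]
  simp only [Complex.add_re, Complex.sub_re, Complex.neg_re, Complex.ofReal_re,
    Complex.re_ofReal_mul]

lemma Lstar_Q_im (m : ℕ) (h : ℝ → ℂ) {r : ℝ} (hr : 0 ≤ r) :
    (Lstar m (Q m) h r).im = -(deriv h r).im - (m + 1) * psi m r / r * (h r).im := by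
  rw [Lstar_Q m h hr]
  simp only [Complex.add_im, Complex.sub_im, Complex.neg_im, Complex.ofReal_im,
    Complex.im_ofReal_mul, add_zero]

/-! ### Equivariant functions -/

lemma rad_ext (m : ℕ) (g : ℝ → ℂ) {r : ℝ} (hr : 0 ≤ r) : rad (ext m g) r = g r := by
  unfold rad ext
  rw [Complex.arg_ofReal_of_nonneg hr]
  simp [abs_of_nonneg hr]

lemma SmoothEquivariant.eq_rad {m : ℕ} {F : ℂ → ℂ} (hF : SmoothEquivariant m F) {z : ℂ}
    (hz : z ≠ 0) : F z = rad F ‖z‖ * exp (m * arg z * I) := by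
  obtain ⟨-, g, hg⟩ := hF
  have hz' : 0 < ‖z‖ := norm_pos_iff.2 hz
  have h0 := hg ‖z‖ hz' 0
  have h1 := hg ‖z‖ hz' (arg z)
  rw [Complex.norm_mul_exp_arg_mul_I] at h1
  simp at h0
  rw [h1, rad, h0]

lemma SmoothEquivariant.contDiff_rad {m : ℕ} {F : ℂ → ℂ} (hF : SmoothEquivariant m F) :
    ContDiff ℝ ∞ (rad F) := hF.1.comp Complex.ofRealCLM.contDiff

/-- The radial part on (0, ∞) determines F away from 0 by equivariance, and at 0 by continuity. -/
lemma SmoothEquivariant.eq_of_rad {m : ℕ} {F G : ℂ → ℂ} (hF : SmoothEquivariant m F)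
    (hG : SmoothEquivariant m G) (h : ∀ r : ℝ, 0 < r → rad F r = rad G r) : F = G := by
  refine Continuous.ext_on (dense_compl_singleton (0 : ℂ)) hF.1.continuous hG.1.continuous ?_
  intro z hz
  rw [hF.eq_rad hz, hG.eq_rad hz, h _ (norm_pos_iff.2 hz)]

lemma SmoothEquivariant.add {m : ℕ} {F G : ℂ → ℂ} (hF : SmoothEquivariant m F)
    (hG : SmoothEquivariant m G) : SmoothEquivariant m (F + G) := by
  obtain ⟨h1, g, hg⟩ := hF
  obtain ⟨k1, k, hk⟩ := hG
  refine ⟨h1.add k1, g + k, fun r hr θ => ?_⟩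
  simp only [Pi.add_apply, hg r hr θ, hk r hr θ, add_mul]

lemma SmoothEquivariant.smul {m : ℕ} {F : ℂ → ℂ} (c : ℝ) (hF : SmoothEquivariant m F) :
    SmoothEquivariant m (c • F) := by
  obtain ⟨h1, g, hg⟩ := hF
  refine ⟨contDiff_const.smul h1, c • g, fun r hr θ => ?_⟩
  simp only [Pi.smul_apply, hg r hr θ, smul_mul_assoc]

lemma contDiff_norm_pow_even (k : ℕ) : ContDiff ℝ ∞ fun z : ℂ => ‖z‖ ^ (2 * k) := by
  simp only [pow_mul]
  exact (contDiff_norm_sq ℝ).pow k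

/-- The factor r^m of Q combines with e^{imθ} into the smooth function z^m; the denominator depends
only on an even power of ‖z‖. Smoothness of an extension Qg then reduces to that of z ↦ g ‖z‖. -/
lemma ext_profile_mul (m : ℕ) (g : ℝ → ℂ) (z : ℂ) :
    ext m (fun r => (profile m r : ℂ) * g r) z
      = ((Real.sqrt 8 * (m + 1) / (1 + ‖z‖ ^ (2 * (m + 1))) : ℝ) : ℂ) * z ^ m * g ‖z‖ := by
  unfold ext profile
  have h : z ^ m = (‖z‖ : ℂ) ^ m * exp (m * arg z * I) := by
    conv_lhs => rw [← Complex.norm_mul_exp_arg_mul_I z]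
    rw [mul_pow, ← Complex.exp_nat_mul]
    ring_nf
  rw [h]
  push_cast
  ring

lemma smoothEquivariant_ext (m : ℕ) {g : ℝ → ℂ} (hg : ContDiff ℝ ∞ fun z : ℂ => g ‖z‖) :
    SmoothEquivariant m (ext m fun r => (profile m r : ℂ) * g r) := by
  have h1 : ContDiff ℝ ∞ fun z : ℂ => Real.sqrt 8 * (m + 1) / (1 + ‖z‖ ^ (2 * (m + 1))) :=
    contDiff_const.div (contDiff_const.add (contDiff_norm_pow_even _)) fun z => (den_pos m _).ne'
  refine ⟨?_, fun r => (profile m r : ℂ) * g r, fun r hr θ => ?_⟩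
  · rw [funext (ext_profile_mul m g)]
    exact ((Complex.ofRealCLM.contDiff.comp h1).mul (contDiff_id.pow m)).mul hg
  · have hn : ‖(r : ℂ) * exp (θ * I)‖ = r := by
      rw [norm_mul, Complex.norm_exp_ofReal_mul_I, Complex.norm_real, Real.norm_eq_abs,
        abs_of_pos hr, mul_one]
    rw [ext_profile_mul, hn, mul_pow, ← Complex.exp_nat_mul]
    unfold profile
    push_cast
    rw [show (m : ℂ) * (θ * I) = m * θ * I by ring]
    ring

lemma contDiff_psi_norm (m : ℕ) : ContDiff ℝ ∞ fun z : ℂ => psi m ‖z‖ := by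
  unfold psi
  exact (contDiff_const.sub (contDiff_norm_pow_even _)).div
    (contDiff_const.add (contDiff_norm_pow_even _)) fun z => (den_pos m _).ne'

lemma ext_congr (m : ℕ) {f g : ℝ → ℂ} (h : ∀ r, 0 ≤ r → f r = g r) : ext m f = ext m g := by
  funext z
  unfold ext
  rw [h _ (norm_nonneg z)]

lemma smoothEquivariant_iQ (m : ℕ) : SmoothEquivariant m (ext m (iQ m)) := by
  have := smoothEquivariant_ext m (g := fun _ => I) contDiff_const
  refine (ext_congr m fun r _ => ?_) ▸ this
  rw [iQ, Q_eq, mul_comm]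

lemma smoothEquivariant_LamQ (m : ℕ) : SmoothEquivariant m (ext m (LamQ m)) := by
  have := smoothEquivariant_ext m (g := fun r => ((m + 1) * psi m r : ℝ))
    (Complex.ofRealCLM.contDiff.comp (contDiff_const.mul (contDiff_psi_norm m)))
  refine (ext_congr m fun r hr => ?_) ▸ this
  rw [LamQ_eq m hr]
  push_cast; ring

lemma smoothEquivariant_irrQ (m : ℕ) : SmoothEquivariant m (ext m (irrQ m)) := by
  have := smoothEquivariant_ext m (g := fun r => I * (r ^ 2 : ℝ))
    (contDiff_const.mul (Complex.ofRealCLM.contDiff.comp (contDiff_norm_sq ℝ)))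
  refine (ext_congr m fun r hr => ?_) ▸ this
  rw [irrQ, Q_eq]
  push_cast; ring

lemma L_congr (m : ℕ) {f g : ℝ → ℂ} (h : ∀ r, 0 < r → f r = g r) {r : ℝ} (hr : 0 < r) :
    L m (Q m) f r = L m (Q m) g r := by
  rw [L_Q m f hr.le, L_Q m g hr.le, h r hr,
    Filter.EventuallyEq.deriv_eq (show f =ᶠ[𝓝 r] g by
      filter_upwards [Ioi_mem_nhds hr] with x hx using h x hx)]
  congr 4
  unfold massInt
  refine intervalIntegral.integral_congr_ae (.of_forall fun x hx => ?_)
  rw [uIoc_of_le hr.le] at hx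
  simp only [h x hx.1]

lemma Lstar_congr (m : ℕ) {f g : ℝ → ℂ} (h : ∀ r, 0 < r → f r = g r) {r : ℝ} (hr : 0 < r) :
    Lstar m (Q m) f r = Lstar m (Q m) g r := by
  rw [Lstar_Q m f hr.le, Lstar_Q m g hr.le, h r hr,
    Filter.EventuallyEq.deriv_eq (show f =ᶠ[𝓝 r] g by
      filter_upwards [Ioi_mem_nhds hr] with x hx using h x hx)]
  congr 3
  refine setIntegral_congr_fun measurableSet_Ioi fun x hx => ?_
  simp only [h x (hr.trans hx)]

/-- The derivative of `en` is r Q² ψ: in the pair (ψ, en), the second entry is the mass of the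
first. -/
lemma massInt_psi_mul_profile (m : ℕ) {r : ℝ} (hr : 0 ≤ r) :
    massInt m (fun s => psi m s * profile m s) r = en m r := by
  unfold massInt
  rw [intervalIntegral.integral_eq_sub_of_hasDerivAt_of_le hr (f := en m) (by fun_prop)
    (fun x hx => ?_) (Continuous.intervalIntegrable (by fun_prop) _ _), en_zero, sub_zero]
  refine (hasDerivAt_en m hx.1).congr_deriv ?_
  have := sq_mul_profile_sq m x
  have hx0 := hx.1.ne'
  field_simp
  linear_combination (-psi m x) * this

/-- `Q ψ` and `iQ` are annihilated by `L_Q`. -/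
lemma L_kernel (m : ℕ) (a b : ℝ) {r : ℝ} (hr : 0 < r) :
    L m (Q m) (fun r => (b * (psi m r * profile m r) : ℝ) + I * (a * profile m r : ℝ)) r = 0 := by
  have hd : HasDerivAt (fun r => ((b * (psi m r * profile m r) : ℝ) : ℂ) + I * (a * profile m r : ℝ))
      _ r := (((((hasDerivAt_psi m hr).mul (hasDerivAt_profile m hr)).const_mul b).ofReal_comp).add
    ((((hasDerivAt_profile m hr).const_mul a).ofReal_comp).const_mul I))
  apply Complex.ext
  · rw [L_Q_re m _ hr.le, hd.deriv]
    have : massInt m (fun s => (((b * (psi m s * profile m s) : ℝ) : ℂ)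
        + I * (a * profile m s : ℝ)).re) r = b * en m r := by
      rw [← massInt_psi_mul_profile m hr.le]
      unfold massInt
      rw [← intervalIntegral.integral_const_mul]
      congr 1
      funext s
      simp [-Complex.ofReal_mul]
      ring
    rw [this]
    simp [-Complex.ofReal_mul, -Complex.ofReal_add, -Complex.ofReal_div, -Complex.ofReal_neg]
    field_simp
    ring
  · rw [L_Q_im m _ hr.le, hd.deriv]
    simp [-Complex.ofReal_mul, -Complex.ofReal_add, -Complex.ofReal_div, -Complex.ofReal_neg]
    ring

/-- The kernel of `L_Q`. -/
lemma kerL_eq (m : ℕ) :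
    kerL m = (Submodule.span ℝ {ext m (iQ m), ext m (LamQ m)} : Set (ℂ → ℂ)) := by
  have hm : (m : ℝ) + 1 ≠ 0 := by positivity
  have hrad : ∀ (a b r : ℝ), 0 < r → rad (a • ext m (iQ m) + b • ext m (LamQ m)) r
      = (((b * (m + 1)) * (psi m r * profile m r) : ℝ) : ℂ) + I * (a * profile m r : ℝ) := by
    intro a b r hr
    have h1 := rad_ext m (iQ m) hr.le
    have h2 := rad_ext m (LamQ m) hr.le
    unfold rad at h1 h2 ⊢
    simp only [Pi.add_apply, Pi.smul_apply, h1, h2, LamQ_eq m hr.le, iQ, Q_eq, Complex.real_smul]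
    push_cast; ring
  ext F
  simp only [SetLike.mem_coe, Submodule.mem_span_pair]
  constructor
  · rintro ⟨hF, h0⟩
    have hs := hF.contDiff_rad
    have hd : ∀ r, HasDerivAt (rad F) (deriv (rad F) r) r := fun r =>
      (hs.differentiable (by simp)).differentiableAt.hasDerivAt
    have hc := hs.continuous
    -- The real part can only contribute ΛQ and the imaginary part only iQ.
    obtain ⟨b, hb⟩ := eq_mul_of_real_kernel (m := m) (f := fun r => (rad F r).re)
      (f' := fun r => (deriv (rad F) r).re) (by fun_prop) (fun r _ => hasDerivAt_re (hd r))
      (fun r hr => by rw [← L_Q_re m _ hr.le, h0 r hr]; rfl)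
    obtain ⟨a, ha⟩ := eq_mul_of_imag_kernel (m := m) (f := fun r => (rad F r).im)
      (f' := fun r => (deriv (rad F) r).im) (fun r _ => hasDerivAt_im (hd r))
      (fun r hr => by rw [← L_Q_im m _ hr.le, h0 r hr]; rfl)
    refine ⟨a, b / (m + 1), SmoothEquivariant.eq_of_rad
      (((smoothEquivariant_iQ m).smul a).add ((smoothEquivariant_LamQ m).smul _)) hF ?_⟩
    intro r hr
    rw [hrad _ _ _ hr, ← ha r hr, div_mul_cancel₀ _ hm, ← hb r hr, mul_comm I]
    exact Complex.re_add_im _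
  · rintro ⟨a, b, rfl⟩
    refine ⟨((smoothEquivariant_iQ m).smul a).add ((smoothEquivariant_LamQ m).smul _), ?_⟩
    intro r hr
    rw [L_congr m (hrad a b) hr]
    exact L_kernel m a (b * (m + 1)) hr

/-! ### Averages along rays -/

/-- Differentiating in z brings out a factor t, so the derivative is again a ray average, of
`fderiv` φ with weight t^(j+1). The induction therefore has to be general in both the exponent and
the target space. -/
lemma contDiff_ray_average {E : Type} [NormedAddCommGroup E] [NormedSpace ℝ E] [CompleteSpace E]
    (k j : ℕ) {φ : ℂ → E} (hφ : ContDiff ℝ k φ) :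
    ContDiff ℝ k fun z : ℂ => ∫ t in (0 : ℝ)..1, t ^ j • φ (t • z) := by
  induction k generalizing E j with
  | zero =>
    have hc : Continuous φ := hφ.continuous
    refine contDiff_zero.2 (intervalIntegral.continuous_parametric_intervalIntegral_of_continuous' ?_ 0 1)
    fun_prop
  | succ k ih =>
    have hd : Differentiable ℝ φ := hφ.differentiable (by simp)
    have h' : ContDiff ℝ k (fderiv ℝ φ) := by
      have := (contDiff_succ_iff_fderiv (n := k)).1 (by exact_mod_cast hφ)
      exact this.2.2
    have hc : Continuous φ := hφ.continuous
    have hc' : Continuous (fderiv ℝ φ) := h'.continuous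
    rw [Nat.cast_succ]
    refine contDiff_succ_iff_hasFDerivAt.2
      ⟨fun z => ∫ t in (0 : ℝ)..1, t ^ (j + 1) • fderiv ℝ φ (t • z), ih (j + 1) h', fun z => ?_⟩
    -- This ball contains every t • x with 0 ≤ t ≤ 1 and x within 1 of z, so one constant dominates
    -- the integrands.
    obtain ⟨C, hC⟩ := (isCompact_closedBall (0 : ℂ) (‖z‖ + 1)).exists_bound_of_continuousOn
      hc'.continuousOn
    refine intervalIntegral.hasFDerivAt_integral_of_dominated_of_fderiv_le
      (F := fun z t => t ^ j • φ (t • z)) (F' := fun z t => t ^ (j + 1) • fderiv ℝ φ (t • z))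
      (bound := fun _ => C) (s := Metric.ball z 1) (Metric.ball_mem_nhds z one_pos) ?_ ?_ ?_ ?_ ?_ ?_
    · exact .of_forall fun x => Continuous.aestronglyMeasurable (by fun_prop)
    · exact Continuous.intervalIntegrable (by fun_prop) _ _
    · exact Continuous.aestronglyMeasurable (by fun_prop)
    · refine .of_forall fun t ht x hx => ?_
      rw [uIoc_of_le zero_le_one] at ht
      rw [norm_smul, norm_pow, Real.norm_eq_abs, abs_of_pos ht.1]
      have h1 : t ^ (j + 1) ≤ 1 := pow_le_one₀ ht.1.le ht.2
      have h2 : ‖fderiv ℝ φ (t • x)‖ ≤ C := by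
        refine hC _ ?_
        rw [Metric.mem_closedBall, dist_zero_right, norm_smul, Real.norm_eq_abs, abs_of_pos ht.1]
        have : ‖x‖ ≤ ‖z‖ + 1 := by
          have := norm_le_norm_add_norm_sub' x z
          rw [Metric.mem_ball, dist_eq_norm] at hx
          linarith
        nlinarith [norm_nonneg x, ht.2]
      calc t ^ (j + 1) * ‖fderiv ℝ φ (t • x)‖ ≤ 1 * ‖fderiv ℝ φ (t • x)‖ := by gcongr
        _ ≤ C := by linarith
    · exact intervalIntegrable_const
    · refine .of_forall fun t _ x _ => ?_
      have h1 : HasFDerivAt (fun y : ℂ => t • y) (t • ContinuousLinearMap.id ℝ ℂ) x :=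
        (hasFDerivAt_id x).const_smul t
      refine (((hd (t • x)).hasFDerivAt.comp x h1).const_smul (t ^ j)).congr_fderiv ?_
      ext y
      simp [pow_succ, mul_smul]

/-! ### The generalized eigenmode -/

/-- `∫₀^r s E(s) ds / (2(m+1))`. -/
def modeInt (m : ℕ) (r : ℝ) : ℝ := ∫ s in (0 : ℝ)..r, s * en m s / (2 * (m + 1))

/-- `∫₀^r s E_log(s) ds / (2(m+1))`. -/
def modeIntLog (m : ℕ) (r : ℝ) : ℝ := ∫ s in (0 : ℝ)..r, s * enLog m s / (2 * (m + 1))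

/-- The solution `g = ρ / Q` of `g' + r⁻¹ ∫₀^r Q² g s ds = r / (2 (m + 1))` for positive `r`. -/
def modeSol (m : ℕ) (r : ℝ) : ℝ :=
  (psiLog m r * modeInt m r - psi m r * modeIntLog m r) / (m + 1)

/-- The primitive of `r Q² g`. -/
def modeMass (m : ℕ) (r : ℝ) : ℝ :=
  (enLog m r * modeInt m r - en m r * modeIntLog m r) / (m + 1)

lemma continuous_mul_enLog (m : ℕ) : Continuous fun s => s * enLog m s / (2 * (m + 1)) := by
  have h := Real.continuous_mul_log
  have : (fun s => s * enLog m s / (2 * (m + 1)))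
      = fun s => (m + 1) * (-(s * psi m s) + (s * Real.log s) * en m s) / (2 * (m + 1)) := by
    funext s; unfold enLog; ring
  rw [this]
  fun_prop

lemma continuous_mul_en (m : ℕ) : Continuous fun s => s * en m s / (2 * (m + 1)) := by
  fun_prop

lemma hasDerivAt_modeInt (m : ℕ) (r : ℝ) :
    HasDerivAt (modeInt m) (r * en m r / (2 * (m + 1))) r :=
  intervalIntegral.integral_hasDerivAt_right ((continuous_mul_en m).intervalIntegrable _ _)
    ((continuous_mul_en m).stronglyMeasurableAtFilter _ _) (continuous_mul_en m).continuousAt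

lemma hasDerivAt_modeIntLog (m : ℕ) (r : ℝ) :
    HasDerivAt (modeIntLog m) (r * enLog m r / (2 * (m + 1))) r :=
  intervalIntegral.integral_hasDerivAt_right ((continuous_mul_enLog m).intervalIntegrable _ _)
    ((continuous_mul_enLog m).stronglyMeasurableAtFilter _ _) (continuous_mul_enLog m).continuousAt

/-- Differentiating the two primitives produces the Wronskian, hence the source r/(2(m+1)).
Differentiating the homogeneous solutions turns ψ, psiLog into -en/r, -enLog/r, which assembles
-modeMass/r. -/
lemma hasDerivAt_modeSol (m : ℕ) {r : ℝ} (hr : 0 < r) :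
    HasDerivAt (modeSol m) (r / (2 * (m + 1)) - modeMass m r / r) r := by
  refine ((((hasDerivAt_psiLog m hr).mul (hasDerivAt_modeInt m r)).sub
    ((hasDerivAt_psi m hr).mul (hasDerivAt_modeIntLog m r))).div_const ((m : ℝ) + 1)).congr_deriv ?_
  have := wronskian m r
  unfold modeMass
  field_simp
  linear_combination (r ^ 2) * this

lemma hasDerivAt_modeMass (m : ℕ) {r : ℝ} (hr : 0 < r) :
    HasDerivAt (modeMass m) (profile m r * (profile m r * modeSol m r) * r) r := by
  refine ((((hasDerivAt_enLog m hr).mul (hasDerivAt_modeInt m r)).sub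
    ((hasDerivAt_en m hr).mul (hasDerivAt_modeIntLog m r))).div_const ((m : ℝ) + 1)).congr_deriv ?_
  have := sq_mul_profile_sq m r
  unfold modeSol
  field_simp
  linear_combination (-2 * (m + 1) * (psiLog m r * modeInt m r - psi m r * modeIntLog m r)) * this

lemma mul_log_div_le {s r : ℝ} (hs : 0 < s) (hsr : s ≤ r) :
    |s * (Real.log r - Real.log s)| ≤ r := by
  have hr : 0 < r := hs.trans_le hsr
  rw [← Real.log_div hr.ne' hs.ne']
  have h0 : 0 ≤ Real.log (r / s) := Real.log_nonneg ((one_le_div hs).2 hsr)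
  rw [abs_of_nonneg (by positivity)]
  calc s * Real.log (r / s) ≤ s * (r / s) := by
        gcongr; exact Real.log_le_self (by positivity)
    _ = r := by field_simp

/-- Both solution operators are bounded by `r²`, as the logarithms combine to `log (r / s)`. -/
lemma abs_mode_kernel_le (m : ℕ) {a c r : ℝ} (hr : 0 < r) (ha : |a| ≤ m + 1)
    (hc : |c| ≤ m + 1) :
    |(a + c * Real.log r) * modeInt m r - c * modeIntLog m r / (m + 1)| ≤ 2 * (m + 2) ^ 2 * r ^ 2 := by
  have hm : (0 : ℝ) < m + 1 := by positivity
  have i1 := (continuous_mul_en m).intervalIntegrable (μ := volume) 0 r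
  have i2 := (continuous_mul_enLog m).intervalIntegrable (μ := volume) 0 r
  have e : (a + c * Real.log r) * modeInt m r - c * modeIntLog m r / (m + 1)
      = ∫ s in (0 : ℝ)..r, ((a + c * Real.log r) * (s * en m s / (2 * (m + 1)))
        - c / (m + 1) * (s * enLog m s / (2 * (m + 1)))) := by
    rw [intervalIntegral.integral_sub (i1.const_mul _) (i2.const_mul _),
      intervalIntegral.integral_const_mul, intervalIntegral.integral_const_mul]
    unfold modeInt modeIntLog
    ring
  rw [e]
  have hbd : ∀ s ∈ uIoc 0 r, ‖(a + c * Real.log r) * (s * en m s / (2 * (m + 1)))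
        - c / (m + 1) * (s * enLog m s / (2 * (m + 1)))‖ ≤ 2 * (m + 2) ^ 2 * r := by
    intro s hs
    rw [uIoc_of_le hr.le] at hs
    have h1 := mul_log_div_le hs.1 hs.2
    -- The term (m+1) log s · en inside `enLog` turns the prefactor log r into log r - log s, which
    -- is harmless after multiplication by s.
    have e2 : (a + c * Real.log r) * (s * en m s / (2 * (m + 1)))
        - c / (m + 1) * (s * enLog m s / (2 * (m + 1)))
        = (a * (s * en m s) + c * (s * psi m s)
          + c * (en m s * (s * (Real.log r - Real.log s)))) / (2 * (m + 1)) := by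
      unfold enLog
      field_simp
      ring
    rw [e2, Real.norm_eq_abs, abs_div, abs_of_pos (show (0 : ℝ) < 2 * (m + 1) by positivity),
      div_le_iff₀ (by positivity)]
    have he : |en m s| ≤ m + 1 := by rw [abs_of_nonneg (en_nonneg m s)]; exact en_le m s
    have hs' : |s| ≤ r := by rw [abs_of_pos hs.1]; exact hs.2
    have t1 : |a * (s * en m s)| ≤ (m + 1) * (r * (m + 1)) := by
      rw [abs_mul, abs_mul]; gcongr
    have t2 : |c * (s * psi m s)| ≤ (m + 1) * (r * 1) := by
      rw [abs_mul, abs_mul]; gcongr; exact abs_psi_le m s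
    have t3 : |c * (en m s * (s * (Real.log r - Real.log s)))| ≤ (m + 1) * ((m + 1) * r) := by
      rw [abs_mul, abs_mul]; gcongr
    calc _ ≤ _ := abs_add_three _ _ _
      _ ≤ (m + 1) * (r * (m + 1)) + (m + 1) * (r * 1) + (m + 1) * ((m + 1) * r) := by gcongr
      _ ≤ _ := by
        have hm0 : (0 : ℝ) ≤ m := Nat.cast_nonneg m
        have : 0 ≤ (m + 1) * r := by positivity
        nlinarith [mul_nonneg this hm0, mul_nonneg (mul_nonneg this hm0) hm0]
  have := intervalIntegral.norm_integral_le_of_norm_le_const hbd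
  rw [Real.norm_eq_abs, sub_zero, abs_of_pos hr] at this
  calc _ ≤ _ := this
    _ = _ := by ring

lemma one_le_succ (m : ℕ) : (1 : ℝ) ≤ m + 1 := by
  have : (0 : ℝ) ≤ m := Nat.cast_nonneg m
  linarith

lemma abs_modeSol_le (m : ℕ) {r : ℝ} (hr : 0 < r) : |modeSol m r| ≤ 2 * (m + 2) ^ 2 * r ^ 2 := by
  have hm := one_le_succ m
  have : modeSol m r = (1 / (m + 1) + psi m r * Real.log r) * modeInt m r
      - psi m r * modeIntLog m r / (m + 1) := by
    unfold modeSol psiLog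
    field_simp
  rw [this]
  refine abs_mode_kernel_le m hr ?_ ((abs_psi_le m r).trans hm)
  rw [abs_of_pos (by positivity)]
  exact (div_le_one (by positivity)).2 hm |>.trans hm

lemma abs_modeMass_le (m : ℕ) {r : ℝ} (hr : 0 < r) : |modeMass m r| ≤ 2 * (m + 2) ^ 2 * r ^ 2 := by
  have hm := one_le_succ m
  have : modeMass m r = (-psi m r + en m r * Real.log r) * modeInt m r
      - en m r * modeIntLog m r / (m + 1) := by
    unfold modeMass enLog
    field_simp
  rw [this]
  refine abs_mode_kernel_le m hr ?_ ?_
  · rw [abs_neg]; exact (abs_psi_le m r).trans hm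
  · rw [abs_of_nonneg (en_nonneg m r)]; exact en_le m r

/-- The even extension of `modeSol`. -/
def mode (m : ℕ) (r : ℝ) : ℝ := modeSol m |r|

lemma mode_of_pos (m : ℕ) {r : ℝ} (hr : 0 < r) : mode m r = modeSol m r := by
  rw [mode, abs_of_pos hr]

lemma mode_zero (m : ℕ) : mode m 0 = 0 := by
  simp [mode, modeSol, modeInt, modeIntLog]

lemma abs_mode_le (m : ℕ) (r : ℝ) : |mode m r| ≤ 2 * (m + 2) ^ 2 * r ^ 2 := by
  rcases eq_or_ne r 0 with rfl | hr
  · simp [mode_zero]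
  · have := abs_modeSol_le m (abs_pos.2 hr)
    rwa [sq_abs] at this

lemma hasDerivAt_mode (m : ℕ) {r : ℝ} (hr : 0 < r) :
    HasDerivAt (mode m) (r / (2 * (m + 1)) - modeMass m r / r) r := by
  refine (hasDerivAt_modeSol m hr).congr_of_eventuallyEq ?_
  filter_upwards [Ioi_mem_nhds hr] with x hx using mode_of_pos m hx

lemma continuous_mode (m : ℕ) : Continuous (mode m) := by
  refine continuous_iff_continuousAt.2 fun r => ?_
  rcases eq_or_ne r 0 with rfl | hr
  · unfold ContinuousAt
    rw [mode_zero]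
    · refine squeeze_zero_norm (a := fun r => 2 * (m + 2) ^ 2 * r ^ 2) (fun r => abs_mode_le m r) ?_
      have : Continuous fun r : ℝ => 2 * ((m : ℝ) + 2) ^ 2 * r ^ 2 := by fun_prop
      simpa using this.tendsto 0
  · exact ContinuousAt.comp (f := fun r : ℝ => |r|) (g := modeSol m)
      (hasDerivAt_modeSol m (abs_pos.2 hr)).continuousAt continuous_abs.continuousAt

attribute [fun_prop] continuous_mode

lemma tendsto_modeMass_zero (m : ℕ) : Tendsto (modeMass m) (𝓝[>] 0) (𝓝 0) := by
  have hc : Continuous fun r : ℝ => 2 * ((m : ℝ) + 2) ^ 2 * r ^ 2 := by fun_prop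
  have h := (hc.tendsto 0).mono_left (nhdsWithin_le_nhds (s := Ioi 0))
  simp only [ne_eq, OfNat.ofNat_ne_zero, not_false_eq_true, zero_pow, mul_zero] at h
  refine squeeze_zero_norm' ?_ h
  filter_upwards [self_mem_nhdsWithin] with x hx using abs_modeMass_le m hx

/-- Both sides have the same derivative and tend to 0 at the origin. This identifies `modeMass` as r
B_Q ρ. -/
lemma massInt_mode (m : ℕ) {r : ℝ} (hr : 0 < r) :
    massInt m (fun s => profile m s * mode m s) r = modeMass m r := by
  have hc : Continuous fun s => profile m s * mode m s := by fun_prop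
  have := eq_of_hasDerivAt_zero_of_tendsto (l := 0)
    (f := fun r => massInt m (fun s => profile m s * mode m s) r - modeMass m r)
    (fun x hx => by
      refine ((hasDerivAt_massInt hc x).sub (hasDerivAt_modeMass m hx)).congr_deriv ?_
      rw [mode_of_pos m hx, sub_self]) ?_ r hr
  · linarith
  · have h1 := ((continuous_massInt (m := m) hc).tendsto 0).mono_left
      (nhdsWithin_le_nhds (s := Ioi 0))
    rw [massInt_zero] at h1
    simpa using h1.sub (tendsto_modeMass_zero m)

/-- The smooth extension of `mode` to the plane. -/
lemma hasFDerivAt_mode_norm (m : ℕ) (z : ℂ) :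
    HasFDerivAt (fun z : ℂ => mode m ‖z‖)
      ((1 / (2 * (m + 1)) - ∫ t in (0 : ℝ)..1,
        t ^ 1 • (profile m ‖t • z‖ ^ 2 * mode m ‖t • z‖)) • innerSL ℝ z) z := by
  -- At the origin the derivative is zero because |mode| ≲ r².
  rcases eq_or_ne z 0 with rfl | hz
  · rw [map_zero, smul_zero]
    refine HasFDerivAt.of_isLittleO ?_
    simp only [norm_zero, mode_zero, sub_zero, _root_.zero_apply]
    have h1 : (fun z : ℂ => mode m ‖z‖) =O[𝓝 0] fun z : ℂ => ‖z‖ ^ 2 := by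
      refine Asymptotics.IsBigO.of_bound (2 * (m + 2) ^ 2) (.of_forall fun z => ?_)
      rw [norm_pow, norm_norm]
      exact abs_mode_le m _
    refine h1.trans_isLittleO ?_
    exact Asymptotics.isLittleO_norm_pow_id one_lt_two
  · have hr : 0 < ‖z‖ := norm_pos_iff.2 hz
    have h1 : HasFDerivAt (fun z : ℂ => ‖z‖) ((1 / ‖z‖) • innerSL ℝ z) z := by
      have h2 : HasFDerivAt (fun z : ℂ => ‖z‖ ^ 2) (2 • innerSL ℝ z) z :=
        (hasStrictFDerivAt_norm_sq z).hasFDerivAt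
      have h3 := h2.sqrt (pow_pos hr 2).ne'
      simp only [Real.sqrt_sq (norm_nonneg _)] at h3
      refine h3.congr_fderiv ?_
      ext y
      simp
      ring
    refine ((hasDerivAt_mode m hr).comp_hasFDerivAt z h1).congr_fderiv ?_
    rw [smul_smul]
    congr 1
    -- The substitution s = t‖z‖ exhibits modeMass/r² as a ray average, so no division by ‖z‖
    -- survives in the gradient.
    have h4 : modeMass m ‖z‖ = ‖z‖ ^ 2 * ∫ t in (0 : ℝ)..1,
        t ^ 1 • (profile m ‖t • z‖ ^ 2 * mode m ‖t • z‖) := by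
      rw [← massInt_mode m hr]
      unfold massInt
      have h5 := intervalIntegral.mul_integral_comp_mul_left (a := 0) (b := 1)
        (f := fun s => profile m s * (profile m s * mode m s) * s) ‖z‖
      rw [mul_zero, mul_one] at h5
      rw [← h5, sq, mul_assoc]
      congr 1
      rw [← intervalIntegral.integral_const_mul]
      refine intervalIntegral.integral_congr fun t ht => ?_
      rw [uIcc_of_le zero_le_one] at ht
      simp only [norm_smul, Real.norm_eq_abs, abs_of_nonneg ht.1, mul_comm ‖z‖ t, smul_eq_mul]
      ring
    rw [h4]
    field_simp

lemma contDiff_profile_sq_norm (m : ℕ) : ContDiff ℝ ∞ fun z : ℂ => profile m ‖z‖ ^ 2 := by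
  have h : (fun z : ℂ => profile m ‖z‖ ^ 2) = fun z : ℂ =>
      (Real.sqrt 8 * (m + 1)) ^ 2 * ‖z‖ ^ (2 * m) / (1 + ‖z‖ ^ (2 * (m + 1))) ^ 2 := by
    funext z
    unfold profile
    rw [div_pow, mul_pow, ← pow_mul, mul_comm m 2]
  rw [h]
  exact (contDiff_const.mul (contDiff_norm_pow_even _)).div
    ((contDiff_const.add (contDiff_norm_pow_even _)).pow 2) fun z => (pow_pos (den_pos m _) 2).ne'

/-- Bootstrap: the gradient is z times a constant minus a ray average of Q² mode. As Q²(‖z‖) is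
smooth, C^k regularity of the mode implies C^(k+1). -/
lemma contDiff_mode_norm (m : ℕ) : ContDiff ℝ ∞ fun z : ℂ => mode m ‖z‖ := by
  refine contDiff_infty.2 fun k => ?_
  induction k with
  | zero => exact contDiff_zero.2 ((continuous_mode m).comp continuous_norm)
  | succ k ih =>
    rw [Nat.cast_succ]
    refine contDiff_succ_iff_hasFDerivAt.2 ⟨_, ?_, hasFDerivAt_mode_norm m⟩
    refine ContDiff.smul (contDiff_const.sub (contDiff_ray_average k 1
      (φ := fun z => profile m ‖z‖ ^ 2 * mode m ‖z‖) ?_)) (innerSL ℝ).contDiff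
    exact (contDiff_infty.1 (contDiff_profile_sq_norm m) k).mul ih

/-- The generalized eigenmode `ρ`. -/
def rho (m : ℕ) (r : ℝ) : ℝ := profile m r * mode m r

lemma continuous_rho (m : ℕ) : Continuous (rho m) := by unfold rho; fun_prop

lemma hasDerivAt_rho (m : ℕ) {r : ℝ} (hr : 0 < r) :
    HasDerivAt (rho m) (((m + 1) * psi m r - 1) / r * rho m r
      + profile m r * (r / (2 * (m + 1)) - modeMass m r / r)) r := by
  refine ((hasDerivAt_profile m hr).mul (hasDerivAt_mode m hr)).congr_deriv ?_
  unfold rho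
  ring

lemma massInt_rho (m : ℕ) {r : ℝ} (hr : 0 < r) : massInt m (rho m) r = modeMass m r :=
  massInt_mode m hr

lemma smoothEquivariant_rho (m : ℕ) : SmoothEquivariant m (ext m fun r => (rho m r : ℂ)) := by
  have := smoothEquivariant_ext m (g := fun r => (mode m r : ℂ))
    (Complex.ofRealCLM.contDiff.comp (contDiff_mode_norm m))
  refine (ext_congr m fun r _ => ?_) ▸ this
  unfold rho
  push_cast; ring

lemma contDiffOn_rho (m : ℕ) : ContDiffOn ℝ ∞ (rho m) (Ioi 0) := by
  have h : ContDiff ℝ ∞ fun r : ℝ => mode m ‖(r : ℂ)‖ :=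
    (contDiff_mode_norm m).comp Complex.ofRealCLM.contDiff
  refine ((contDiff_profile m).mul h).contDiffOn.congr fun r hr => ?_
  rw [rho, Complex.norm_real, Real.norm_eq_abs, abs_of_pos hr]

/-! ### Pointwise bounds on the profile -/

/-- Upper half of Q ≍ r^(-m-2) at infinity; `one_le_profile_mul` is the lower half. The admissible
growth exponents σ come from these rates. -/
lemma profile_mul_le (m : ℕ) {r : ℝ} (hr : 0 ≤ r) :
    profile m r * (1 + r) ^ (m + 2) ≤ Real.sqrt 8 * (m + 1) * 2 ^ (m + 2) := by
  unfold profile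
  rw [div_mul_eq_mul_div, div_le_iff₀ (den_pos m r)]
  have h : r ^ m * (1 + r) ^ (m + 2) ≤ 2 ^ (m + 2) * (1 + r ^ (2 * (m + 1))) := by
    rcases le_total r 1 with h1 | h1
    · calc r ^ m * (1 + r) ^ (m + 2) ≤ 1 * 2 ^ (m + 2) := by
            gcongr
            · exact pow_le_one₀ hr h1
            · linarith
        _ ≤ 2 ^ (m + 2) * (1 + r ^ (2 * (m + 1))) := by
            have : 0 ≤ r ^ (2 * (m + 1)) := by positivity
            nlinarith [show (0 : ℝ) < 2 ^ (m + 2) by positivity]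
    · calc r ^ m * (1 + r) ^ (m + 2) ≤ r ^ m * (2 * r) ^ (m + 2) := by gcongr; linarith
        _ = 2 ^ (m + 2) * r ^ (2 * (m + 1)) := by rw [mul_pow]; ring
        _ ≤ _ := by gcongr; linarith
  calc Real.sqrt 8 * (m + 1) * r ^ m * (1 + r) ^ (m + 2)
      = Real.sqrt 8 * (m + 1) * (r ^ m * (1 + r) ^ (m + 2)) := by ring
    _ ≤ Real.sqrt 8 * (m + 1) * (2 ^ (m + 2) * (1 + r ^ (2 * (m + 1)))) := by gcongr
    _ = _ := by ring

lemma one_le_profile_mul (m : ℕ) {r : ℝ} (hr : 1 ≤ r) : 1 ≤ profile m r * r ^ (m + 2) := by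
  unfold profile
  rw [div_mul_eq_mul_div, le_div_iff₀ (den_pos m r)]
  have h8 : 2 ≤ Real.sqrt 8 := Real.le_sqrt_of_sq_le (by norm_num)
  have h1 : 1 ≤ r ^ (2 * (m + 1)) := one_le_pow₀ hr
  have h2 : (2 : ℝ) ≤ Real.sqrt 8 * (m + 1) := by nlinarith [one_le_succ m]
  calc 1 * (1 + r ^ (2 * (m + 1))) ≤ 2 * r ^ (2 * (m + 1)) := by linarith
    _ ≤ Real.sqrt 8 * (m + 1) * r ^ (2 * (m + 1)) := by gcongr
    _ = Real.sqrt 8 * (m + 1) * r ^ m * r ^ (m + 2) := by ring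

lemma en_mul_le (m : ℕ) {r : ℝ} (hr : 0 ≤ r) : en m r * r ^ (2 * (m + 1)) ≤ 4 * (m + 1) := by
  unfold en
  rw [div_mul_eq_mul_div, div_le_iff₀ (pow_pos (den_pos m r) 2)]
  have h0 : 0 ≤ r ^ (2 * (m + 1)) := by positivity
  calc 4 * (m + 1) * r ^ (2 * (m + 1)) * r ^ (2 * (m + 1))
      = 4 * (m + 1) * ((r ^ (2 * (m + 1))) ^ 2) := by ring
    _ ≤ 4 * (m + 1) * ((1 + r ^ (2 * (m + 1))) ^ 2) := by gcongr; linarith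

/-- At infinity r en decays like r^(-2m-1). For m = 0 this diverges logarithmically, which is why
the pairing of ρ with Q is restricted to m ≥ 1. -/
lemma integrableOn_mul_en {m : ℕ} (hm : 1 ≤ m) : IntegrableOn (fun r => r * en m r) (Ioi 0) := by
  rw [← Ioc_union_Ioi_eq_Ioi (zero_le_one (α := ℝ))]
  refine IntegrableOn.union ((Continuous.integrableOn_Icc (by fun_prop)).mono_set Ioc_subset_Icc_self)
    ?_
  have h : IntegrableOn (fun r : ℝ => 4 * (m + 1) * r ^ (-3 : ℝ)) (Ioi 1) :=
    (integrableOn_Ioi_rpow_of_lt (by norm_num) zero_lt_one).const_mul _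
  refine Integrable.mono' h (Continuous.aestronglyMeasurable (by fun_prop)) ?_
  filter_upwards [ae_restrict_mem measurableSet_Ioi] with r hr
  have hr1 : (1 : ℝ) < r := hr
  have hr0 : 0 < r := one_pos.trans hr1
  rw [Real.norm_eq_abs, abs_of_nonneg (mul_nonneg hr0.le (en_nonneg m r)), Real.rpow_neg hr0.le,
    ← div_eq_mul_inv, le_div_iff₀ (by positivity)]
  calc r * en m r * r ^ (3 : ℝ) = en m r * r ^ 4 := by norm_cast; ring
    _ ≤ en m r * r ^ (2 * (m + 1)) := by
        gcongr
        · exact en_nonneg m r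
        · exact hr1.le
        · omega
    _ ≤ _ := en_mul_le m hr0.le

/-! ### Asymptotics of the generalized eigenmode -/

/-- This is the variation against ψ for ρ, integrated from the origin; the cofactor of `modeInt` in
it is the Wronskian. -/
lemma mode_mul_en (m : ℕ) {r : ℝ} (hr : 0 < r) :
    mode m r * en m r - modeMass m r * psi m r = modeInt m r := by
  have := wronskian m r
  rw [mode_of_pos m hr]
  unfold modeSol modeMass
  have hm : (m : ℝ) + 1 ≠ 0 := by positivity
  field_simp
  linear_combination (modeInt m r) * this

lemma modeInt_pos (m : ℕ) {r : ℝ} (hr : 0 < r) : 0 < modeInt m r := by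
  refine intervalIntegral.intervalIntegral_pos_of_pos_on
    ((continuous_mul_en m).intervalIntegrable _ _) (fun x hx => ?_) hr
  have := en_pos m hx.1
  have := hx.1
  positivity

lemma modeInt_mono (m : ℕ) {r s : ℝ} (hr : 0 ≤ r) (hrs : r ≤ s) : modeInt m r ≤ modeInt m s := by
  have := intervalIntegral.integral_add_adjacent_intervals (μ := volume)
    ((continuous_mul_en m).intervalIntegrable 0 r) ((continuous_mul_en m).intervalIntegrable r s)
  have h2 : 0 ≤ ∫ x in r..s, x * en m x / (2 * (m + 1)) := by
    refine intervalIntegral.integral_nonneg hrs fun x hx => ?_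
    have := en_nonneg m x
    have : 0 ≤ x := hr.trans hx.1
    positivity
  unfold modeInt
  linarith

lemma modeInt_zero_eq {r : ℝ} (hr : 0 ≤ r) :
    modeInt 0 r = Real.log (1 + r ^ 2) + 1 / (1 + r ^ 2) - 1 := by
  unfold modeInt
  have hp : ∀ x : ℝ, 1 + x ^ 2 ≠ 0 := fun x => by positivity
  rw [intervalIntegral.integral_eq_sub_of_hasDerivAt_of_le hr
    (f := fun x => Real.log (1 + x ^ 2) + 1 / (1 + x ^ 2))]
  · simp
  · exact Continuous.continuousOn (by fun_prop (disch := exact hp _))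
  · intro x _
    have h1 := (hasDerivAt_pow 2 x).const_add 1
    refine ((h1.log (hp x)).add ((hasDerivAt_const x (1 : ℝ)).div h1 (hp x))).congr_deriv ?_
    have := hp x
    simp [en]
    field_simp
    ring
  · exact (continuous_mul_en 0).intervalIntegrable _ _

lemma tendsto_mode_mul_en {m : ℕ} (hm : 1 ≤ m) :
    Tendsto (fun r => mode m r * en m r) atTop (𝓝 0) := by
  have h1 : Tendsto (fun r : ℝ => 2 * ((m : ℝ) + 2) ^ 2 * (4 * (m + 1)) * (r ^ 2)⁻¹) atTop (𝓝 0) := by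
    have := (tendsto_inv_atTop_zero.comp (tendsto_pow_atTop (α := ℝ) two_ne_zero)).const_mul
      (2 * ((m : ℝ) + 2) ^ 2 * (4 * (m + 1)))
    simpa using this
  refine squeeze_zero_norm' ?_ h1
  filter_upwards [eventually_ge_atTop 1] with r hr
  have hr0 : 0 < r := one_pos.trans_le hr
  rw [norm_mul, Real.norm_eq_abs, Real.norm_eq_abs, abs_of_nonneg (en_nonneg m r)]
  have h2 := abs_mode_le m r
  have h3 : en m r * r ^ 4 ≤ 4 * (m + 1) := by
    refine le_trans ?_ (en_mul_le m hr0.le)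
    gcongr
    · exact en_nonneg m r
    · omega
  calc |mode m r| * en m r ≤ 2 * (m + 2) ^ 2 * r ^ 2 * en m r := by
        gcongr; exact en_nonneg m r
    _ = 2 * (m + 2) ^ 2 * (en m r * r ^ 4) * (r ^ 2)⁻¹ := by field_simp
    _ ≤ _ := by gcongr

/-- In `mode_mul_en`, `modeInt` eventually dominates mode·en: for m ≥ 1 the latter tends to 0, and
for m = 0 it stays bounded while `modeInt` grows logarithmically. The bound prevents ρ from
appearing on the right of the imaginary equation. -/
lemma exists_le_modeMass (m : ℕ) : ∃ η > 0, ∀ᶠ r in atTop, η ≤ modeMass m r := by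
  have key : ∃ η > 0, ∀ᶠ r in atTop, η ≤ modeInt m r - mode m r * en m r := by
    rcases Nat.eq_zero_or_pos m with rfl | hm
    · refine ⟨1, one_pos, ?_⟩
      have h1 : Tendsto (fun r : ℝ => Real.log (1 + r ^ 2)) atTop atTop :=
        Real.tendsto_log_atTop.comp (tendsto_atTop_add_const_left _ _
          (tendsto_pow_atTop two_ne_zero))
      -- 34 = 32 + 1 + 1: the bound 8·4 on |mode·en|, the constant -1 in `modeInt_zero_eq`, and the
      -- desired margin.
      filter_upwards [h1.eventually_ge_atTop 34, eventually_gt_atTop 0] with r h hr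
      rw [modeInt_zero_eq hr.le]
      have h2 : |mode 0 r * en 0 r| ≤ 32 := by
        rw [abs_mul, abs_of_nonneg (en_nonneg 0 r)]
        have h3 := abs_mode_le 0 r
        have h4 := en_mul_le 0 hr.le
        norm_num at h3 h4
        calc |mode 0 r| * en 0 r ≤ 8 * r ^ 2 * en 0 r := by
              gcongr; exact en_nonneg 0 r
          _ ≤ 32 := by linarith
      have h5 : 0 < 1 / (1 + r ^ 2) := by positivity
      linarith [(abs_le.1 h2).2]
    · refine ⟨modeInt m 1 / 2, half_pos (modeInt_pos m one_pos), ?_⟩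
      have h1 := (tendsto_mode_mul_en hm).eventually
        (eventually_le_nhds (half_pos (modeInt_pos m one_pos)))
      filter_upwards [h1, eventually_ge_atTop 1] with r h hr
      have := modeInt_mono m zero_le_one hr
      linarith
  obtain ⟨η, hη, h⟩ := key
  refine ⟨η, hη, ?_⟩
  filter_upwards [h, eventually_gt_atTop 0,
    (tendsto_psi m).eventually (eventually_lt_nhds (show (-1 : ℝ) < 0 by norm_num))] with r h1 hr h2
  rw [← mode_mul_en m hr] at h1
  have h3 := (abs_le.1 (abs_psi_le m r)).1
  -- Since 0 < -ψ ≤ 1 here, removing the factor -ψ only improves the bound.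
  have h4 : η ≤ modeMass m r * (-psi m r) := by linarith
  have h5 : 0 < modeMass m r := by
    by_contra hc
    push Not at hc
    nlinarith
  nlinarith

/-! ### Action of the operators on the explicit modes -/

lemma integral_Ioi_profile_sq (m : ℕ) {r : ℝ} (hr : 0 ≤ r) :
    ∫ s in Ioi r, profile m s ^ 2 * s = 2 * (m + 1) * (1 + psi m r) := by
  have h := integral_Ioi_of_hasDerivAt_of_tendsto (a := r)
    (f := fun s => -(2 * (m + 1) * psi m s)) (f' := fun s => profile m s ^ 2 * s)
    (m := -(2 * (m + 1) * (-1))) (Continuous.continuousWithinAt (by fun_prop)) (fun x hx => ?_)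
    ((integrableOn_profile_sq m).mono_set (Ioi_subset_Ioi hr))
    ((tendsto_psi m).const_mul _).neg
  · rw [h]; ring
  · have hx0 : 0 < x := hr.trans_lt hx
    refine ((hasDerivAt_psi m hx0).const_mul (2 * ((m : ℝ) + 1))).neg.congr_deriv ?_
    have := sq_mul_profile_sq m x
    field_simp
    linarith

/-- The radial part of a combination of `iQ, ΛQ, ir²Q, ρ`. -/
def combRad (m : ℕ) (a b c d r : ℝ) : ℂ :=
  ((b * ((m + 1) * (psi m r * profile m r)) + d * rho m r : ℝ) : ℂ)
    + I * ((a * profile m r + c * (r ^ 2 * profile m r) : ℝ) : ℂ)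

lemma re_combRad (m : ℕ) (a b c d r : ℝ) : (combRad m a b c d r).re
    = b * ((m + 1) * (psi m r * profile m r)) + d * rho m r := by
  simp [combRad, -Complex.ofReal_mul, -Complex.ofReal_add]

lemma im_combRad (m : ℕ) (a b c d r : ℝ) : (combRad m a b c d r).im
    = a * profile m r + c * (r ^ 2 * profile m r) := by
  simp [combRad, -Complex.ofReal_mul, -Complex.ofReal_add]

lemma massInt_add_mul (m : ℕ) {f g : ℝ → ℝ} (hf : Continuous f) (hg : Continuous g) (a b r : ℝ) :
    massInt m (fun s => a * f s + b * g s) r = a * massInt m f r + b * massInt m g r := by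
  unfold massInt
  rw [← intervalIntegral.integral_const_mul, ← intervalIntegral.integral_const_mul,
    ← intervalIntegral.integral_add]
  · congr 1; funext s; ring
  all_goals exact Continuous.intervalIntegrable (by fun_prop) _ _

attribute [fun_prop] continuous_rho

/-- The kernel elements drop out and the other two modes land on rQ and irQ, so only
`Lstar_mul_profile` is needed for the second factor. -/
lemma L_combRad (m : ℕ) (a b c d : ℝ) {r : ℝ} (hr : 0 < r) :
    L m (Q m) (combRad m a b c d) r = ((d / (2 * (m + 1)) * (r * profile m r) : ℝ) : ℂ)
      + I * ((2 * c * (r * profile m r) : ℝ) : ℂ) := by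
  have hq := hasDerivAt_profile m hr
  have hd : HasDerivAt (combRad m a b c d) _ r :=
    ((((((hasDerivAt_psi m hr).mul hq).const_mul ((m : ℝ) + 1)).const_mul b).add
      ((hasDerivAt_rho m hr).const_mul d)).ofReal_comp).add
    ((((hq.const_mul a).add (((hasDerivAt_pow 2 r).mul hq).const_mul c)).ofReal_comp).const_mul I)
  apply Complex.ext
  · rw [L_Q_re m _ hr.le, hd.deriv]
    simp only [re_combRad, ← mul_assoc]
    rw [show (fun s => b * (m + 1) * psi m s * profile m s + d * rho m s)
        = fun s => (b * (m + 1)) * (psi m s * profile m s) + d * rho m s by funext s; ring,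
      massInt_add_mul m (by fun_prop) (by fun_prop), massInt_psi_mul_profile m hr.le,
      massInt_rho m hr]
    simp [-Complex.ofReal_mul, -Complex.ofReal_add, -Complex.ofReal_div, -Complex.ofReal_neg,
      -Complex.ofReal_sub]
    field_simp
    ring
  · rw [L_Q_im m _ hr.le, hd.deriv]
    simp only [im_combRad]
    simp [-Complex.ofReal_mul, -Complex.ofReal_add, -Complex.ofReal_div, -Complex.ofReal_neg,
      -Complex.ofReal_sub]
    field_simp
    ring

/-- Here (rQ)' = ΛQ, and ∫_r^∞ sQ² ds = 2(m+1)(1 + ψ) cancels the ψ terms of the real part. The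
imaginary part has no nonlocal term and keeps -2ΛQ. -/
lemma Lstar_mul_profile (m : ℕ) (a b : ℝ) {r : ℝ} (hr : 0 < r) :
    Lstar m (Q m) (fun r => ((a * (r * profile m r) : ℝ) : ℂ) + I * ((b * (r * profile m r) : ℝ) : ℂ)) r
      = ((2 * (m + 1) * a * profile m r : ℝ) : ℂ)
        - I * ((2 * b * ((m + 1) * psi m r * profile m r) : ℝ) : ℂ) := by
  have hq := hasDerivAt_profile m hr
  have hk : HasDerivAt (fun r => r * profile m r) ((m + 1) * psi m r * profile m r) r := by
    refine ((hasDerivAt_id r).mul hq).congr_deriv ?_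
    simp only [id]
    field_simp
    ring
  have hd : HasDerivAt (fun r => ((a * (r * profile m r) : ℝ) : ℂ)
      + I * ((b * (r * profile m r) : ℝ) : ℂ)) _ r :=
    (hk.const_mul a).ofReal_comp.add ((hk.const_mul b).ofReal_comp.const_mul I)
  have hre : ∀ s : ℝ, (((a * (s * profile m s) : ℝ) : ℂ) + I * ((b * (s * profile m s) : ℝ) : ℂ)).re
      = a * (s * profile m s) := fun s => by simp [-Complex.ofReal_mul]
  have him : ∀ s : ℝ, (((a * (s * profile m s) : ℝ) : ℂ) + I * ((b * (s * profile m s) : ℝ) : ℂ)).im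
      = b * (s * profile m s) := fun s => by simp [-Complex.ofReal_mul]
  apply Complex.ext
  · rw [Lstar_Q_re m _ hr.le, hd.deriv]
    simp only [hre]
    have : ∫ s in Ioi r, profile m s * (a * (s * profile m s))
        = a * (2 * (m + 1) * (1 + psi m r)) := by
      rw [← integral_Ioi_profile_sq m hr.le, ← integral_const_mul]
      congr 1; funext s; ring
    rw [this]
    simp [-Complex.ofReal_mul]
    field_simp
    ring
  · rw [Lstar_Q_im m _ hr.le, hd.deriv]
    simp only [him]
    simp [-Complex.ofReal_mul]
    field_simp
    ring

lemma linOp_combRad (m : ℕ) (a b c d : ℝ) {r : ℝ} (hr : 0 < r) :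
    linOp m (Q m) (combRad m a b c d) r = ((d * profile m r : ℝ) : ℂ)
      - I * ((4 * c * ((m + 1) * psi m r * profile m r) : ℝ) : ℂ) := by
  rw [linOp_eq m _ hr, Lstar_congr m (fun x hx => L_combRad m a b c d hx) hr,
    Lstar_mul_profile m _ _ hr]
  have hm : (m : ℂ) + 1 ≠ 0 := by exact_mod_cast (show (m : ℝ) + 1 ≠ 0 by positivity)
  push_cast
  field_simp
  ring

lemma linOp_congr (m : ℕ) {f g : ℝ → ℂ} (h : ∀ r, 0 < r → f r = g r) {r : ℝ} (hr : 0 < r) :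
    linOp m (Q m) f r = linOp m (Q m) g r := by
  rw [linOp_eq m f hr, linOp_eq m g hr]
  exact Lstar_congr m (fun x hx => L_congr m h hx) hr

lemma rho_eq_combRad (m : ℕ) (r : ℝ) : (rho m r : ℂ) = combRad m 0 0 0 1 r := by
  simp [combRad]

lemma isRho_rho (m : ℕ) : IsRho m (rho m) where
  smooth := contDiffOn_rho m
  tail := by
    refine IntegrableOn.congr_fun ((integrableOn_profile_sq m).const_mul (1 / (2 * ((m : ℝ) + 1))))
      (fun r hr => ?_) measurableSet_Ioi
    rw [funext (rho_eq_combRad m), L_combRad m _ _ _ _ hr, Q_eq, Complex.conj_ofReal,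
      Complex.re_ofReal_mul]
    simp [-Complex.ofReal_mul]
    field_simp
  eqn r hr := by
    rw [← linOp_eq m _ hr, funext (rho_eq_combRad m), linOp_combRad m _ _ _ _ hr, Q_eq]
    simp
  bound := by
    refine ⟨2 * (m + 2) ^ 2, fun r hr => ?_⟩
    rw [Q_eq, Complex.norm_real, Real.norm_eq_abs, rho, abs_mul]
    have := abs_mode_le m r
    calc |profile m r| * |mode m r| ≤ |profile m r| * (2 * (m + 2) ^ 2 * r ^ 2) := by gcongr
      _ = _ := by ring

/-- Up to the factor 2π, `modeInt` and `modeMass` are the truncated integrals of ‖L_Qρ‖² and (ρ,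
Q)_r. Letting r → ∞ in `mode_mul_en`, where ψ → -1 and mode·en → 0, identifies the two limits. -/
lemma rho_pairing {m : ℕ} (hm : 1 ≤ m) :
    Integrable (fun r => ((rho m r : ℂ) * (starRingEnd ℂ) (Q m r)).re) radMeasure ∧
      MemLp (L m (Q m) (fun r => (rho m r : ℂ))) 2 radMeasure ∧
      rinner (fun r => (rho m r : ℂ)) (Q m) = l2norm (L m (Q m) (fun r => (rho m r : ℂ))) ^ 2 ∧
      l2norm (L m (Q m) (fun r => (rho m r : ℂ))) ^ 2 ≠ 0 := by
  have hn : (0 : ℝ) < 2 * (m + 1) := by positivity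
  have hre : ∀ r, ((rho m r : ℂ) * (starRingEnd ℂ) (Q m r)).re = profile m r * rho m r := fun r => by
    rw [Q_eq, Complex.conj_ofReal, ← Complex.ofReal_mul, Complex.ofReal_re, mul_comm]
  have hE := integrableOn_mul_en hm
  have hi : IntegrableOn (fun r => profile m r * rho m r * r) (Ioi 0) := by
    refine Integrable.mono' (hE.const_mul (2 * (m + 2) ^ 2 * (2 * (m + 1))))
      (Continuous.aestronglyMeasurable (by fun_prop)) ?_
    filter_upwards [ae_restrict_mem measurableSet_Ioi] with r hr
    have hr0 : 0 < r := hr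
    have h1 := abs_mode_le m r
    have h2 := sq_mul_profile_sq m r
    rw [rho, Real.norm_eq_abs, show profile m r * (profile m r * mode m r) * r
      = (profile m r ^ 2 * r) * mode m r by ring, abs_mul, abs_of_nonneg (by positivity)]
    calc profile m r ^ 2 * r * |mode m r| ≤ profile m r ^ 2 * r * (2 * (m + 2) ^ 2 * r ^ 2) := by
          gcongr
      _ = 2 * (m + 2) ^ 2 * r * (r ^ 2 * profile m r ^ 2) := by ring
      _ = _ := by rw [h2]; ring
  have hL : ∀ r ∈ Ioi (0 : ℝ), L m (Q m) (fun r => (rho m r : ℂ)) r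
      = ((1 / (2 * (m + 1)) * (r * profile m r) : ℝ) : ℂ) := fun r hr => by
    rw [funext (rho_eq_combRad m), L_combRad m _ _ _ _ hr]
    simp
  have hN : ∀ r ∈ Ioi (0 : ℝ), ‖L m (Q m) (fun r => (rho m r : ℂ)) r‖ ^ 2 * r
      = r * en m r / (2 * (m + 1)) := fun r hr => by
    have h2 := sq_mul_profile_sq m r
    rw [hL r hr, Complex.norm_real, Real.norm_eq_abs, sq_abs]
    field_simp
    linear_combination r * h2
  have hmem : MemLp (L m (Q m) (fun r => (rho m r : ℂ))) 2 radMeasure := by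
    refine memLp_radMeasure_iff.2 ⟨?_, ?_⟩
    · refine AEStronglyMeasurable.congr (f := fun r : ℝ => ((1 / (2 * (m + 1)) * (r * profile m r) : ℝ) : ℂ))
        (Continuous.aestronglyMeasurable (by fun_prop)) ?_
      filter_upwards [ae_restrict_mem measurableSet_Ioi] with r hr using (hL r hr).symm
    · exact IntegrableOn.congr_fun (hE.div_const (2 * ((m : ℝ) + 1))) (fun r hr => (hN r hr).symm) measurableSet_Ioi
  have hl2 : l2norm (L m (Q m) (fun r => (rho m r : ℂ))) ^ 2
      = 2 * Real.pi * ∫ r in Ioi (0 : ℝ), r * en m r / (2 * (m + 1)) := by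
    rw [l2norm_sq hmem, setIntegral_congr_fun measurableSet_Ioi hN]
  have lim1 : Tendsto (modeInt m) atTop (𝓝 (∫ r in Ioi (0 : ℝ), r * en m r / (2 * (m + 1)))) :=
    intervalIntegral_tendsto_integral_Ioi 0 (hE.div_const _) tendsto_id
  have lim2 : Tendsto (modeMass m) atTop (𝓝 (∫ r in Ioi (0 : ℝ), profile m r * rho m r * r)) := by
    refine (intervalIntegral_tendsto_integral_Ioi 0 hi tendsto_id).congr' ?_
    filter_upwards [eventually_gt_atTop 0] with r hr using massInt_rho m hr
  have lim3 : Tendsto (modeInt m) atTop (𝓝 (∫ r in Ioi (0 : ℝ), profile m r * rho m r * r)) := by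
    have := (tendsto_mode_mul_en hm).sub (lim2.mul (tendsto_psi m))
    simp only [mul_neg, mul_one, zero_sub, neg_neg] at this
    refine this.congr' ?_
    filter_upwards [eventually_gt_atTop 0] with r hr using mode_mul_en m hr
  have heq := tendsto_nhds_unique lim1 lim3
  refine ⟨?_, hmem, ?_, ?_⟩
  · rw [integrable_radMeasure_iff]
    simpa only [hre] using hi
  · rw [hl2, heq, rinner, integral_radMeasure]
    simp only [hre]
  · rw [hl2]
    have h1 : modeInt m 1 ≤ ∫ r in Ioi (0 : ℝ), r * en m r / (2 * (m + 1)) := by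
      refine ge_of_tendsto lim1 ?_
      filter_upwards [eventually_ge_atTop 1] with r hr using modeInt_mono m zero_le_one hr
    have h2 := modeInt_pos m one_pos
    have := Real.pi_pos
    have h3 := h2.trans_le h1
    positivity

/-! ### The inhomogeneous equations of the generalized null space -/

/-- `∫₀^r s³ Q² ψ ds`. -/
def quadMoment (m : ℕ) (r : ℝ) : ℝ := ∫ s in (0 : ℝ)..r, s ^ 3 * profile m s ^ 2 * psi m s

lemma psi_pos_of_lt_one (m : ℕ) {s : ℝ} (h0 : 0 ≤ s) (h1 : s < 1) : 0 < psi m s := by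
  have : s ^ (2 * (m + 1)) < 1 := pow_lt_one₀ h0 h1 (by omega)
  exact div_pos (by linarith) (den_pos m s)

lemma psi_nonpos_of_one_le (m : ℕ) {s : ℝ} (h1 : 1 ≤ s) : psi m s ≤ 0 := by
  have : 1 ≤ s ^ (2 * (m + 1)) := one_le_pow₀ h1
  exact div_nonpos_of_nonpos_of_nonneg (by linarith) (den_pos m s).le

/-- Compare with ∫₀^r sQ²ψ ds = en(r), which tends to 0. The difference is the integral of (1 -
s²)sQ²ψ, nonnegative because ψ and 1 - s² change sign together at 1. -/
lemma exists_quadMoment_le (m : ℕ) : ∃ δ > 0, ∀ᶠ r in atTop, quadMoment m r ≤ -δ := by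
  set u : ℝ → ℝ := fun s => (1 - s ^ 2) * (profile m s ^ 2 * s * psi m s) with hu
  have cu : Continuous u := by rw [hu]; fun_prop
  have hpos : 0 < ∫ s in (0 : ℝ)..1, u s := by
    refine intervalIntegral.intervalIntegral_pos_of_pos_on (cu.intervalIntegrable _ _)
      (fun s hs => ?_) zero_lt_one
    have h1 := psi_pos_of_lt_one m hs.1.le hs.2
    have h2 := profile_pos m hs.1
    have h3 : 0 < 1 - s ^ 2 := by nlinarith [hs.1, hs.2]
    have := hs.1
    positivity
  refine ⟨(∫ s in (0 : ℝ)..1, u s) / 2, half_pos hpos, ?_⟩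
  filter_upwards [(tendsto_en m).eventually (eventually_le_nhds (half_pos hpos)),
    eventually_ge_atTop 1] with r h1 hr
  have e1 : quadMoment m r = en m r - ∫ s in (0 : ℝ)..r, u s := by
    rw [← massInt_psi_mul_profile m (zero_le_one.trans hr)]
    unfold quadMoment massInt
    rw [← intervalIntegral.integral_sub]
    · congr 1; funext s; rw [hu]; ring
    all_goals exact Continuous.intervalIntegrable (by fun_prop) _ _
  have e2 := intervalIntegral.integral_add_adjacent_intervals (μ := volume)
    (cu.intervalIntegrable 0 1) (cu.intervalIntegrable 1 r)
  have e3 : 0 ≤ ∫ s in (1 : ℝ)..r, u s := by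
    refine intervalIntegral.integral_nonneg hr fun s hs => ?_
    have h1 := psi_nonpos_of_one_le m hs.1
    have h3 : 1 - s ^ 2 ≤ 0 := by nlinarith [hs.1]
    have h4 : 0 ≤ profile m s ^ 2 * s := by have : 0 ≤ s := zero_le_one.trans hs.1; positivity
    exact mul_nonneg_of_nonpos_of_nonpos h3 (mul_nonpos_of_nonneg_of_nonpos h4 h1)
  rw [e1]
  linarith

lemma hasDerivAt_quadMoment (m : ℕ) (r : ℝ) :
    HasDerivAt (quadMoment m) (r ^ 3 * profile m r ^ 2 * psi m r) r := by
  have hc : Continuous fun s => s ^ 3 * profile m s ^ 2 * psi m s := by fun_prop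
  exact intervalIntegral.integral_hasDerivAt_right (hc.intervalIntegrable _ _)
    (hc.stronglyMeasurableAtFilter _ _) hc.continuousAt

lemma not_integrableOn_of_le_abs_div {u : ℝ → ℝ} {c : ℝ} (hc : 0 < c)
    (h : ∀ᶠ r in atTop, c / r ≤ |u r|) : ¬ IntegrableOn u (Ioi 0) := by
  intro hi
  obtain ⟨R, hR⟩ := eventually_atTop.1 (h.and (eventually_gt_atTop 0))
  have h1 : IntegrableOn (fun r => c⁻¹ * |u r|) (Ioi R) :=
    ((hi.mono_set (Ioi_subset_Ioi (hR R le_rfl).2.le)).abs).const_mul _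
  refine not_integrableOn_Ioi_inv (a := R) (Integrable.mono' h1
    (Measurable.aestronglyMeasurable (by fun_prop)) ?_)
  filter_upwards [ae_restrict_mem measurableSet_Ioi] with r hr
  obtain ⟨h2, h3⟩ := hR r (le_of_lt hr)
  rw [Real.norm_eq_abs, abs_of_pos (inv_pos.2 h3)]
  rw [← div_eq_inv_mul, le_div_iff₀ hc]
  calc r⁻¹ * c = c / r := by ring
    _ ≤ _ := h2

/-- Solutions of the real part of `L_Q^* h = α Q + γ r² Q`. -/
lemma real_inhomogeneous {m : ℕ} {h h' : ℝ → ℝ} {α γ : ℝ}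
    (hd : ∀ r, 0 < r → HasDerivAt h (h' r) r)
    (hi : IntegrableOn (fun r => profile m r * h r) (Ioi 0))
    (hk : Tendsto (fun r => r * profile m r * h r) (𝓝[>] 0) (𝓝 0))
    (eqn : ∀ r, 0 < r → -h' r - (m + 1) * psi m r / r * h r
      + profile m r * ∫ s in Ioi r, profile m s * h s
        = α * profile m r + γ * (r ^ 2 * profile m r)) :
    γ = 0 ∧ ∀ r, 0 < r → h r = α / (2 * (m + 1)) * (r * profile m r) := by
  have hcont : ContinuousOn (fun r => profile m r * h r) (Ioi 0) :=
    (continuous_profile m).continuousOn.mul fun r hr => (hd r hr).continuousAt.continuousWithinAt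
  -- With k = rQh the equation becomes p' = k/r, k' = -rQ²(p + γr²). For γ = 0 the pair (p, -k)
  -- solves the homogeneous system of (ψ, en).
  set p : ℝ → ℝ := fun r => α - ∫ s in Ioi r, profile m s * h s with hp
  set k : ℝ → ℝ := fun r => r * profile m r * h r with hkdef
  have dp : ∀ r, 0 < r → HasDerivAt p (profile m r * h r) r := fun r hr => by
    simpa using (hasDerivAt_integral_Ioi hi hcont hr).const_sub α
  have dk : ∀ r, 0 < r → HasDerivAt k (-(r * profile m r ^ 2 * (p r + γ * r ^ 2))) r := by
    intro r hr
    refine (((hasDerivAt_id r).mul (hasDerivAt_profile m hr)).mul (hd r hr)).congr_deriv ?_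
    have := eqn r hr
    simp only [id, Pi.mul_apply, hp]
    field_simp at this ⊢
    linear_combination (-profile m r) * this
  have hsq := fun r => sq_mul_profile_sq m r
  have d1 : ∀ r, 0 < r → HasDerivAt (fun r => p r * en m r + k r * psi m r + γ * quadMoment m r)
      0 r := by
    intro r hr
    refine ((((dp r hr).mul (hasDerivAt_en m hr)).add ((dk r hr).mul (hasDerivAt_psi m hr))).add
      ((hasDerivAt_quadMoment m r).const_mul γ)).congr_deriv ?_
    simp only [hkdef]
    field_simp
    linear_combination (-(p r * psi m r)) * hsq r
  obtain ⟨M, hM⟩ : ∃ M, ∀ r, 0 < r → |p r| ≤ M := by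
    refine ⟨|α| + ∫ s in Ioi (0 : ℝ), |profile m s * h s|, fun r hr => ?_⟩
    refine (abs_sub _ _).trans (add_le_add le_rfl ?_)
    refine (abs_integral_le_integral_abs).trans ?_
    exact setIntegral_mono_set hi.abs (.of_forall fun x => abs_nonneg _)
      (Ioi_subset_Ioi hr.le).eventuallyLE
  have l1 : Tendsto (fun r => p r * en m r) (𝓝[>] 0) (𝓝 0) := by
    have h1 : Tendsto (fun r => M * en m r) (𝓝[>] 0) (𝓝 0) := by
      have hc : Continuous fun r => M * en m r := by fun_prop
      simpa [en_zero] using (hc.tendsto 0).mono_left (nhdsWithin_le_nhds (s := Ioi 0))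
    refine squeeze_zero_norm' ?_ h1
    filter_upwards [self_mem_nhdsWithin] with r hr
    rw [norm_mul, Real.norm_eq_abs, Real.norm_eq_abs, abs_of_nonneg (en_nonneg m r)]
    exact mul_le_mul_of_nonneg_right (hM r hr) (en_nonneg m r)
  have l2 : Tendsto (fun r => k r * psi m r) (𝓝[>] 0) (𝓝 0) := by
    have := hk.mul (((continuous_psi m).tendsto 0).mono_left (nhdsWithin_le_nhds (s := Ioi 0)))
    simpa using this
  have l3 : Tendsto (fun r => γ * quadMoment m r) (𝓝[>] 0) (𝓝 0) := by
    have := ((hasDerivAt_quadMoment m 0).continuousAt.tendsto.mono_left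
      (nhdsWithin_le_nhds (s := Ioi 0))).const_mul γ
    simpa [quadMoment] using this
  have z1 : ∀ r, 0 < r → p r * en m r + k r * psi m r + γ * quadMoment m r = 0 :=
    eq_of_hasDerivAt_zero_of_tendsto d1 (by simpa using (l1.add l2).add l3)
  -- If γ ≠ 0, then p·en → 0 and the sign of `quadMoment` keep |k| above a positive constant, so
  -- |Qh| = |k|/r is not integrable.
  have hγ : γ = 0 := by
    by_contra hγ
    obtain ⟨δ, hδ, hJ⟩ := exists_quadMoment_le m
    have hg : 0 < |γ| := abs_pos.2 hγ
    have l4 : Tendsto (fun r => M * en m r) atTop (𝓝 0) := by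
      simpa using (tendsto_en m).const_mul M
    refine not_integrableOn_of_le_abs_div (c := |γ| * δ / 2) (by positivity) ?_ hi
    filter_upwards [hJ, eventually_gt_atTop 0, l4.eventually (eventually_le_nhds
      (show (0 : ℝ) < |γ| * δ / 2 by positivity))] with r h1 hr h2
    have e1 := z1 r hr
    have b1 : |p r * en m r| ≤ |γ| * δ / 2 := by
      rw [abs_mul, abs_of_nonneg (en_nonneg m r)]
      exact (mul_le_mul_of_nonneg_right (hM r hr) (en_nonneg m r)).trans h2
    have b2 : |γ| * δ ≤ |γ * quadMoment m r| := by
      rw [abs_mul]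
      gcongr
      rw [abs_of_nonpos (by linarith)]
      linarith
    have b3 : |γ * quadMoment m r| ≤ |p r * en m r| + |k r * psi m r| := by
      rw [show γ * quadMoment m r = -(p r * en m r + k r * psi m r) by linarith, abs_neg]
      exact abs_add_le _ _
    have b4 : |k r * psi m r| ≤ |k r| := by
      rw [abs_mul]
      exact mul_le_of_le_one_right (abs_nonneg _) (abs_psi_le m r)
    have b5 : |k r| = r * |profile m r * h r| := by
      rw [hkdef]; simp only; rw [mul_assoc, abs_mul, abs_of_pos hr]
    rw [div_le_iff₀ hr, mul_comm |profile m r * h r| r, ← b5]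
    linarith
  refine ⟨hγ, ?_⟩
  have d2 : ∀ r, 0 < r → HasDerivAt (fun r => p r * enLog m r + k r * psiLog m r) 0 r := by
    intro r hr
    refine (((dp r hr).mul (hasDerivAt_enLog m hr)).add
      ((dk r hr).mul (hasDerivAt_psiLog m hr))).congr_deriv ?_
    simp only [hkdef, hγ]
    field_simp
    linear_combination (-(p r * psiLog m r)) * hsq r
  set c := p 1 * enLog m 1 + k 1 * psiLog m 1 with hc
  have z2 : ∀ r, 0 < r → p r * enLog m r + k r * psiLog m r = c := const_of_hasDerivAt_zero d2
  have z1' : ∀ r, 0 < r → p r * en m r + k r * psi m r = 0 := fun r hr => by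
    have := z1 r hr
    rw [hγ] at this
    linarith
  have hpψ : ∀ r, 0 < r → (m + 1) * p r = -c * psi m r := fun r hr => by
    linear_combination (-p r) * wronskian m r + psiLog m r * z1' r hr - psi m r * z2 r hr
  have hkE : ∀ r, 0 < r → (m + 1) * k r = c * en m r := fun r hr => by
    linear_combination (-k r) * wronskian m r + en m r * z2 r hr - enLog m r * z1' r hr
  -- The remaining constant is read off at infinity, where p → α and ψ → -1.
  have hcα : c = (m + 1) * α := by
    have t1 : Tendsto (fun r => ((m : ℝ) + 1) * p r) atTop (𝓝 ((m + 1) * (α - 0))) :=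
      ((tendsto_integral_Ioi hi).const_sub α).const_mul _
    have t2 : Tendsto (fun r => ((m : ℝ) + 1) * p r) atTop (𝓝 (-c * -1)) := by
      refine ((tendsto_psi m).const_mul (-c)).congr' ?_
      filter_upwards [eventually_gt_atTop 0] with r hr using (hpψ r hr).symm
    have := tendsto_nhds_unique t1 t2
    linarith
  intro r hr
  have e := hkE r hr
  have hm : (m : ℝ) + 1 ≠ 0 := by positivity
  have hq := (profile_pos m hr).ne'
  rw [hcα, mul_assoc] at e
  have e' := mul_left_cancel₀ hm e
  simp only [hkdef] at e'
  have h2 := hsq r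
  have : r * profile m r * h r = r * profile m r * (α / (2 * (m + 1)) * (r * profile m r)) := by
    rw [e']
    field_simp
    linear_combination (-α) * h2
  exact mul_left_cancel₀ (mul_ne_zero hr.ne' hq) this

lemma tendsto_one_add_rpow_div {σ : ℝ} {k : ℕ} (h : σ < k) :
    Tendsto (fun r : ℝ => (1 + r) ^ σ / r ^ k) atTop (𝓝 0) := by
  have h1 : Tendsto (fun r : ℝ => (1 + r) ^ (-((k : ℝ) - σ))) atTop (𝓝 0) :=
    (tendsto_rpow_neg_atTop (by linarith)).comp (tendsto_atTop_add_const_left _ 1 tendsto_id)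
  have h2 : Tendsto (fun r : ℝ => (1 + r⁻¹) ^ k) atTop (𝓝 ((1 + 0) ^ k)) :=
    (tendsto_inv_atTop_zero.const_add 1).pow k
  have := h1.mul h2
  simp only [zero_mul] at this
  refine this.congr' ?_
  filter_upwards [eventually_gt_atTop 0] with r hr
  have hr1 : 0 < 1 + r := by linarith
  rw [show -((k : ℝ) - σ) = σ - k by ring, Real.rpow_sub hr1, Real.rpow_natCast,
    show 1 + r⁻¹ = (1 + r) / r by field_simp; ring, div_pow]
  field_simp

/-- Solutions of growth below `r^(m+2)` of the imaginary part of
`L_Q^* L_Q f = -(β ΛQ + δ ρ)`. -/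
lemma imag_inhomogeneous {m : ℕ} {f f' h h' : ℝ → ℝ} {β δ σ C : ℝ} (hσ : σ < m + 2)
    (hf : ∀ r, 0 < r → HasDerivAt f (f' r) r)
    (hh : ∀ r, 0 < r → h r = f' r - ((m + 1) * psi m r - 1) / r * f r)
    (hd : ∀ r, 0 < r → HasDerivAt h (h' r) r)
    (hk : Tendsto (fun r => r * profile m r * h r) (𝓝[>] 0) (𝓝 0))
    (hb : ∀ r, 0 < r → |f r| ≤ C * (1 + r) ^ σ)
    (eqn : ∀ r, 0 < r → -h' r - (m + 1) * psi m r / r * h r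
        = -(β * ((m + 1) * psi m r * profile m r) + δ * rho m r)) :
    δ = 0 ∧ ∃ c, ∀ r, 0 < r → f r = c * profile m r + β / 4 * (r ^ 2 * profile m r) := by
  -- The integrating factor is rQ. Since (rQ)' = ΛQ, the β term integrates to β(rQ)²/2, and the δ
  -- term to the mass of ρ.
  have d1 : ∀ r, 0 < r → HasDerivAt (fun r => r * profile m r * h r
      - (β / 2 * (r * profile m r) ^ 2 + δ * modeMass m r)) 0 r := by
    intro r hr
    have dq := (hasDerivAt_id r).mul (hasDerivAt_profile m hr)
    refine ((dq.mul (hd r hr)).sub (((dq.pow 2).const_mul (β / 2)).add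
      ((hasDerivAt_modeMass m hr).const_mul δ))).congr_deriv ?_
    have := eqn r hr
    rw [rho, mode_of_pos m hr] at this
    simp only [id, Pi.mul_apply]
    field_simp at this ⊢
    push_cast
    linear_combination (-2 * profile m r) * this
  have l1 : Tendsto (fun r => β / 2 * (r * profile m r) ^ 2) (𝓝[>] 0) (𝓝 0) := by
    have hc : Continuous fun r => β / 2 * (r * profile m r) ^ 2 := by fun_prop
    simpa using (hc.tendsto 0).mono_left (nhdsWithin_le_nhds (s := Ioi 0))
  have z1 := eq_of_hasDerivAt_zero_of_tendsto d1 (l := 0)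
    (by simpa using hk.sub (l1.add ((tendsto_modeMass_zero m).const_mul δ)))
  have d2 : ∀ r, 0 < r → HasDerivAt (fun r => f r / profile m r - β / 4 * r ^ 2)
      (δ * (modeMass m r / (r * profile m r ^ 2))) r := by
    intro r hr
    have hq := (profile_pos m hr).ne'
    refine ((hasDerivAt_div_profile (m := m) hr (hf r hr)).sub
      ((hasDerivAt_pow 2 r).const_mul (β / 4))).congr_deriv ?_
    rw [← hh r hr]
    have := z1 r hr
    field_simp
    push_cast
    linear_combination 4 * this
  -- Otherwise (f/Q)' is at least of order r^(2m+3), hence f of order r^(m+2), against the growth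
  -- hypothesis.
  have hδ : δ = 0 := by
    by_contra hδ
    obtain ⟨η, hη, hM⟩ := exists_le_modeMass m
    obtain ⟨R, hR⟩ := eventually_atTop.1 (hM.and (eventually_ge_atTop 1))
    have hR1 : 1 ≤ R := (hR R le_rfl).2
    set N : ℝ := (Real.sqrt 8 * (m + 1) * 2 ^ (m + 2)) ^ 2 with hN
    have hN0 : 0 < N := by positivity
    -- From modeMass ≥ η and (r^(m+2) Q)² ≤ N, the derivative of `y` is at least δ²η r^(2m+3)/N,
    -- whose primitive is κ r^(2m+4). The factor δ in `y` makes the sign irrelevant.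
    set κ : ℝ := δ ^ 2 * η / (N * (2 * m + 4)) with hκ
    have hκ0 : 0 < κ := by positivity
    set y : ℝ → ℝ := fun r => δ * (f r / profile m r - β / 4 * r ^ 2) with hy
    have dy : ∀ r, 0 < r → HasDerivAt (fun r => y r - κ * r ^ (2 * m + 4))
        (δ ^ 2 * (modeMass m r / (r * profile m r ^ 2)) - κ * ((2 * m + 4) * r ^ (2 * m + 3))) r := by
      intro r hr
      refine (((d2 r hr).const_mul δ).sub ((hasDerivAt_pow (2 * m + 4) r).const_mul κ)).congr_deriv ?_
      push_cast
      ring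
    have hmono : MonotoneOn (fun r => y r - κ * r ^ (2 * m + 4)) (Ici R) := by
      refine monotoneOn_of_deriv_nonneg (convex_Ici R) ?_ ?_ ?_
      · intro r hr
        exact (dy r (by linarith [show R ≤ r from hr])).continuousAt.continuousWithinAt
      · intro r hr
        rw [interior_Ici] at hr
        exact (dy r (by linarith [show R < r from hr])).differentiableAt.differentiableWithinAt
      · intro r hr
        rw [interior_Ici] at hr
        have hRr : R < r := hr
        have hr0 : 0 < r := by linarith
        rw [(dy r hr0).deriv]
        have hq := profile_pos m hr0
        have h1 := (hR r hRr.le).1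
        have h2 : profile m r * r ^ (m + 2) ≤ Real.sqrt 8 * (m + 1) * 2 ^ (m + 2) := by
          refine le_trans ?_ (profile_mul_le m hr0.le)
          gcongr
          linarith
        have h3 : (profile m r * r ^ (m + 2)) ^ 2 ≤ N := by
          rw [hN]
          exact pow_le_pow_left₀ (by positivity) h2 2
        have h4 : κ * ((2 * m + 4) * r ^ (2 * m + 3)) = δ ^ 2 * (η * r ^ (2 * m + 3) / N) := by
          rw [hκ]; field_simp
        rw [h4, sub_nonneg]
        gcongr δ ^ 2 * ?_
        rw [div_le_div_iff₀ hN0 (by positivity)]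
        calc η * r ^ (2 * m + 3) * (r * profile m r ^ 2)
            = η * (profile m r * r ^ (m + 2)) ^ 2 := by ring
          _ ≤ modeMass m r * N := by gcongr; exact hη.le.trans h1
    have lim : Tendsto (fun r => y r / r ^ (2 * m + 4)) atTop (𝓝 0) := by
      have t1 : Tendsto (fun r : ℝ => |δ| * (C * ((1 + r) ^ σ / r ^ (m + 2))
          + |β| / 4 * (r ^ 2)⁻¹)) atTop (𝓝 0) := by
        have a1 := (tendsto_one_add_rpow_div (σ := σ) (k := m + 2) (by push_cast; exact hσ)).const_mul C
        have a2 := (tendsto_inv_atTop_zero.comp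
          (tendsto_pow_atTop (α := ℝ) two_ne_zero)).const_mul (|β| / 4)
        simpa using (a1.add a2).const_mul |δ|
      refine squeeze_zero_norm' ?_ t1
      filter_upwards [eventually_ge_atTop 1] with r hr
      have hr0 : 0 < r := one_pos.trans_le hr
      have hq := profile_pos m hr0
      have h1 : |f r / profile m r| ≤ C * (1 + r) ^ σ * r ^ (m + 2) := by
        rw [abs_div, abs_of_pos hq, div_le_iff₀ hq]
        have h2 := one_le_profile_mul m hr
        have h3 : 0 ≤ C * (1 + r) ^ σ := (abs_nonneg _).trans (hb r hr0)
        calc |f r| ≤ C * (1 + r) ^ σ * 1 := by rw [mul_one]; exact hb r hr0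
          _ ≤ C * (1 + r) ^ σ * (profile m r * r ^ (m + 2)) := by gcongr
          _ = _ := by ring
      have h4 : |y r| ≤ |δ| * (C * (1 + r) ^ σ * r ^ (m + 2) + |β| / 4 * r ^ 2) := by
        rw [hy]
        simp only
        rw [abs_mul]
        gcongr
        refine (abs_sub _ _).trans (add_le_add h1 (le_of_eq ?_))
        rw [abs_mul, abs_div, abs_of_pos (show 0 < r ^ 2 by positivity)]
        norm_num
      rw [norm_div, Real.norm_eq_abs, Real.norm_eq_abs,
        abs_of_pos (show 0 < r ^ (2 * m + 4) by positivity), div_le_iff₀ (by positivity)]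
      refine h4.trans ?_
      rw [mul_assoc |δ|]
      refine mul_le_mul_of_nonneg_left ?_ (abs_nonneg δ)
      have h5 : C * ((1 + r) ^ σ / r ^ (m + 2)) * r ^ (2 * m + 4)
          = C * (1 + r) ^ σ * r ^ (m + 2) := by
        rw [show 2 * m + 4 = (m + 2) + (m + 2) by ring, pow_add]
        field_simp
        ring
      have h6 : |β| / 4 * r ^ 2 ≤ |β| / 4 * (r ^ 2)⁻¹ * r ^ (2 * m + 4) := by
        rw [mul_assoc]
        gcongr
        rw [inv_mul_eq_div, le_div_iff₀ (by positivity), ← pow_add]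
        exact pow_le_pow_right₀ hr (by omega)
      rw [add_mul, h5]
      linarith
    have lim2 : Tendsto (fun r => (y R - κ * R ^ (2 * m + 4)) * (r ^ (2 * m + 4))⁻¹ + κ) atTop (𝓝 κ) := by
      have := (tendsto_inv_atTop_zero.comp (tendsto_pow_atTop (α := ℝ)
        (show 2 * m + 4 ≠ 0 by omega))).const_mul (y R - κ * R ^ (2 * m + 4))
      simpa using this.add_const κ
    have := le_of_tendsto_of_tendsto lim2 lim (by
      filter_upwards [eventually_ge_atTop R] with r hr
      have hr0 : 0 < r := by linarith
      have h1 := hmono self_mem_Ici (show r ∈ Ici R from hr) hr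
      simp only at h1
      rw [le_div_iff₀ (by positivity), add_mul, mul_assoc, inv_mul_cancel₀ (by positivity)]
      linarith)
    linarith
  refine ⟨hδ, ?_⟩
  have z2 := const_of_hasDerivAt_zero (fun r hr => by simpa [hδ] using d2 r hr)
  refine ⟨f 1 / profile m 1 - β / 4 * 1 ^ 2, fun r hr => ?_⟩
  have := z2 r hr
  have hq := (profile_pos m hr).ne'
  rw [← this]
  field_simp
  ring

/-! ### The four modes and the generalized null space -/

/-- Real combinations of the equivariant extensions of `iQ, ΛQ, ir²Q, ρ`. -/
def comb (m : ℕ) (a b c d : ℝ) : ℂ → ℂ :=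
  a • ext m (iQ m) + b • ext m (LamQ m) + c • ext m (irrQ m) + d • ext m fun r => (rho m r : ℂ)

lemma comb_eq_ext (m : ℕ) (a b c d : ℝ) : comb m a b c d = ext m (combRad m a b c d) := by
  funext z
  unfold comb ext combRad
  simp only [Pi.add_apply, Pi.smul_apply, Complex.real_smul, LamQ_eq m (norm_nonneg z), iQ, irrQ,
    Q_eq]
  push_cast
  ring

lemma rad_comb (m : ℕ) (a b c d : ℝ) {r : ℝ} (hr : 0 ≤ r) :
    rad (comb m a b c d) r = combRad m a b c d r := by
  rw [comb_eq_ext, rad_ext m _ hr]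

lemma smoothEquivariant_comb (m : ℕ) (a b c d : ℝ) : SmoothEquivariant m (comb m a b c d) :=
  ((((smoothEquivariant_iQ m).smul a).add ((smoothEquivariant_LamQ m).smul b)).add
    ((smoothEquivariant_irrQ m).smul c)).add ((smoothEquivariant_rho m).smul d)

lemma norm_ext (m : ℕ) (g : ℝ → ℂ) (z : ℂ) : ‖ext m g z‖ = ‖g ‖z‖‖ := by
  unfold ext
  rw [norm_mul, show (m : ℂ) * arg z * I = ((m * arg z : ℝ) : ℂ) * I by push_cast; ring,
    Complex.norm_exp_ofReal_mul_I, mul_one]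

lemma norm_combRad_le (m : ℕ) (a b c d : ℝ) {r : ℝ} (hr : 0 ≤ r) :
    ‖combRad m a b c d r‖ ≤ (|b| * (m + 1) + |d| * (2 * (m + 2) ^ 2) + |a| + |c|)
      * (profile m r * (1 + r) ^ 2) := by
  have hq := profile_nonneg m hr
  refine (Complex.norm_le_abs_re_add_abs_im _).trans ?_
  rw [re_combRad, im_combRad]
  have h1 : |b * ((m + 1) * (psi m r * profile m r))| ≤ |b| * (m + 1) * profile m r := by
    rw [abs_mul, abs_mul, abs_mul, abs_of_nonneg hq,
      abs_of_pos (show (0 : ℝ) < m + 1 by positivity), mul_assoc]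
    gcongr
    exact mul_le_of_le_one_left hq (abs_psi_le m r)
  have h2 : |d * rho m r| ≤ |d| * (profile m r * (2 * (m + 2) ^ 2 * r ^ 2)) := by
    rw [rho, abs_mul, abs_mul, abs_of_nonneg hq]
    gcongr
    exact abs_mode_le m r
  have h3 : |a * profile m r| = |a| * profile m r := by rw [abs_mul, abs_of_nonneg hq]
  have h4 : |c * (r ^ 2 * profile m r)| = |c| * (r ^ 2 * profile m r) := by
    rw [abs_mul, abs_of_nonneg (show 0 ≤ r ^ 2 * profile m r by positivity)]
  have e1 := abs_add_le (b * ((m + 1) * (psi m r * profile m r))) (d * rho m r)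
  have e2 := abs_add_le (a * profile m r) (c * (r ^ 2 * profile m r))
  have g1 : 1 ≤ (1 + r) ^ 2 := by nlinarith
  have g2 : r ^ 2 ≤ (1 + r) ^ 2 := by nlinarith
  have k1 : |b| * (m + 1) * profile m r ≤ |b| * (m + 1) * (profile m r * (1 + r) ^ 2) := by
    gcongr; exact le_mul_of_one_le_right hq g1
  have k2 : |d| * (profile m r * (2 * (m + 2) ^ 2 * r ^ 2))
      ≤ |d| * (2 * (m + 2) ^ 2) * (profile m r * (1 + r) ^ 2) := by
    calc _ = |d| * (2 * (m + 2) ^ 2) * (profile m r * r ^ 2) := by ring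
      _ ≤ _ := by gcongr
  have k3 : |a| * profile m r ≤ |a| * (profile m r * (1 + r) ^ 2) := by
    gcongr; exact le_mul_of_one_le_right hq g1
  have k4 : |c| * (r ^ 2 * profile m r) ≤ |c| * (profile m r * (1 + r) ^ 2) := by
    rw [mul_comm (r ^ 2)]; gcongr
  linarith

/-- All four modes are O((1 + r)^(-m)), which is where -m ≤ σ enters. -/
lemma comb_mem_genDomain (m : ℕ) (a b c d : ℝ) {σ : ℝ} (hσ : -(m : ℝ) ≤ σ) :
    comb m a b c d ∈ genDomain m σ := by
  refine ⟨smoothEquivariant_comb m a b c d, ?_, ?_⟩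
  · refine ⟨(|b| * (m + 1) + |d| * (2 * (m + 2) ^ 2) + |a| + |c|)
      * (Real.sqrt 8 * (m + 1) * 2 ^ (m + 2)), fun z => ?_⟩
    have hr := norm_nonneg z
    rw [comb_eq_ext, norm_ext, mul_assoc]
    refine (norm_combRad_le m a b c d hr).trans ?_
    refine mul_le_mul_of_nonneg_left ?_ (by positivity)
    have h1 := profile_mul_le m hr
    have hp : 0 < 1 + ‖z‖ := by linarith
    have h2 : profile m ‖z‖ * (1 + ‖z‖) ^ 2
        ≤ Real.sqrt 8 * (m + 1) * 2 ^ (m + 2) * (1 + ‖z‖) ^ (-(m : ℝ)) := by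
      rw [Real.rpow_neg hp.le, Real.rpow_natCast, ← div_eq_mul_inv, le_div_iff₀ (by positivity)]
      calc _ = profile m ‖z‖ * (1 + ‖z‖) ^ (m + 2) := by ring
        _ ≤ _ := h1
    refine h2.trans ?_
    gcongr
    linarith
  · refine IntegrableOn.congr_fun ((integrableOn_profile_sq m).const_mul (d / (2 * ((m : ℝ) + 1))))
      (fun r hr => ?_) measurableSet_Ioi
    rw [L_congr m (fun x hx => rad_comb m a b c d (le_of_lt hx)) hr, L_combRad m _ _ _ _ hr, Q_eq,
      Complex.conj_ofReal, Complex.re_ofReal_mul]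
    simp [-Complex.ofReal_mul]
    ring

/-- On coefficients i𝓛_Q acts as (a, b, c, d) ↦ (d, 4c, 0, 0), which squares to zero. -/
lemma I_mul_linOp_comb (m : ℕ) (a b c d : ℝ) {r : ℝ} (hr : 0 < r) :
    rad (comb m d (4 * c) 0 0) r = I * linOp m (Q m) (rad (comb m a b c d)) r := by
  rw [linOp_congr m (fun x hx => rad_comb m a b c d (le_of_lt hx)) hr, linOp_combRad m _ _ _ _ hr,
    rad_comb m _ _ _ _ hr.le, combRad]
  push_cast
  linear_combination (4 * c * ((m + 1) * (psi m r * profile m r) : ℂ)) * I_mul_I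

lemma comb_zero (m : ℕ) : comb m 0 0 0 0 = 0 := by simp [comb]

lemma genNull_comb (m : ℕ) (a b c d : ℝ) {σ : ℝ} (hσ : -(m : ℝ) ≤ σ) :
    GenNull m σ (comb m a b c d) := by
  refine .step _ (comb m d (4 * c) 0 0) (comb_mem_genDomain m a b c d hσ) ?_
    fun r hr => I_mul_linOp_comb m a b c d hr
  refine .step _ 0 (comb_mem_genDomain m _ _ _ _ hσ) .zero fun r hr => ?_
  rw [← I_mul_linOp_comb m _ _ _ _ hr, mul_zero, comb_zero]

lemma differentiableAt_L {m : ℕ} {f : ℝ → ℂ} (hf : ContDiff ℝ 2 f) {r : ℝ} (hr : 0 < r) :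
    DifferentiableAt ℝ (L m (Q m) f) r := by
  have hf' : ContDiff ℝ 1 (deriv f) := (contDiff_succ_iff_deriv (n := 1).1 hf).2.2
  have cf := hf.continuous
  have c1 : DifferentiableAt ℝ (fun x => ((m + 1) * psi m x - 1) / x) r :=
    (((hasDerivAt_psi m hr).const_mul ((m : ℝ) + 1)).sub_const 1).differentiableAt.div
      differentiableAt_id hr.ne'
  have c2 : DifferentiableAt ℝ (fun x => profile m x * (massInt m (fun s => (f s).re) x / x)) r :=
    (hasDerivAt_profile m hr).differentiableAt.mul
      ((hasDerivAt_massInt (by fun_prop) r).differentiableAt.div differentiableAt_id hr.ne')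
  have := (((hf'.differentiable (by simp)) r).sub
    (c1.hasDerivAt.ofReal_comp.differentiableAt.mul (hf.differentiable (by simp) r))).add
      c2.hasDerivAt.ofReal_comp.differentiableAt
  refine this.congr_of_eventuallyEq ?_
  filter_upwards [Ioi_mem_nhds hr] with x hx
  rw [L_Q m f (le_of_lt hx)]
  rfl

lemma natCast_mul_profile_zero (m : ℕ) : (m : ℝ) * profile m 0 = 0 := by
  rcases m with _ | m <;> simp [profile]

/-- At the origin r L_Q f tends to -m f(0), and m Q(0) = 0 for every m. This is the boundary
condition used in both inhomogeneous equations. -/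
lemma tendsto_profile_mul_L {m : ℕ} {f : ℝ → ℂ} (hf : ContDiff ℝ 2 f) :
    Tendsto (fun r => ((r * profile m r : ℝ) : ℂ) * L m (Q m) f r) (𝓝[>] 0) (𝓝 0) := by
  have cf := hf.continuous
  have cf' : Continuous (deriv f) := hf.continuous_deriv (by simp)
  have cT : Continuous (massInt m fun s => (f s).re) := continuous_massInt (by fun_prop)
  have hc : Continuous fun r : ℝ => (profile m r : ℂ) * (r * deriv f r
      - (((m + 1) * psi m r - 1 : ℝ) : ℂ) * f r
      + ((profile m r * massInt m (fun s => (f s).re) r : ℝ) : ℂ)) := by fun_prop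
  have h := (hc.tendsto 0).mono_left (nhdsWithin_le_nhds (s := Ioi 0))
  have h0 : (profile m 0 : ℂ) * m = 0 := by
    have := natCast_mul_profile_zero m
    rw [mul_comm]
    exact_mod_cast this
  have hv : (profile m 0 : ℂ) * (((0 : ℝ) : ℂ) * deriv f 0
      - (((m + 1) * psi m 0 - 1 : ℝ) : ℂ) * f 0
      + ((profile m 0 * massInt m (fun s => (f s).re) 0 : ℝ) : ℂ)) = 0 := by
    rw [massInt_zero, psi_zero]
    push_cast
    linear_combination (-f 0) * h0
  rw [hv] at h
  refine h.congr' ?_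
  filter_upwards [self_mem_nhdsWithin] with r hr
  have hr0 : (r : ℂ) ≠ 0 := by exact_mod_cast (ne_of_gt hr)
  rw [L_Q m f (le_of_lt hr)]
  push_cast
  field_simp

/-- One step of the description of the generalized null space. -/
lemma eq_comb_of_step {m : ℕ} {σ : ℝ} (hσ : σ < m + 2) {F : ℂ → ℂ} (hF : F ∈ genDomain m σ)
    {a b c d : ℝ} (h : ∀ r : ℝ, 0 < r →
      rad (comb m a b c d) r = I * linOp m (Q m) (rad F) r) :
    ∃ a' b' c' d', F = comb m a' b' c' d' := by
  obtain ⟨hs, ⟨C, hC⟩, hi⟩ := hF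
  have hf2 : ContDiff ℝ 2 (rad F) := contDiff_infty.1 hs.contDiff_rad 2
  have hc := hf2.continuous
  have hdf : ∀ r, HasDerivAt (rad F) (deriv (rad F) r) r := fun r =>
    (hf2.differentiable (by simp) r).hasDerivAt
  set H := L m (Q m) (rad F) with hH
  have hdH : ∀ r, 0 < r → HasDerivAt H (deriv H r) r := fun r hr =>
    (differentiableAt_L hf2 hr).hasDerivAt
  have hk := tendsto_profile_mul_L (m := m) hf2
  have heq : ∀ r, 0 < r → Lstar m (Q m) H r = -I * combRad m a b c d r := fun r hr => by
    have h1 := h r hr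
    rw [rad_comb m _ _ _ _ hr.le, linOp_eq m _ hr] at h1
    rw [h1, ← mul_assoc, hH]
    simp
  have hre : ∀ r, 0 < r → (Lstar m (Q m) H r).re
      = a * profile m r + c * (r ^ 2 * profile m r) := fun r hr => by
    rw [heq r hr, ← im_combRad m a b c d]
    simp
  have him : ∀ r, 0 < r → (Lstar m (Q m) H r).im
      = -(b * ((m + 1) * psi m r * profile m r) + d * rho m r) := fun r hr => by
    have := re_combRad m a b c d r
    rw [heq r hr, mul_assoc ((m : ℝ) + 1), ← this]
    simp
  have hi' : IntegrableOn (fun r => profile m r * (H r).re) (Ioi 0) := by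
    refine hi.congr_fun (fun r _ => ?_) measurableSet_Ioi
    simp only [Q_eq, Complex.conj_ofReal, Complex.re_ofReal_mul, hH]
  -- Multiplication by -i swaps the parts: iQ and ir²Q feed the real equation, ΛQ and ρ the
  -- imaginary one.
  obtain ⟨-, hHre⟩ := real_inhomogeneous (m := m) (h := fun r => (H r).re) (α := a) (γ := c)
    (fun r hr => hasDerivAt_re (hdH r hr)) hi'
    (by
      have := (Complex.continuous_re.tendsto 0).comp hk
      refine this.congr fun r => ?_
      simp only [Function.comp, Complex.re_ofReal_mul, hH])
    (fun r hr => by rw [← hre r hr, Lstar_Q_re m _ hr.le])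
  obtain ⟨-, e, he⟩ := imag_inhomogeneous (m := m) (f := fun r => (rad F r).im)
    (h := fun r => (H r).im) (C := C) hσ (fun r _ => hasDerivAt_im (hdf r))
    (fun r hr => L_Q_im m _ hr.le) (fun r hr => hasDerivAt_im (hdH r hr))
    (by
      have := (Complex.continuous_im.tendsto 0).comp hk
      refine this.congr fun r => ?_
      simp only [Function.comp, Complex.im_ofReal_mul, hH])
    (fun r hr => by
      have := hC r
      rw [Complex.norm_real, Real.norm_eq_abs, abs_of_pos hr] at this
      exact (Complex.abs_im_le_norm _).trans this)
    (fun r hr => by rw [← him r hr, Lstar_Q_im m _ hr.le])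
  -- Re L_Q F equals a L_Q ρ, so Re F - aρ lies in the real kernel.
  obtain ⟨b', hb'⟩ := eq_mul_of_real_kernel (m := m)
    (f := fun r => 1 * (rad F r).re + (-a) * rho m r)
    (by fun_prop) (fun r hr => ((hasDerivAt_re (hdf r)).const_mul 1).add
      ((hasDerivAt_rho m hr).const_mul (-a)))
    (fun r hr => by
      rw [massInt_add_mul m (by fun_prop) (by fun_prop), massInt_rho m hr]
      have e1 := hHre r hr
      simp only [hH] at e1
      rw [L_Q_re m _ hr.le] at e1
      linear_combination e1)
  have hm : (m : ℝ) + 1 ≠ 0 := by positivity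
  refine ⟨e, b' / (m + 1), b / 4, a, hs.eq_of_rad (smoothEquivariant_comb m _ _ _ _) fun r hr => ?_⟩
  rw [rad_comb m _ _ _ _ hr.le]
  apply Complex.ext
  · rw [re_combRad]
    have := hb' r hr
    rw [← mul_assoc, div_mul_cancel₀ _ hm]
    linarith
  · rw [im_combRad]
    exact he r hr

lemma mem_span_range_iff (m : ℕ) (F : ℂ → ℂ) :
    F ∈ Submodule.span ℝ (Set.range ![ext m (iQ m), ext m (LamQ m), ext m (irrQ m),
      ext m (fun r => (rho m r : ℂ))]) ↔ ∃ a b c d, F = comb m a b c d := by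
  rw [Submodule.mem_span_range_iff_exists_fun]
  constructor
  · rintro ⟨v, rfl⟩
    refine ⟨v 0, v 1, v 2, v 3, ?_⟩
    simp [Fin.sum_univ_four, comb]
  · rintro ⟨a, b, c, d, rfl⟩
    refine ⟨![a, b, c, d], ?_⟩
    simp [Fin.sum_univ_four, comb]

lemma genNull_eq (m : ℕ) {σ : ℝ} (h1 : -(m : ℝ) ≤ σ) (h2 : σ < m + 2) :
    {F | GenNull m σ F} = (Submodule.span ℝ (Set.range ![ext m (iQ m), ext m (LamQ m),
      ext m (irrQ m), ext m (fun r => (rho m r : ℂ))]) : Set (ℂ → ℂ)) := by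
  ext F
  rw [SetLike.mem_coe, mem_span_range_iff]
  constructor
  · intro hF
    induction hF with
    | zero => exact ⟨0, 0, 0, 0, (comb_zero m).symm⟩
    | step F G hF _ h ih =>
      obtain ⟨a, b, c, d, rfl⟩ := ih
      exact eq_comb_of_step h2 hF h
  · rintro ⟨a, b, c, d, rfl⟩
    exact genNull_comb m a b c d h1

lemma linearIndependent_modes (m : ℕ) :
    LinearIndependent ℝ ![ext m (iQ m), ext m (LamQ m), ext m (irrQ m),
      ext m (fun r => (rho m r : ℂ))] := by
  rw [Fintype.linearIndependent_iff]
  intro v hv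
  have h0 : comb m (v 0) (v 1) (v 2) (v 3) = 0 := by
    rw [← hv]
    simp [Fin.sum_univ_four, comb]
  have hm : (0 : ℝ) < m + 1 := by positivity
  have hz : ∀ r, 0 < r → combRad m (v 0) (v 1) (v 2) (v 3) r = 0 := fun r hr => by
    rw [← rad_comb m _ _ _ _ hr.le, h0]; rfl
  have hL : ∀ r, 0 < r → L m (Q m) (combRad m (v 0) (v 1) (v 2) (v 3)) r = 0 := fun r hr => by
    rw [← L_congr m (f := fun _ => 0) (fun x hx => (hz x hx).symm) hr, L_Q m _ hr.le]
    simp [massInt]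
  have hq := profile_pos m one_pos
  have e1 := hL 1 one_pos
  rw [L_combRad m _ _ _ _ one_pos] at e1
  have e2 := congrArg Complex.re e1
  have e3 := congrArg Complex.im e1
  simp [-Complex.ofReal_mul, hq.ne', hm.ne'] at e2 e3
  have e4 := congrArg Complex.im (hz 1 one_pos)
  rw [im_combRad, e3] at e4
  simp [hq.ne'] at e4
  -- ψ vanishes at 1, so the coefficient of ΛQ is read off at 1/2.
  have e5 := congrArg Complex.re (hz (1 / 2) (by norm_num))
  rw [re_combRad, e2] at e5
  have hψ := psi_pos_of_lt_one m (show (0 : ℝ) ≤ 1 / 2 by norm_num) (by norm_num)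
  have hq' := profile_pos m (show (0 : ℝ) < 1 / 2 by norm_num)
  have e6 : v 1 = 0 := by
    rw [zero_mul, add_zero, Complex.zero_re] at e5
    rcases mul_eq_zero.1 e5 with h | h
    · exact h
    · exfalso
      have : 0 < ((m : ℝ) + 1) * (psi m (1 / 2) * profile m (1 / 2)) := by positivity
      linarith
  intro i
  fin_cases i
  · exact e4
  · exact e6
  · exact e3
  · exact e2

lemma mode_identities (m : ℕ) {r : ℝ} (hr : 0 < r) :
    I * linOp m (Q m) (fun s => (rho m s : ℂ)) r = iQ m r ∧
    I * linOp m (Q m) (irrQ m) r = 4 * LamQ m r ∧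
    I * linOp m (Q m) (iQ m) r = 0 ∧
    I * linOp m (Q m) (LamQ m) r = 0 := by
  refine ⟨?_, ?_, ?_, ?_⟩
  · rw [linOp_congr m (g := combRad m 0 0 0 1) (fun x _ => rho_eq_combRad m x) hr,
      linOp_combRad m _ _ _ _ hr, iQ, Q_eq]
    simp
  · rw [linOp_congr m (g := combRad m 0 0 1 0) (fun x _ => by
      simp [irrQ, combRad, Q_eq, mul_assoc]) hr, linOp_combRad m _ _ _ _ hr, LamQ_eq m hr.le]
    push_cast
    linear_combination (-4 * ((m + 1) * (psi m r * profile m r) : ℂ)) * I_mul_I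
  · rw [linOp_congr m (g := combRad m 1 0 0 0) (fun x _ => by
      simp [iQ, combRad, Q_eq]) hr, linOp_combRad m _ _ _ _ hr]
    simp
  · rw [linOp_congr m (g := combRad m 0 1 0 0) (fun x hx => by
      simp [LamQ_eq m (le_of_lt hx), combRad, mul_assoc]) hr, linOp_combRad m _ _ _ _ hr]
    simp

/-! ### Locally absolutely continuous functions on the half-line -/

/-- `f` is a primitive of the locally integrable function `g` on `(0, ∞)`. -/
structure IsPrimitive (f g : ℝ → ℝ) : Prop where
  loc : LocallyIntegrableOn g (Ioi 0)
  eqn : ∀ a b, 0 < a → 0 < b → f b - f a = ∫ s in a..b, g s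

lemma uIcc_subset_Ioi {a b : ℝ} (ha : 0 < a) (hb : 0 < b) : uIcc a b ⊆ Ioi 0 :=
  (ordConnected_Ioi).uIcc_subset ha hb

lemma intervalIntegrable_of_loc {g : ℝ → ℝ} (hg : LocallyIntegrableOn g (Ioi 0)) {a b : ℝ}
    (ha : 0 < a) (hb : 0 < b) : IntervalIntegrable g volume a b := by
  rw [intervalIntegrable_iff]
  exact (hg.integrableOn_compact_subset (uIcc_subset_Ioi ha hb) isCompact_uIcc).mono_set
    uIoc_subset_uIcc

lemma isPrimitive_integral {g : ℝ → ℝ} (hg : LocallyIntegrableOn g (Ioi 0)) {c : ℝ} (hc : 0 < c) :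
    IsPrimitive (fun r => ∫ s in c..r, g s) g where
  loc := hg
  eqn a b ha hb := by
    rw [intervalIntegral.integral_interval_sub_left (intervalIntegrable_of_loc hg hc hb)
      (intervalIntegrable_of_loc hg hc ha)]

namespace IsPrimitive

variable {f g p : ℝ → ℝ}

lemma absolutelyContinuous (h : IsPrimitive f g) {a b : ℝ} (ha : 0 < a) (hb : 0 < b) :
    AbsolutelyContinuousOnInterval (fun r => ∫ s in a..r, g s) a b :=
  (intervalIntegrable_of_loc h.loc ha hb).absolutelyContinuousOnInterval_intervalIntegral
    left_mem_uIcc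

lemma continuousOn (h : IsPrimitive f g) : ContinuousOn f (Ioi 0) := by
  intro r hr
  have hr0 : 0 < r := hr
  have h1 := (h.absolutelyContinuous (a := r / 2) (b := 2 * r) (by positivity)
    (by positivity)).continuousOn
  have h2 : ContinuousOn f (uIcc (r / 2) (2 * r)) := by
    refine (h1.const_add (f (r / 2))).congr fun x hx => ?_
    have hx0 : 0 < x := uIcc_subset_Ioi (by positivity) (by positivity) hx
    simp only
    rw [← h.eqn (r / 2) x (by positivity) hx0]
    ring
  rw [uIcc_of_le (by linarith)] at h2
  exact (h2.continuousAt (Icc_mem_nhds (by linarith) (by linarith))).continuousWithinAt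

lemma locallyIntegrableOn (h : IsPrimitive f g) : LocallyIntegrableOn f (Ioi 0) :=
  h.continuousOn.locallyIntegrableOn measurableSet_Ioi

/-- The product rule is applied to the absolutely continuous function ∫_a^x g; the missing constant
f(a) is restored through the integral of p'. -/
lemma mul (h : IsPrimitive f g) (hp : ContDiffOn ℝ 1 p (Ioi 0)) :
    IsPrimitive (fun r => p r * f r) (fun r => deriv p r * f r + p r * g r) where
  loc := by
    have hp' : ContinuousOn (deriv p) (Ioi 0) := hp.continuousOn_deriv_of_isOpen isOpen_Ioi le_rfl
    exact ((hp'.mul h.continuousOn).locallyIntegrableOn measurableSet_Ioi).add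
      (h.loc.continuousOn_mul hp.continuousOn isOpen_Ioi.isLocallyClosed)
  eqn a b ha hb := by
    have hp' : ContinuousOn (deriv p) (Ioi 0) := hp.continuousOn_deriv_of_isOpen isOpen_Ioi le_rfl
    have hsub := uIcc_subset_Ioi ha hb
    have acp : AbsolutelyContinuousOnInterval p a b :=
      (hp.mono hsub).absolutelyContinuousOnInterval
    have acg := h.absolutelyContinuous ha hb
    have key := acp.integral_deriv_mul_eq_sub acg
    have hd := (intervalIntegrable_of_loc h.loc ha hb).ae_hasDerivAt_integral
    have key2 : ∫ x in a..b, deriv p x * (∫ s in a..x, g s) + p x * g x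
        = p b * (∫ s in a..b, g s) := by
      rw [intervalIntegral.integral_same, mul_zero, sub_zero] at key
      rw [← key]
      refine intervalIntegral.integral_congr_ae ?_
      filter_upwards [hd] with x hx hxm
      rw [(hx (uIoc_subset_uIcc hxm) a left_mem_uIcc).deriv]
    have i1 : IntervalIntegrable (fun x => deriv p x * (∫ s in a..x, g s) + p x * g x) volume a b :=
      ((hp'.mono hsub).mul acg.continuousOn).intervalIntegrable.add
        ((intervalIntegrable_of_loc h.loc ha hb).continuousOn_mul (hp.continuousOn.mono hsub))
    have i2 : IntervalIntegrable (fun x => deriv p x * f a) volume a b :=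
      ((hp'.mono hsub).mul continuousOn_const).intervalIntegrable
    have e : ∫ x in a..b, deriv p x * f x + p x * g x
        = ∫ x in a..b, ((deriv p x * (∫ s in a..x, g s) + p x * g x) + deriv p x * f a) := by
      refine intervalIntegral.integral_congr fun x hx => ?_
      rw [← h.eqn a x ha (hsub hx)]
      ring
    rw [e, intervalIntegral.integral_add i1 i2, key2, intervalIntegral.integral_mul_const,
      acp.integral_deriv_eq_sub, ← h.eqn a b ha hb]
    ring

lemma sub {f₂ g₂ : ℝ → ℝ} (h : IsPrimitive f g) (h₂ : IsPrimitive f₂ g₂) :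
    IsPrimitive (fun r => f r - f₂ r) (fun r => g r - g₂ r) where
  loc := h.loc.sub h₂.loc
  eqn a b ha hb := by
    rw [intervalIntegral.integral_sub (intervalIntegrable_of_loc h.loc ha hb)
      (intervalIntegrable_of_loc h₂.loc ha hb), ← h.eqn a b ha hb, ← h₂.eqn a b ha hb]
    ring

lemma congr_right {g₂ : ℝ → ℝ} (h : IsPrimitive f g)
    (hg : g =ᵐ[volume.restrict (Ioi 0)] g₂) : IsPrimitive f g₂ where
  loc := by
    intro x hx
    obtain ⟨s, hs, hi⟩ := h.loc x hx
    refine ⟨s ∩ Ioi 0, inter_mem hs self_mem_nhdsWithin, ?_⟩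
    exact (hi.mono_set inter_subset_left).congr (ae_restrict_of_ae_restrict_of_subset
      inter_subset_right hg)
  eqn a b ha hb := by
    rw [h.eqn a b ha hb]
    refine intervalIntegral.integral_congr_ae ?_
    rw [← ae_restrict_iff' measurableSet_uIoc]
    exact ae_restrict_of_ae_restrict_of_subset (uIoc_subset_uIcc.trans (uIcc_subset_Ioi ha hb)) hg

end IsPrimitive

/-! ### Weak derivatives -/

/-- Real test functions on `(0, ∞)`. -/
def IsRealTest (φ : ℝ → ℝ) : Prop :=
  ContDiff ℝ ∞ φ ∧ HasCompactSupport φ ∧ tsupport φ ⊆ Ioi 0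

/-- `g` is a weak derivative of the real-valued function `f` on `(0, ∞)`. -/
structure IsRealWeakDeriv (f g : ℝ → ℝ) : Prop where
  loc : LocallyIntegrableOn f (Ioi 0)
  loc' : LocallyIntegrableOn g (Ioi 0)
  eqn : ∀ φ : ℝ → ℝ, IsRealTest φ →
    ∫ r in Ioi (0 : ℝ), deriv φ r * f r = -∫ r in Ioi (0 : ℝ), φ r * g r

lemma IsRealTest.exists_interval {φ : ℝ → ℝ} (h : IsRealTest φ) :
    ∃ a b : ℝ, 0 < a ∧ a < b ∧ ∀ x, x ∉ Ioo a b → φ x = 0 := by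
  obtain ⟨-, h2, h3⟩ := h
  rcases (tsupport φ).eq_empty_or_nonempty with he | hne
  · refine ⟨1, 2, one_pos, one_lt_two, fun x _ => ?_⟩
    exact image_eq_zero_of_notMem_tsupport (by simp [he])
  · have hK : IsCompact (tsupport φ) := h2
    obtain ⟨x, hx, hxm⟩ := hK.exists_isLeast hne
    obtain ⟨y, hy, hym⟩ := hK.exists_isGreatest hne
    have hx0 : 0 < x := h3 hx
    have hxy := hxm hy
    refine ⟨x / 2, y + 1, by positivity, by linarith, fun z hz => ?_⟩
    refine image_eq_zero_of_notMem_tsupport fun hzt => hz ⟨?_, ?_⟩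
    · linarith [hxm hzt]
    · linarith [hym hzt]

lemma setIntegral_Ioi_eq_intervalIntegral {u : ℝ → ℝ} {a b : ℝ} (ha : 0 < a) (hab : a < b)
    (hu : ∀ x, x ∉ Ioo a b → u x = 0) : ∫ x in Ioi (0 : ℝ), u x = ∫ x in a..b, u x := by
  rw [intervalIntegral.integral_of_le hab.le]
  refine (setIntegral_eq_of_subset_of_forall_sdiff_eq_zero measurableSet_Ioi
    (fun x hx => ha.trans hx.1) fun x hx => hu x fun h => hx.2 ⟨h.1, h.2.le⟩)

lemma deriv_eq_zero_of_notMem_Ioo {φ : ℝ → ℝ} {a b : ℝ}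
    (hφ : ∀ x, x ∉ Ioo a b → φ x = 0) {x : ℝ} (hx : x ∉ Icc a b) : deriv φ x = 0 := by
  have : φ =ᶠ[𝓝 x] fun _ => 0 := by
    filter_upwards [isClosed_Icc.isOpen_compl.mem_nhds hx] with y hy
    exact hφ y fun h => hy (Ioo_subset_Icc_self h)
  rw [this.deriv_eq]
  simp

lemma IsRealTest.deriv_interval {φ : ℝ → ℝ} (h : IsRealTest φ) :
    ∃ a b : ℝ, 0 < a ∧ a < b ∧ (∀ x, x ∉ Ioo a b → φ x = 0) ∧ ∀ x, x ∉ Ioo a b → deriv φ x = 0 := by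
  obtain ⟨a, b, ha, hab, hφ⟩ := h.exists_interval
  refine ⟨a / 2, b + 1, by positivity, by linarith, fun x hx => hφ x fun h' => hx ?_,
    fun x hx => deriv_eq_zero_of_notMem_Ioo hφ fun h' => hx ?_⟩
  · exact ⟨by linarith [h'.1], by linarith [h'.2]⟩
  · exact ⟨by linarith [h'.1], by linarith [h'.2]⟩

lemma IsPrimitive.isRealWeakDeriv {f g : ℝ → ℝ} (h : IsPrimitive f g) : IsRealWeakDeriv f g where
  loc := h.locallyIntegrableOn
  loc' := h.loc
  eqn φ hφ := by
    obtain ⟨a, b, ha, hab, h1, h2⟩ := hφ.deriv_interval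
    have hb := ha.trans hab
    rw [setIntegral_Ioi_eq_intervalIntegral ha hab (fun x hx => by rw [h2 x hx, zero_mul]),
      setIntegral_Ioi_eq_intervalIntegral ha hab (fun x hx => by rw [h1 x hx, zero_mul])]
    have hp : ContDiff ℝ 1 φ := contDiff_infty.1 hφ.1 1
    have hsub := uIcc_subset_Ioi ha hb
    have e := (h.mul hp.contDiffOn).eqn a b ha hb
    rw [h1 a (by simp), h1 b (by simp), intervalIntegral.integral_add] at e
    · linarith
    · exact ((hp.continuous_deriv le_rfl).continuousOn.mul
        (h.continuousOn.mono hsub)).intervalIntegrable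
    · exact (intervalIntegrable_of_loc h.loc ha hb).continuousOn_mul hp.continuous.continuousOn

lemma IsRealTest.integrable_mul {φ f : ℝ → ℝ} (hφ : IsRealTest φ)
    (hf : LocallyIntegrableOn f (Ioi 0)) :
    IntegrableOn (fun r => φ r * f r) (Ioi 0) := by
  obtain ⟨h1, h2, h3⟩ := hφ
  have hK : IntegrableOn (fun r => φ r * f r) (tsupport φ) :=
    IntegrableOn.continuousOn_mul h1.continuous.continuousOn
      (hf.integrableOn_compact_subset h3 h2) h2
  refine ((integrableOn_iff_integrable_of_support_subset ?_).1 hK).integrableOn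
  intro r hr
  exact subset_tsupport φ (left_ne_zero_of_mul hr)

lemma IsRealTest.deriv {φ : ℝ → ℝ} (hφ : IsRealTest φ) : IsRealTest (deriv φ) := by
  obtain ⟨h1, h2, h3⟩ := hφ
  exact ⟨(contDiff_infty_iff_deriv.1 h1).2, h2.deriv,
    (closure_minimal (support_deriv_subset (f := φ)) (isClosed_tsupport φ)).trans h3⟩

lemma isRealTest_of_interval {φ : ℝ → ℝ} {a b : ℝ} (ha : 0 < a) (h : ContDiff ℝ ∞ φ)
    (hφ : ∀ x, x ∉ Icc a b → φ x = 0) : IsRealTest φ := by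
  have hs : tsupport φ ⊆ Icc a b := by
    refine closure_minimal (fun x hx => ?_) isClosed_Icc
    by_contra hc
    exact hx (hφ x hc)
  exact ⟨h, isCompact_Icc.of_isClosed_subset (isClosed_tsupport φ) hs,
    hs.trans fun x hx => ha.trans_le hx.1⟩

lemma exists_realTest_integral_eq_one : ∃ η : ℝ → ℝ, IsRealTest η ∧ ∫ r in Ioi (0 : ℝ), η r = 1 := by
  let bmp : ContDiffBump (2 : ℝ) := ⟨1 / 2, 1, by norm_num, by norm_num⟩
  have ht : tsupport (bmp.normed volume) ⊆ Icc 1 3 := by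
    rw [bmp.tsupport_normed_eq, Real.closedBall_eq_Icc]
    refine Icc_subset_Icc ?_ ?_ <;> norm_num [bmp]
  refine ⟨bmp.normed volume, isRealTest_of_interval (a := 1) (b := 3) one_pos bmp.contDiff_normed
    fun x hx => image_eq_zero_of_notMem_tsupport fun h => hx (ht h), ?_⟩
  rw [setIntegral_eq_integral_of_forall_compl_eq_zero, bmp.integral_normed]
  intro x hx
  refine image_eq_zero_of_notMem_tsupport fun h => hx ?_
  exact one_pos.trans_le (ht h).1

/-- A function with vanishing weak derivative is constant. -/
lemma IsRealWeakDeriv.ae_const {f : ℝ → ℝ} (h : IsRealWeakDeriv f fun _ => 0) :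
    ∃ c, ∀ᵐ r ∂volume.restrict (Ioi (0 : ℝ)), f r = c := by
  obtain ⟨η, hη, hη1⟩ := exists_realTest_integral_eq_one
  set c := ∫ r in Ioi (0 : ℝ), η r * f r with hc
  refine ⟨c, ?_⟩
  have hconst : LocallyIntegrableOn (fun _ : ℝ => c) (Ioi 0) :=
    (locallyIntegrable_const c).locallyIntegrableOn _
  have key := isOpen_Ioi.ae_eq_zero_of_integral_contDiff_smul_eq_zero (h.loc.sub hconst)
    (μ := volume) fun φ h1 h2 h3 => by
      have hφ : IsRealTest φ := ⟨h1, h2, h3⟩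
      set A := ∫ r in Ioi (0 : ℝ), φ r with hA
      -- The du Bois-Reymond argument: θ has integral zero, hence is the derivative of a test
      -- function and is annihilated by f, which says ∫ φ f = c ∫ φ.
      set θ : ℝ → ℝ := fun r => φ r - A * η r with hθ
      have cθ : ContDiff ℝ ∞ θ := h1.sub (contDiff_const.mul hη.1)
      have dΦ : ∀ r, HasDerivAt (fun r => ∫ s in (0 : ℝ)..r, θ s) (θ r) r := fun r =>
        intervalIntegral.integral_hasDerivAt_right (cθ.continuous.intervalIntegrable _ _)
          (cθ.continuous.stronglyMeasurableAtFilter _ _) cθ.continuous.continuousAt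
      have eΦ : deriv (fun r => ∫ s in (0 : ℝ)..r, θ s) = θ := funext fun r => (dΦ r).deriv
      obtain ⟨a₁, b₁, ha₁, hab₁, hz₁⟩ := hφ.exists_interval
      obtain ⟨a₂, b₂, ha₂, hab₂, hz₂⟩ := hη.exists_interval
      set a := min a₁ a₂
      set b := max b₁ b₂
      have ha : 0 < a := lt_min ha₁ ha₂
      have hθ0 : ∀ x, x ∉ Ioo a b → θ x = 0 := fun x hx => by
        rw [hθ]
        simp only
        rw [hz₁ x fun h => hx ⟨(min_le_left _ _).trans_lt h.1, h.2.trans_le (le_max_left _ _)⟩,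
          hz₂ x fun h => hx ⟨(min_le_right _ _).trans_lt h.1, h.2.trans_le (le_max_right _ _)⟩]
        ring
      have hab : a < b := (min_le_left _ _).trans_lt (hab₁.trans_le (le_max_left _ _))
      have iφ : IntegrableOn φ (Ioi 0) := (h1.continuous.integrable_of_hasCompactSupport h2).integrableOn
      have iη : IntegrableOn η (Ioi 0) :=
        (hη.1.continuous.integrable_of_hasCompactSupport hη.2.1).integrableOn
      have hθint : ∫ r in Ioi (0 : ℝ), θ r = 0 := by
        rw [hθ, integral_sub iφ (iη.const_mul A), integral_const_mul, hη1, ← hA]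
        ring
      have hΦ : IsRealTest fun r => ∫ s in (0 : ℝ)..r, θ s := by
        refine isRealTest_of_interval (a := a) (b := b) ha ?_ fun x hx => ?_
        · rw [contDiff_infty_iff_deriv, eΦ]
          exact ⟨fun r => (dΦ r).differentiableAt, cθ⟩
        · rcases lt_or_ge x a with hxa | hxa
          · rw [intervalIntegral.integral_congr (g := fun _ => 0)]
            · simp
            · intro y hy
              refine hθ0 y fun h => ?_
              have : y ≤ max 0 x := hy.2
              rcases le_max_iff.1 this with h' | h' <;> linarith [h.1]
          · have hxb : b < x := by
              by_contra hcon
              exact hx ⟨hxa, not_lt.1 hcon⟩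
            rw [intervalIntegral.integral_of_le (by linarith)]
            have e : ∫ y in Ioi (0 : ℝ), θ y = ∫ y in Ioc 0 x, θ y :=
              setIntegral_eq_of_subset_of_forall_sdiff_eq_zero measurableSet_Ioi
                (fun y hy => hy.1) fun y hy => hθ0 y fun h => hy.2 ⟨hy.1, by linarith [h.2]⟩
            rw [← e, hθint]
      have e1 := h.eqn _ hΦ
      rw [eΦ] at e1
      simp only [mul_zero, integral_zero, neg_zero] at e1
      have iφf := hφ.integrable_mul h.loc
      have iηf := hη.integrable_mul h.loc
      have e2 : ∫ r in Ioi (0 : ℝ), θ r * f r = (∫ r in Ioi (0 : ℝ), φ r * f r) - A * c := by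
        rw [hc, ← integral_const_mul, ← integral_sub iφf (iηf.const_mul A)]
        congr 1
        funext r
        rw [hθ]; ring
      have e3 : ∫ r, φ r • ((f - fun _ => c : ℝ → ℝ) r) = ∫ r in Ioi (0 : ℝ), φ r * (f r - c) := by
        rw [setIntegral_eq_integral_of_forall_compl_eq_zero]
        · rfl
        · intro x hx
          rw [image_eq_zero_of_notMem_tsupport fun h => hx (h3 h), zero_mul]
      have e4 : ∫ r in Ioi (0 : ℝ), φ r * (f r - c) = (∫ r in Ioi (0 : ℝ), φ r * f r) - A * c := by
        rw [hA, ← integral_mul_const, ← integral_sub iφf (iφ.mul_const c)]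
        congr 1
        funext r
        ring
      rw [e3, e4, ← e2, e1]
  rw [ae_restrict_iff' measurableSet_Ioi]
  filter_upwards [key] with r hr hr0
  have := hr hr0
  simp only [Pi.sub_apply] at this
  linarith

lemma IsRealWeakDeriv.sub {f g f₂ g₂ : ℝ → ℝ} (h : IsRealWeakDeriv f g)
    (h₂ : IsRealWeakDeriv f₂ g₂) :
    IsRealWeakDeriv (fun r => f r - f₂ r) (fun r => g r - g₂ r) where
  loc := h.loc.sub h₂.loc
  loc' := h.loc'.sub h₂.loc'
  eqn φ hφ := by
    simp only [mul_sub]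
    rw [integral_sub (hφ.deriv.integrable_mul h.loc) (hφ.deriv.integrable_mul h₂.loc),
      integral_sub (hφ.integrable_mul h.loc') (hφ.integrable_mul h₂.loc'),
      h.eqn φ hφ, h₂.eqn φ hφ]
    ring

/-- A weakly differentiable function agrees almost everywhere with a primitive of its weak
derivative. -/
lemma IsRealWeakDeriv.exists_primitive {f g : ℝ → ℝ} (h : IsRealWeakDeriv f g) :
    ∃ F, IsPrimitive F g ∧ f =ᵐ[volume.restrict (Ioi 0)] F := by
  have hG := isPrimitive_integral h.loc' one_pos
  have hd := h.sub hG.isRealWeakDeriv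
  simp only [sub_self] at hd
  obtain ⟨c, hc⟩ := hd.ae_const
  refine ⟨fun r => (∫ s in (1 : ℝ)..r, g s) + c, ⟨h.loc', fun a b ha hb => ?_⟩, ?_⟩
  · rw [← hG.eqn a b ha hb]; ring
  · filter_upwards [hc] with r hr
    rw [← hr]; ring

lemma IsRealWeakDeriv.ae_unique {f g g₂ : ℝ → ℝ} (h : IsRealWeakDeriv f g)
    (h₂ : IsRealWeakDeriv f g₂) : g =ᵐ[volume.restrict (Ioi 0)] g₂ := by
  have key := isOpen_Ioi.ae_eq_zero_of_integral_contDiff_smul_eq_zero (h.loc'.sub h₂.loc')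
    (μ := volume) fun φ h1 h2 h3 => by
      have hφ : IsRealTest φ := ⟨h1, h2, h3⟩
      have e : ∫ r, φ r • ((g - g₂) r) = ∫ r in Ioi (0 : ℝ), (φ r * g r - φ r * g₂ r) := by
        rw [setIntegral_eq_integral_of_forall_compl_eq_zero]
        · congr 1; funext r; simp [mul_sub]
        · intro x hx
          rw [image_eq_zero_of_notMem_tsupport fun h => hx (h3 h)]
          ring
      rw [e, integral_sub (hφ.integrable_mul h.loc') (hφ.integrable_mul h₂.loc')]
      have e1 := h.eqn φ hφ
      have e2 := h₂.eqn φ hφ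
      linarith
  rw [Filter.EventuallyEq, ae_restrict_iff' measurableSet_Ioi]
  filter_upwards [key] with r hr hr0
  have := hr hr0
  simp only [Pi.sub_apply] at this
  linarith

lemma IsRealTest.ofReal {φ : ℝ → ℝ} (h : IsRealTest φ) : IsTest fun r => (φ r : ℂ) := by
  have hs : tsupport (fun r => (φ r : ℂ)) ⊆ tsupport φ := by
    refine closure_mono fun x hx => ?_
    simpa using hx
  exact ⟨Complex.ofRealCLM.contDiff.comp h.1,
    h.2.1.isCompact.of_isClosed_subset (isClosed_tsupport _) hs, hs.trans h.2.2⟩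

lemma IsWeakDeriv.re {f f' : ℝ → ℂ} (h : IsWeakDeriv f f') :
    IsRealWeakDeriv (fun r => (f r).re) (fun r => (f' r).re) where
  loc := fun x hx => let ⟨s, hs, hi⟩ := h.loc x hx; ⟨s, hs, hi.re⟩
  loc' := fun x hx => let ⟨s, hs, hi⟩ := h.loc' x hx; ⟨s, hs, hi.re⟩
  eqn φ hφ := by
    have hd : ∀ r, deriv (fun r => (φ r : ℂ)) r = ((deriv φ r : ℝ) : ℂ) := fun r =>
      ((hφ.1.differentiable (by simp) r).hasDerivAt.ofReal_comp).deriv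
    have e := congrArg Complex.reCLM (h.eqn _ hφ.ofReal)
    rw [map_neg, ← ContinuousLinearMap.integral_comp_comm _ (hφ.ofReal.deriv.integrable_mul h.loc),
      ← ContinuousLinearMap.integral_comp_comm _ (hφ.ofReal.integrable_mul h.loc')] at e
    simpa only [hd, Complex.reCLM_apply, Complex.re_ofReal_mul] using e

lemma IsWeakDeriv.im {f f' : ℝ → ℂ} (h : IsWeakDeriv f f') :
    IsRealWeakDeriv (fun r => (f r).im) (fun r => (f' r).im) where
  loc := fun x hx => let ⟨s, hs, hi⟩ := h.loc x hx; ⟨s, hs, hi.im⟩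
  loc' := fun x hx => let ⟨s, hs, hi⟩ := h.loc' x hx; ⟨s, hs, hi.im⟩
  eqn φ hφ := by
    have hd : ∀ r, deriv (fun r => (φ r : ℂ)) r = ((deriv φ r : ℝ) : ℂ) := fun r =>
      ((hφ.1.differentiable (by simp) r).hasDerivAt.ofReal_comp).deriv
    have e := congrArg Complex.imCLM (h.eqn _ hφ.ofReal)
    rw [map_neg, ← ContinuousLinearMap.integral_comp_comm _ (hφ.ofReal.deriv.integrable_mul h.loc),
      ← ContinuousLinearMap.integral_comp_comm _ (hφ.ofReal.integrable_mul h.loc')] at e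
    simpa only [hd, Complex.imCLM_apply, Complex.im_ofReal_mul] using e

lemma IsWeakDeriv.ae_unique {f f' f'' : ℝ → ℂ} (h : IsWeakDeriv f f') (h₂ : IsWeakDeriv f f'') :
    f' =ᵐ[volume.restrict (Ioi 0)] f'' := by
  filter_upwards [h.re.ae_unique h₂.re, h.im.ae_unique h₂.im] with r h1 h2
  exact Complex.ext h1 h2

lemma isWeakDeriv_weakDeriv {f f' : ℝ → ℂ} (h : IsWeakDeriv f f') :
    IsWeakDeriv f (weakDeriv f) := by
  have hex : ∃ f', IsWeakDeriv f f' := ⟨f', h⟩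
  rw [weakDeriv, dif_pos hex]
  exact hex.choose_spec

lemma weakDeriv_ae_eq {f f' : ℝ → ℂ} (h : IsWeakDeriv f f') :
    weakDeriv f =ᵐ[volume.restrict (Ioi 0)] f' :=
  (isWeakDeriv_weakDeriv h).ae_unique h

/-- The classical derivative is a weak derivative. -/
lemma isWeakDeriv_of_contDiff {f : ℝ → ℂ} (hf : ContDiff ℝ 1 f) : IsWeakDeriv f (deriv f) where
  loc := hf.continuous.locallyIntegrable.locallyIntegrableOn _
  loc' := (hf.continuous_deriv le_rfl).locallyIntegrable.locallyIntegrableOn _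
  eqn φ hφ := by
    obtain ⟨h1, h2, h3⟩ := hφ
    have d1 : ∀ r, HasDerivAt φ (deriv φ r) r := fun r =>
      (h1.differentiable (by simp) r).hasDerivAt
    have d2 : ∀ r, HasDerivAt f (deriv f r) r := fun r =>
      (hf.differentiable (by simp) r).hasDerivAt
    have cf := hf.continuous
    have cf' : Continuous (deriv f) := hf.continuous_deriv le_rfl
    have cφ := h1.continuous
    have cφ' : Continuous (deriv φ) := h1.continuous_deriv (by simp)
    have i1 : Integrable fun r => deriv φ r * f r :=
      (cφ'.mul cf).integrable_of_hasCompactSupport h2.deriv.mul_right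
    have i2 : Integrable fun r => φ r * deriv f r :=
      (cφ.mul cf').integrable_of_hasCompactSupport h2.mul_right
    have i3 : Integrable fun r => φ r * f r :=
      (cφ.mul cf).integrable_of_hasCompactSupport h2.mul_right
    have e := integral_mul_deriv_eq_deriv_mul_of_integrable (fun r _ => d1 r) (fun r _ => d2 r) i2 i1 i3
    have hz : ∀ x, x ∉ Ioi (0 : ℝ) → φ x = 0 := fun x hx =>
      image_eq_zero_of_notMem_tsupport fun h => hx (h3 h)
    have hz' : ∀ x, x ∉ Ioi (0 : ℝ) → deriv φ x = 0 := fun x hx =>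
      image_eq_zero_of_notMem_tsupport fun h => hx (h3 (tsupport_deriv_subset h))
    rw [setIntegral_eq_integral_of_forall_compl_eq_zero (fun x hx => by rw [hz' x hx, zero_mul]),
      setIntegral_eq_integral_of_forall_compl_eq_zero (fun x hx => by rw [hz x hx, zero_mul]), e,
      neg_neg]

/-! ### Weighted square-integrability -/

lemma ae_radMeasure_iff {p : ℝ → Prop} :
    (∀ᵐ r ∂radMeasure, p r) ↔ ∀ᵐ r ∂volume.restrict (Ioi (0 : ℝ)), p r :=
  ⟨fun h => ac_radMeasure.ae_le h, fun h => radMeasure_ac.ae_le h⟩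

lemma aestronglyMeasurable_radMeasure {E : Type*} [NormedAddCommGroup E] {f : ℝ → E}
    (h : AEStronglyMeasurable f (volume.restrict (Ioi 0))) : AEStronglyMeasurable f radMeasure :=
  h.mono_ac radMeasure_ac

lemma eLpNorm_radMeasure_sq {E : Type*} [NormedAddCommGroup E] (f : ℝ → E) :
    eLpNorm f 2 radMeasure ^ 2
      = ENNReal.ofReal (2 * Real.pi) * ∫⁻ r in Ioi (0 : ℝ), ‖f r‖ₑ ^ 2 * ENNReal.ofReal r := by
  rw [eLpNorm_eq_lintegral_rpow_enorm_toReal two_ne_zero ENNReal.ofNat_ne_top]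
  simp only [ENNReal.toReal_ofNat, ENNReal.rpow_ofNat]
  rw [← ENNReal.rpow_ofNat, ← ENNReal.rpow_mul,
    show (1 / 2 * 2 : ℝ) = 1 by norm_num, ENNReal.rpow_one]
  unfold radMeasure
  rw [lintegral_withDensity_eq_lintegral_mul_non_measurable _ radDensity_measurable
    (.of_forall fun _ => ENNReal.ofReal_lt_top), ← lintegral_const_mul']
  · refine lintegral_congr fun r => ?_
    rw [Pi.mul_apply, ENNReal.ofReal_mul (by positivity), mul_assoc,
      mul_comm (ENNReal.ofReal r)]
  · exact ENNReal.ofReal_ne_top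

lemma l2norm_nonneg (f : ℝ → ℂ) : 0 ≤ l2norm f := ENNReal.toReal_nonneg

lemma l2norm_congr {f g : ℝ → ℂ} (h : f =ᵐ[volume.restrict (Ioi 0)] g) : l2norm f = l2norm g := by
  unfold l2norm
  rw [eLpNorm_congr_ae (radMeasure_ac.ae_le h)]

lemma l2norm_add_le {f g : ℝ → ℂ} (hf : MemLp f 2 radMeasure) (hg : MemLp g 2 radMeasure) :
    l2norm (f + g) ≤ l2norm f + l2norm g := by
  unfold l2norm
  rw [← ENNReal.toReal_add hf.2.ne hg.2.ne]
  exact ENNReal.toReal_mono (ENNReal.add_ne_top.2 ⟨hf.2.ne, hg.2.ne⟩)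
    (eLpNorm_add_le hf.1 hg.1 (by norm_num))

lemma l2norm_smul (c : ℝ) (f : ℝ → ℂ) : l2norm (c • f) = |c| * l2norm f := by
  unfold l2norm
  rw [eLpNorm_const_smul, ENNReal.toReal_mul]
  simp

lemma memLp_and_l2norm_le {f g : ℝ → ℂ} {C : ℝ} (hC : 0 ≤ C) (hg : MemLp g 2 radMeasure)
    (hf : AEStronglyMeasurable f (volume.restrict (Ioi 0)))
    (h : ∀ᵐ r ∂volume.restrict (Ioi (0 : ℝ)), ‖f r‖ ≤ C * ‖g r‖) :
    MemLp f 2 radMeasure ∧ l2norm f ≤ C * l2norm g := by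
  have h' := ae_radMeasure_iff.2 h
  refine ⟨hg.of_le_mul (aestronglyMeasurable_radMeasure hf) h', ?_⟩
  have := eLpNorm_le_mul_eLpNorm_of_ae_le_mul h' 2
  have e := ENNReal.toReal_mono (ENNReal.mul_ne_top ENNReal.ofReal_ne_top hg.2.ne) this
  rwa [ENNReal.toReal_mul, ENNReal.toReal_ofReal hC] at e

/-- The Cauchy-Schwarz inequality for the Lebesgue integral. -/
lemma sq_lintegral_mul_le {α : Type*} [MeasurableSpace α] {μ : Measure α} {f g : α → ℝ≥0∞}
    (hf : AEMeasurable f μ) (hg : AEMeasurable g μ) :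
    (∫⁻ x, f x * g x ∂μ) ^ 2 ≤ (∫⁻ x, f x ^ 2 ∂μ) * ∫⁻ x, g x ^ 2 ∂μ := by
  have h := ENNReal.lintegral_mul_le_Lp_mul_Lq μ Real.HolderConjugate.two_two hf hg
  simp only [Pi.mul_apply, ENNReal.rpow_ofNat] at h
  refine (pow_le_pow_left₀ zero_le h 2).trans_eq ?_
  rw [mul_pow, ← ENNReal.rpow_ofNat, ← ENNReal.rpow_ofNat, ← ENNReal.rpow_mul, ← ENNReal.rpow_mul]
  norm_num

/-- Local Cauchy-Schwarz bound for functions in `L²(2π r dr)`. -/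
lemma radial_cauchy_schwarz {u b : ℝ → ℝ} {C : ℝ} (hC : 0 ≤ C)
    (hu : MemLp (fun r => (u r : ℂ)) 2 radMeasure)
    (hb : AEStronglyMeasurable b (volume.restrict (Ioi 0)))
    (hbC : ∀ r, 0 < r → |b r| ≤ C) {r : ℝ} (hr : 0 < r) :
    IntegrableOn (fun s => b s * u s * s) (Ioc 0 r) ∧
      |∫ s in (0 : ℝ)..r, b s * u s * s| ≤ C * l2norm (fun r => (u r : ℂ)) * r := by
  obtain ⟨u1, u2⟩ := memLp_radMeasure_iff.1 hu
  have u1' : AEStronglyMeasurable u (volume.restrict (Ioi 0)) := u1.re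
  simp only [Complex.norm_real, Real.norm_eq_abs, sq_abs] at u2
  have hsub : Ioc 0 r ⊆ Ioi (0 : ℝ) := fun x hx => hx.1
  have mono := Measure.restrict_mono hsub (le_refl (volume : Measure ℝ))
  have hid : IntegrableOn (fun s : ℝ => s) (Ioc 0 r) :=
    (continuous_id.integrableOn_Icc (a := 0) (b := r)).mono_set Ioc_subset_Icc_self
  have hbu : IntegrableOn (fun s => b s * u s * s) (Ioc 0 r) := by
    refine integrableOn_mul_of_sq measurableSet_Ioc (fun x hx => hx.1.le) (hb.mono_measure mono)
      (u1'.mono_measure mono) continuous_id.aestronglyMeasurable ?_ (u2.mono_set hsub)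
    refine Integrable.mono' (hid.const_mul (C ^ 2))
      (((hb.mono_measure mono).pow 2).mul continuous_id.aestronglyMeasurable) ?_
    filter_upwards [ae_restrict_mem measurableSet_Ioc] with x hx
    have hx0 : 0 < x := hx.1
    rw [Real.norm_eq_abs, abs_mul, abs_of_pos hx0, abs_pow]
    have := hbC x hx0
    gcongr
  refine ⟨hbu, ?_⟩
  have hiu : IntegrableOn (fun s => |u s| * s) (Ioc 0 r) := by
    have := integrableOn_mul_of_sq (f := fun _ => 1) measurableSet_Ioc (fun x hx => hx.1.le)
      aestronglyMeasurable_const ((u1'.mono_measure mono).norm)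
      (continuous_id.aestronglyMeasurable) (by simpa using hid)
      (by simpa using u2.mono_set hsub)
    simpa using this
  have h1 : |∫ s in (0 : ℝ)..r, b s * u s * s| ≤ C * ∫ s in Ioc 0 r, |u s| * s := by
    rw [intervalIntegral.integral_of_le hr.le, ← integral_const_mul]
    refine (abs_integral_le_integral_abs).trans
      (setIntegral_mono_on hbu.abs (hiu.const_mul C) measurableSet_Ioc fun x hx => ?_)
    have hx0 : 0 < x := hx.1
    rw [abs_mul, abs_mul, abs_of_pos hx0, mul_assoc]
    have := hbC x hx0
    gcongr
  rw [mul_assoc]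
  refine h1.trans (mul_le_mul_of_nonneg_left ?_ hC)
  set N := l2norm (fun r => (u r : ℂ)) with hN
  have hN0 : 0 ≤ N := l2norm_nonneg _
  have hNsq : ∫ s in Ioc 0 r, u s ^ 2 * s ≤ N ^ 2 := by
    have e := l2norm_sq hu
    simp only [Complex.norm_real, Real.norm_eq_abs, sq_abs] at e
    have e2 : ∫ s in Ioc 0 r, u s ^ 2 * s ≤ ∫ s in Ioi (0 : ℝ), u s ^ 2 * s :=
      setIntegral_mono_set u2 ((ae_restrict_iff' measurableSet_Ioi).2 (.of_forall fun x hx => by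
        have : 0 < x := hx
        positivity)) hsub.eventuallyLE
    have e3 : 0 ≤ ∫ s in Ioi (0 : ℝ), u s ^ 2 * s := setIntegral_nonneg measurableSet_Ioi
      fun x hx => by have : 0 < x := hx; positivity
    have := Real.pi_gt_three
    rw [hN, e]
    nlinarith
  have hidr : ∫ s in Ioc 0 r, s = r ^ 2 / 2 := by
    rw [← intervalIntegral.integral_of_le hr.le, integral_id]; ring
  by_contra hcon
  push Not at hcon
  -- Integrate 2l|u| ≤ l² + u² with l free. The choice l = N/r contradicts an integral larger than
  -- Nr; when N = 0, l = J/r² does.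
  have key : ∀ l : ℝ, 2 * l * (∫ s in Ioc 0 r, |u s| * s) ≤ l ^ 2 * (r ^ 2 / 2) + N ^ 2 := by
    intro l
    have : ∫ s in Ioc 0 r, (2 * l * (|u s| * s)) ≤ ∫ s in Ioc 0 r, (l ^ 2 * s + u s ^ 2 * s) := by
      refine setIntegral_mono_on (hiu.const_mul _) ((hid.const_mul _).add (u2.mono_set hsub))
        measurableSet_Ioc fun x hx => ?_
      have hx0 : 0 < x := hx.1
      have := sq_nonneg (l - |u x|)
      rw [sub_sq, sq_abs] at this
      nlinarith
    rw [integral_const_mul, integral_add (hid.const_mul _) (u2.mono_set hsub), integral_const_mul,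
      hidr] at this
    linarith
  have h2 := key (N / r)
  have e : (N / r) ^ 2 * (r ^ 2 / 2) = N ^ 2 / 2 := by field_simp
  rcases hN0.eq_or_lt with h0 | h0
  · set J := ∫ s in Ioc 0 r, |u s| * s
    rw [← h0] at hcon hNsq key
    have := key (J / r ^ 2)
    have e2 : 2 * (J / r ^ 2) * J = 2 * (J ^ 2 / r ^ 2) := by ring
    have e3 : (J / r ^ 2) ^ 2 * (r ^ 2 / 2) = (J ^ 2 / r ^ 2) / 2 := by field_simp
    rw [e2, e3] at this
    have hJ : 0 < J := by simpa using hcon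
    have : 0 < J ^ 2 / r ^ 2 := by positivity
    linarith
  · have : 2 * (N / r) * (N * r) < 2 * (N / r) * ∫ s in Ioc 0 r, |u s| * s := by gcongr
    have e2 : 2 * (N / r) * (N * r) = 2 * N ^ 2 := by field_simp
    rw [e] at h2
    nlinarith

/-! ### A weighted Hardy inequality -/

lemma weight_nonneg (m : ℕ) {r : ℝ} (hr : 0 < r) : 0 ≤ weight m r := by
  unfold weight; split_ifs <;> positivity

lemma weight_mul_le_one (m : ℕ) {r : ℝ} (hr : 0 < r) : weight m r * r ≤ 1 := by
  unfold weight
  split_ifs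
  · rw [inv_mul_le_iff₀ (by positivity)]; linarith
  · rw [inv_mul_cancel₀ hr.ne']

lemma one_le_weight_mul (m : ℕ) {r : ℝ} (hr : 0 < r) : 1 ≤ weight m r * (1 + r) := by
  unfold weight
  split_ifs
  · rw [inv_mul_cancel₀ (by positivity)]
  · rw [← div_eq_inv_mul, one_le_div hr]; linarith

@[fun_prop] lemma measurable_weight (m : ℕ) : Measurable (weight m) := by
  unfold weight
  split_ifs <;> fun_prop

/-- Up to the factor 2, r²Q is nonincreasing beyond 1, where it behaves like r^(-m). -/
lemma profile_mul_sq_le (m : ℕ) {s r : ℝ} (hs : 1 ≤ s) (hsr : s ≤ r) :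
    profile m r * r ^ 2 ≤ 2 * s ^ 2 * profile m s := by
  have hr : 1 ≤ r := hs.trans hsr
  have h : r ^ m * r ^ 2 * (1 + s ^ (2 * (m + 1))) ≤ 2 * s ^ 2 * s ^ m * (1 + r ^ (2 * (m + 1))) := by
    have e1 : 1 ≤ s ^ (2 * (m + 1)) := one_le_pow₀ hs
    have e2 : s ^ (2 * (m + 1)) = s ^ 2 * s ^ m * s ^ m := by ring
    have e3 : r ^ (2 * (m + 1)) = r ^ 2 * r ^ m * r ^ m := by ring
    have e4 : s ^ m ≤ r ^ m := by gcongr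
    calc r ^ m * r ^ 2 * (1 + s ^ (2 * (m + 1))) ≤ r ^ m * r ^ 2 * (2 * s ^ (2 * (m + 1))) := by
          gcongr; linarith
      _ = 2 * s ^ 2 * s ^ m * (r ^ 2 * r ^ m * s ^ m) := by rw [e2]; ring
      _ ≤ 2 * s ^ 2 * s ^ m * (r ^ 2 * r ^ m * r ^ m) := by gcongr
      _ ≤ 2 * s ^ 2 * s ^ m * (1 + r ^ (2 * (m + 1))) := by
          gcongr; rw [e3]; linarith
  unfold profile
  rw [div_mul_eq_mul_div, mul_div_assoc', div_le_div_iff₀ (den_pos m r) (den_pos m s)]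
  have := mul_le_mul_of_nonneg_left h (show 0 ≤ Real.sqrt 8 * (m + 1) by positivity)
  linarith

/-- Below 1 the denominators of Q lie between 1 and 2. The powers compare because r^(m-1) is
nondecreasing for m ≥ 1, and because weight and s are at most 1 for m = 0. -/
lemma weight_mul_profile_le (m : ℕ) {s r : ℝ} (hr : 0 < r) (hsr : r ≤ s) (hs : s ≤ 1) :
    weight m r * profile m r * s ≤ 2 * profile m s := by
  have hs0 : 0 < s := hr.trans_le hsr
  have key : weight m r * r ^ m * s * (1 + s ^ (2 * (m + 1)))
      ≤ 2 * s ^ m * (1 + r ^ (2 * (m + 1))) := by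
    have e1 : s ^ (2 * (m + 1)) ≤ 1 := pow_le_one₀ hs0.le hs
    have e2 : weight m r * r ^ m * s ≤ s ^ m := by
      rcases m with _ | m
      · simp only [weight, if_true, pow_zero, mul_one]
        rw [inv_mul_le_iff₀ (by positivity)]; linarith
      · simp only [weight, Nat.succ_ne_zero, if_false]
        rw [pow_succ, pow_succ]
        have : r⁻¹ * (r ^ m * r) * s = r ^ m * s := by field_simp
        rw [this]
        gcongr
    have e3 : 0 ≤ r ^ (2 * (m + 1)) := by positivity
    have hw := weight_nonneg m hr
    calc weight m r * r ^ m * s * (1 + s ^ (2 * (m + 1))) ≤ s ^ m * 2 := by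
          gcongr; linarith
      _ ≤ 2 * s ^ m * (1 + r ^ (2 * (m + 1))) := by
          nlinarith [show 0 ≤ s ^ m by positivity]
  unfold profile
  rw [mul_div_assoc', div_mul_eq_mul_div, mul_div_assoc',
    div_le_div_iff₀ (den_pos m r) (den_pos m s)]
  have := mul_le_mul_of_nonneg_left key (show 0 ≤ Real.sqrt 8 * (m + 1) by positivity)
  linarith

/-- The kernel that controls the square of `r^{1/2} w Q ∫₁^r |h| / Q`. -/
def hardyKernel (r s : ℝ) : ℝ≥0∞ :=
  (if 1 < s ∧ s ≤ r then ENNReal.ofReal (4 * s ^ 4 / r ^ 4) else 0)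
    + if r < s ∧ s ≤ 1 then 4 else 0

lemma measurable_hardyKernel : Measurable fun p : ℝ × ℝ => hardyKernel p.1 p.2 := by
  unfold hardyKernel
  refine Measurable.add (Measurable.ite ?_ (by fun_prop) measurable_const)
    (Measurable.ite ?_ measurable_const measurable_const)
  · exact (measurableSet_lt measurable_const measurable_snd).inter
      (measurableSet_le measurable_snd measurable_fst)
  · exact (measurableSet_lt measurable_fst measurable_snd).inter
      (measurableSet_le measurable_snd measurable_const)

/-- The inner kernel has mass 4s and the outer one 4s/3. The factor s is the weight of L²(s ds), and
4 = 2² becomes the constant of `hardy`. -/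
lemma lintegral_hardyKernel_le {s : ℝ} (hs : 0 < s) :
    ∫⁻ r in Ioi (0 : ℝ), hardyKernel r s ≤ 4 * ENNReal.ofReal s := by
  rcases le_or_gt s 1 with h1 | h1
  · calc ∫⁻ r in Ioi (0 : ℝ), hardyKernel r s
        ≤ ∫⁻ r in Ioi (0 : ℝ), (Iio s).indicator (fun _ => 4) r := by
          refine lintegral_mono fun r => ?_
          unfold hardyKernel
          rw [if_neg (fun h => absurd h.1 (not_lt.2 h1)), zero_add, indicator]
          simp only [mem_Iio, h1, and_true]
          exact le_rfl
      _ = 4 * volume (Iio s ∩ Ioi 0) := by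
          rw [lintegral_indicator measurableSet_Iio, Measure.restrict_restrict measurableSet_Iio,
            setLIntegral_const]
      _ = 4 * ENNReal.ofReal s := by
          rw [inter_comm, Ioi_inter_Iio, Real.volume_Ioo, sub_zero]
  · have hi : IntegrableOn (fun r : ℝ => 4 * s ^ 4 * r ^ (-4 : ℝ)) (Ioi s) :=
      (integrableOn_Ioi_rpow_of_lt (by norm_num) hs).const_mul _
    calc ∫⁻ r in Ioi (0 : ℝ), hardyKernel r s
        ≤ ∫⁻ r in Ioi (0 : ℝ), (Ici s).indicator
            (fun r => ENNReal.ofReal (4 * s ^ 4 * r ^ (-4 : ℝ))) r := by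
          refine setLIntegral_mono' measurableSet_Ioi fun r hr => ?_
          have hr0 : 0 < r := hr
          unfold hardyKernel
          rw [if_neg (fun h : r < s ∧ s ≤ 1 => absurd h.2 (not_le.2 h1)), add_zero, indicator]
          simp only [mem_Ici, h1, true_and]
          have : 4 * s ^ 4 / r ^ 4 = 4 * s ^ 4 * r ^ (-4 : ℝ) := by
            rw [Real.rpow_neg hr0.le, Real.rpow_ofNat, div_eq_mul_inv]
          rw [this]
      _ = ∫⁻ r in Ioi s, ENNReal.ofReal (4 * s ^ 4 * r ^ (-4 : ℝ)) := by
          rw [lintegral_indicator measurableSet_Ici, Measure.restrict_restrict measurableSet_Ici,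
            inter_eq_left.2 (show Ici s ⊆ Ioi 0 from fun x hx => hs.trans_le hx), restrict_Ioi_eq_restrict_Ici]
      _ = ENNReal.ofReal (4 * s / 3) := by
          rw [← ofReal_integral_eq_lintegral_ofReal hi, integral_const_mul,
            integral_Ioi_rpow_of_lt (by norm_num) hs]
          · congr 1
            have : s ^ (-4 + 1 : ℝ) = (s ^ 3)⁻¹ := by
              rw [show (-4 + 1 : ℝ) = -3 by norm_num, Real.rpow_neg hs.le, Real.rpow_ofNat]
            rw [this]
            field_simp
            norm_num
          · filter_upwards [ae_restrict_mem measurableSet_Ioi] with r hr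
            have : 0 < r := hs.trans hr
            positivity
      _ ≤ 4 * ENNReal.ofReal s := by
          rw [← ENNReal.ofReal_ofNat 4, ← ENNReal.ofReal_mul (by norm_num)]
          exact ENNReal.ofReal_le_ofReal (by linarith)

/-- Cauchy-Schwarz at fixed r. For r ≤ 1 the integrand is split as (2/s)·|h| with ∫_r^1 4/s² ≤ 4/r.
For r > 1 it is 1·(2s²/r³)|h| on an interval of length at most r. Both leave `hardyKernel`. -/
lemma ofReal_mul_lintegral_sq_le {m : ℕ} {h u : ℝ → ℝ}
    (hh : AEMeasurable h (volume.restrict (Ioi 0)))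
    (hu : ∀ s, 0 < s → |u s| ≤ |h s| / profile m s) {r : ℝ} (hr : 0 < r) :
    ‖weight m r * profile m r * ∫ s in (1 : ℝ)..r, u s‖ₑ ^ 2 * ENNReal.ofReal r
      ≤ ∫⁻ s in Ioi (0 : ℝ), hardyKernel r s * ‖h s‖ₑ ^ 2 := by
  have hw := weight_nonneg m hr
  have hq := profile_nonneg m hr.le
  have he : ∀ x : ℝ, ‖x‖ₑ = ENNReal.ofReal |x| := fun x => by
    rw [← Real.enorm_eq_ofReal_abs]
  have hbound : ‖weight m r * profile m r * ∫ s in (1 : ℝ)..r, u s‖ₑ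
      ≤ ∫⁻ s in uIoc 1 r, ENNReal.ofReal (weight m r * profile m r) * ‖u s‖ₑ := by
    rw [lintegral_const_mul' _ _ ENNReal.ofReal_ne_top, enorm_mul, he (weight m r * profile m r),
      abs_of_nonneg (by positivity)]
    gcongr
    rw [← ofReal_norm, intervalIntegral.norm_integral_eq_norm_integral_uIoc, ofReal_norm]
    exact enorm_integral_le_lintegral_enorm _
  rcases le_or_gt r 1 with h1 | h1
  · have hsub : Ioc r 1 ⊆ Ioi (0 : ℝ) := fun x hx => hr.trans hx.1
    have hm : AEMeasurable h (volume.restrict (Ioc r 1)) :=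
      hh.mono_measure (Measure.restrict_mono hsub le_rfl)
    have b2 : ‖weight m r * profile m r * ∫ s in (1 : ℝ)..r, u s‖ₑ
        ≤ ∫⁻ s in Ioc r 1, ENNReal.ofReal (2 * s⁻¹) * ‖h s‖ₑ := by
      refine hbound.trans ?_
      rw [uIoc_of_ge h1]
      refine setLIntegral_mono' measurableSet_Ioc fun s hs => ?_
      have hs0 : 0 < s := hsub hs
      have hqs := profile_pos m hs0
      rw [he, he, ← ENNReal.ofReal_mul (by positivity), ← ENNReal.ofReal_mul (by positivity)]
      refine ENNReal.ofReal_le_ofReal ?_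
      calc weight m r * profile m r * |u s| ≤ weight m r * profile m r * (|h s| / profile m s) := by
            gcongr; exact hu s hs0
        _ = (weight m r * profile m r * s) * (s⁻¹ * |h s| / profile m s) := by field_simp
        _ ≤ (2 * profile m s) * (s⁻¹ * |h s| / profile m s) := by
            exact mul_le_mul_of_nonneg_right (weight_mul_profile_le m hr hs.1.le hs.2)
              (by positivity)
        _ = 2 * s⁻¹ * |h s| := by field_simp
    have b3 : ∫⁻ s in Ioc r 1, ENNReal.ofReal (2 * s⁻¹) ^ 2 ≤ ENNReal.ofReal (4 * r⁻¹) := by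
      have hi : IntegrableOn (fun s : ℝ => 4 * s ^ (-2 : ℝ)) (Ioi r) :=
        (integrableOn_Ioi_rpow_of_lt (by norm_num) hr).const_mul _
      calc ∫⁻ s in Ioc r 1, ENNReal.ofReal (2 * s⁻¹) ^ 2
          = ∫⁻ s in Ioc r 1, ENNReal.ofReal (4 * s ^ (-2 : ℝ)) := by
            refine setLIntegral_congr_fun measurableSet_Ioc fun s hs => ?_
            have hs0 : 0 < s := hsub hs
            rw [← ENNReal.ofReal_pow (by positivity), Real.rpow_neg hs0.le, Real.rpow_ofNat]
            congr 1
            field_simp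
            norm_num
        _ ≤ ∫⁻ s in Ioi r, ENNReal.ofReal (4 * s ^ (-2 : ℝ)) :=
            lintegral_mono_set Ioc_subset_Ioi_self
        _ = ENNReal.ofReal (4 * r⁻¹) := by
            rw [← ofReal_integral_eq_lintegral_ofReal hi, integral_const_mul,
              integral_Ioi_rpow_of_lt (by norm_num) hr]
            · congr 1
              rw [show (-2 + 1 : ℝ) = -1 by norm_num, Real.rpow_neg_one]
              ring
            · filter_upwards [ae_restrict_mem measurableSet_Ioi] with s hs
              have : 0 < s := hr.trans hs
              positivity
    calc _ ≤ (∫⁻ s in Ioc r 1, ENNReal.ofReal (2 * s⁻¹) * ‖h s‖ₑ) ^ 2 * ENNReal.ofReal r := by gcongr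
      _ ≤ (∫⁻ s in Ioc r 1, ENNReal.ofReal (2 * s⁻¹) ^ 2) * (∫⁻ s in Ioc r 1, ‖h s‖ₑ ^ 2)
            * ENNReal.ofReal r := by
          gcongr
          exact sq_lintegral_mul_le (by fun_prop) hm.enorm
      _ ≤ ENNReal.ofReal (4 * r⁻¹) * (∫⁻ s in Ioc r 1, ‖h s‖ₑ ^ 2) * ENNReal.ofReal r := by
          gcongr
      _ = 4 * ∫⁻ s in Ioc r 1, ‖h s‖ₑ ^ 2 := by
          rw [mul_right_comm, ← ENNReal.ofReal_mul (by positivity), mul_assoc,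
            inv_mul_cancel₀ hr.ne', mul_one, ENNReal.ofReal_ofNat]
      _ = ∫⁻ s in Ioc r 1, 4 * ‖h s‖ₑ ^ 2 := by rw [lintegral_const_mul' _ _ (by norm_num)]
      _ ≤ ∫⁻ s in Ioc r 1, hardyKernel r s * ‖h s‖ₑ ^ 2 := by
          refine setLIntegral_mono' measurableSet_Ioc fun s hs => ?_
          gcongr
          unfold hardyKernel
          rw [if_pos (show r < s ∧ s ≤ 1 from hs)]
          exact le_add_self
      _ ≤ _ := lintegral_mono_set hsub
  · have hsub : Ioc 1 r ⊆ Ioi (0 : ℝ) := fun x hx => one_pos.trans hx.1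
    have hm : AEMeasurable h (volume.restrict (Ioc 1 r)) :=
      hh.mono_measure (Measure.restrict_mono hsub le_rfl)
    have b2 : ‖weight m r * profile m r * ∫ s in (1 : ℝ)..r, u s‖ₑ
        ≤ ∫⁻ s in Ioc 1 r, 1 * (ENNReal.ofReal (2 * s ^ 2 / r ^ 3) * ‖h s‖ₑ) := by
      refine hbound.trans ?_
      rw [uIoc_of_le h1.le]
      refine setLIntegral_mono' measurableSet_Ioc fun s hs => ?_
      have hs0 : 0 < s := hsub hs
      have hqs := profile_pos m hs0
      rw [he, he, one_mul, ← ENNReal.ofReal_mul (by positivity),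
        ← ENNReal.ofReal_mul (by positivity)]
      refine ENNReal.ofReal_le_ofReal ?_
      calc weight m r * profile m r * |u s| ≤ weight m r * profile m r * (|h s| / profile m s) := by
            gcongr; exact hu s hs0
        _ = (weight m r * r) * (profile m r * r ^ 2) * (|h s| / profile m s / r ^ 3) := by
            field_simp
        _ ≤ 1 * (2 * s ^ 2 * profile m s) * (|h s| / profile m s / r ^ 3) := by
            exact mul_le_mul_of_nonneg_right (mul_le_mul (weight_mul_le_one m hr)
              (profile_mul_sq_le m hs.1.le hs.2) (by positivity) zero_le_one) (by positivity)
        _ = 2 * s ^ 2 / r ^ 3 * |h s| := by field_simp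
    calc _ ≤ (∫⁻ s in Ioc 1 r, 1 * (ENNReal.ofReal (2 * s ^ 2 / r ^ 3) * ‖h s‖ₑ)) ^ 2
            * ENNReal.ofReal r := by gcongr
      _ ≤ ((∫⁻ s in Ioc 1 r, 1 ^ 2) * (∫⁻ s in Ioc 1 r,
            (ENNReal.ofReal (2 * s ^ 2 / r ^ 3) * ‖h s‖ₑ) ^ 2)) * ENNReal.ofReal r := by
          gcongr
          exact sq_lintegral_mul_le aemeasurable_const (AEMeasurable.mul (by fun_prop) hm.enorm)
      _ ≤ (ENNReal.ofReal r * (∫⁻ s in Ioc 1 r,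
            (ENNReal.ofReal (2 * s ^ 2 / r ^ 3) * ‖h s‖ₑ) ^ 2)) * ENNReal.ofReal r := by
          gcongr
          rw [one_pow, setLIntegral_const, one_mul, Real.volume_Ioc]
          exact ENNReal.ofReal_le_ofReal (by linarith)
      _ = ENNReal.ofReal (r ^ 2) * (∫⁻ s in Ioc 1 r,
            (ENNReal.ofReal (2 * s ^ 2 / r ^ 3) * ‖h s‖ₑ) ^ 2) := by
          rw [mul_right_comm, ← ENNReal.ofReal_mul hr.le, sq]
      _ = ∫⁻ s in Ioc 1 r, ENNReal.ofReal (r ^ 2)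
            * (ENNReal.ofReal (2 * s ^ 2 / r ^ 3) * ‖h s‖ₑ) ^ 2 := by
          rw [lintegral_const_mul' _ _ ENNReal.ofReal_ne_top]
      _ ≤ ∫⁻ s in Ioc 1 r, hardyKernel r s * ‖h s‖ₑ ^ 2 := by
          refine setLIntegral_mono' measurableSet_Ioc fun s hs => ?_
          have hs0 : 0 < s := hsub hs
          rw [mul_pow, ← mul_assoc]
          gcongr
          unfold hardyKernel
          rw [if_pos (show 1 < s ∧ s ≤ r from hs), ← ENNReal.ofReal_pow (by positivity),
            ← ENNReal.ofReal_mul (by positivity)]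
          have : r ^ 2 * (2 * s ^ 2 / r ^ 3) ^ 2 = 4 * s ^ 4 / r ^ 4 := by field_simp; norm_num
          rw [this]
          exact le_self_add
      _ ≤ _ := lintegral_mono_set hsub

/-- The weighted Hardy inequality for the primitive that vanishes at `r = 1`. -/
lemma hardy {m : ℕ} {h u : ℝ → ℝ} (hh : MemLp (fun r => (h r : ℂ)) 2 radMeasure)
    (hu : ∀ s, 0 < s → |u s| ≤ |h s| / profile m s)
    (hul : LocallyIntegrableOn u (Ioi 0)) :
    MemLp (fun r => ((weight m r * profile m r * ∫ s in (1 : ℝ)..r, u s : ℝ) : ℂ)) 2 radMeasure ∧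
      l2norm (fun r => ((weight m r * profile m r * ∫ s in (1 : ℝ)..r, u s : ℝ) : ℂ))
        ≤ 2 * l2norm (fun r => (h r : ℂ)) := by
  have hm : AEMeasurable h (volume.restrict (Ioi 0)) :=
    ((memLp_radMeasure_iff.1 hh).1.re).aemeasurable
  have key : eLpNorm (fun r => ((weight m r * profile m r * ∫ s in (1 : ℝ)..r, u s : ℝ) : ℂ)) 2
      radMeasure ≤ 2 * eLpNorm (fun r => (h r : ℂ)) 2 radMeasure := by
    refine (ENNReal.pow_le_pow_left_iff two_ne_zero).1 ?_
    rw [mul_pow, eLpNorm_radMeasure_sq, eLpNorm_radMeasure_sq, mul_left_comm]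
    refine mul_le_mul_right ?_ _
    have en : ∀ x : ℝ, ‖(x : ℂ)‖ₑ = ‖x‖ₑ := fun x => by
      rw [← ofReal_norm, Complex.norm_real, ofReal_norm]
    simp only [en]
    calc _ ≤ ∫⁻ r in Ioi (0 : ℝ), ∫⁻ s in Ioi (0 : ℝ), hardyKernel r s * ‖h s‖ₑ ^ 2 :=
          setLIntegral_mono' measurableSet_Ioi fun r hr => ofReal_mul_lintegral_sq_le hm hu hr
      -- Tonelli: the kernel is integrated in r first.
      _ = ∫⁻ s in Ioi (0 : ℝ), ∫⁻ r in Ioi (0 : ℝ), hardyKernel r s * ‖h s‖ₑ ^ 2 :=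
          lintegral_lintegral_swap (measurable_hardyKernel.aemeasurable.mul
            ((hm.enorm.pow_const 2).comp_snd))
      _ = ∫⁻ s in Ioi (0 : ℝ), (∫⁻ r in Ioi (0 : ℝ), hardyKernel r s) * ‖h s‖ₑ ^ 2 := by
          refine lintegral_congr fun s => ?_
          rw [lintegral_mul_const' _ _ (by simp)]
      _ ≤ ∫⁻ s in Ioi (0 : ℝ), 2 ^ 2 * (‖h s‖ₑ ^ 2 * ENNReal.ofReal s) := by
          refine setLIntegral_mono' measurableSet_Ioi fun s hs => ?_
          calc _ ≤ (4 * ENNReal.ofReal s) * ‖h s‖ₑ ^ 2 := by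
                gcongr; exact lintegral_hardyKernel_le hs
            _ = _ := by norm_num; ring
      _ = _ := by rw [lintegral_const_mul' _ _ (by norm_num)]
  have hmeas : AEStronglyMeasurable
      (fun r => ((weight m r * profile m r * ∫ s in (1 : ℝ)..r, u s : ℝ) : ℂ)) radMeasure := by
    refine aestronglyMeasurable_radMeasure ?_
    refine Complex.continuous_ofReal.comp_aestronglyMeasurable ?_
    exact ((measurable_weight m).aestronglyMeasurable.mul
      (continuous_profile m).aestronglyMeasurable).mul
      ((isPrimitive_integral hul one_pos).continuousOn.aestronglyMeasurable measurableSet_Ioi)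
  have hfin : 2 * eLpNorm (fun r => (h r : ℂ)) 2 radMeasure ≠ ⊤ :=
    ENNReal.mul_ne_top (by norm_num) hh.2.ne
  refine ⟨⟨hmeas, key.trans_lt hfin.lt_top⟩, ?_⟩
  have := ENNReal.toReal_mono hfin key
  rwa [ENNReal.toReal_mul, ENNReal.toReal_ofNat] at this

/-! ### Boundedness of `L_Q` on the energy space -/

lemma memLp_of_sq_mul_le {f : ℝ → ℂ} {C : ℝ}
    (hf : AEStronglyMeasurable f (volume.restrict (Ioi 0)))
    (h : ∀ r, 0 < r → ‖f r‖ ^ 2 * r * (1 + r ^ 2) ≤ C) : MemLp f 2 radMeasure := by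
  refine memLp_radMeasure_iff.2 ⟨hf, ?_⟩
  refine Integrable.mono' ((integrable_inv_one_add_sq.const_mul C).integrableOn (s := Ioi 0))
    ((hf.norm.pow 2).mul continuous_id.aestronglyMeasurable) ?_
  filter_upwards [ae_restrict_mem measurableSet_Ioi] with r hr
  have hr0 : 0 < r := hr
  rw [Real.norm_eq_abs, abs_of_nonneg (by positivity), ← div_eq_mul_inv, le_div_iff₀ (by positivity)]
  exact h r hr

lemma exists_profile_mul_sq_le (m : ℕ) :
    ∃ C, 0 ≤ C ∧ ∀ r, 0 ≤ r → profile m r * (1 + r) ^ 2 ≤ C := by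
  refine ⟨_, by positivity, fun r hr => le_trans ?_ (profile_mul_le m hr)⟩
  refine mul_le_mul_of_nonneg_left ?_ (profile_nonneg m hr)
  exact pow_le_pow_right₀ (by linarith) (by omega)

lemma exists_weight_mul_profile_le (m : ℕ) :
    ∃ C, 0 ≤ C ∧ ∀ r, 0 < r → weight m r * profile m r * (1 + r) ^ 2 ≤ C := by
  obtain ⟨C, hC, h⟩ := exists_profile_mul_sq_le m
  refine ⟨2 * C + 2 * profile m 1 * 4, add_nonneg (by positivity)
    (by have := profile_pos m one_pos; positivity), fun r hr => ?_⟩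
  have hw := weight_nonneg m hr
  have hq := profile_nonneg m hr.le
  have h1 := profile_pos m one_pos
  rcases le_or_gt r 1 with h' | h'
  · have e := weight_mul_profile_le m hr h' le_rfl
    rw [mul_one] at e
    have e2 : (1 + r) ^ 2 ≤ 4 := by nlinarith
    have := mul_le_mul e e2 (by positivity) (by positivity)
    linarith
  · have e : weight m r ≤ 1 := by
      have := weight_mul_le_one m hr
      nlinarith
    have := mul_le_mul e (h r hr.le) (by positivity) zero_le_one
    rw [← mul_assoc] at this
    linarith

lemma memLp_profile (m : ℕ) : MemLp (fun r => (profile m r : ℂ)) 2 radMeasure := by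
  refine memLp_radMeasure_iff.2 ⟨(by fun_prop : Continuous _).aestronglyMeasurable, ?_⟩
  simpa using integrableOn_profile_sq m

lemma memLp_weight_mul_profile (m : ℕ) :
    MemLp (fun r => ((weight m r * profile m r : ℝ) : ℂ)) 2 radMeasure := by
  obtain ⟨C, hC, h⟩ := exists_weight_mul_profile_le m
  refine memLp_of_sq_mul_le (C := C ^ 2) ?_ fun r hr => ?_
  · exact Complex.continuous_ofReal.comp_aestronglyMeasurable
      ((measurable_weight m).aestronglyMeasurable.mul (continuous_profile m).aestronglyMeasurable)
  · have hw := weight_nonneg m hr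
    have hq := profile_nonneg m hr.le
    rw [Complex.norm_real, Real.norm_eq_abs, sq_abs]
    calc (weight m r * profile m r) ^ 2 * r * (1 + r ^ 2)
        ≤ (weight m r * profile m r) ^ 2 * (1 + r) ^ 4 := by
          rw [mul_assoc]
          refine mul_le_mul_of_nonneg_left ?_ (by positivity)
          nlinarith [pow_pos hr 2, pow_pos hr 3, pow_pos hr 4]
      _ = (weight m r * profile m r * (1 + r) ^ 2) ^ 2 := by ring
      _ ≤ C ^ 2 := by
          refine pow_le_pow_left₀ (by positivity) (h r hr) 2

/-- The measure r dr supplies the factor √r in an L² estimate; it absorbs the logarithm at the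
origin, via log r = 2 log √r. -/
lemma abs_log_mul_sqrt_le {r : ℝ} (hr : 0 < r) : |Real.log r| * Real.sqrt r ≤ 2 * (1 + r) := by
  have hx : 0 < Real.sqrt r := Real.sqrt_pos.2 hr
  have hsq : Real.sqrt r ^ 2 = r := Real.sq_sqrt hr.le
  have hl : Real.log r = 2 * Real.log (Real.sqrt r) := by rw [Real.log_sqrt hr.le]; ring
  rw [hl, abs_mul, abs_two, mul_assoc]
  refine mul_le_mul_of_nonneg_left ?_ zero_le_two
  rcases le_or_gt (Real.sqrt r) 1 with h | h
  · have := Real.abs_log_mul_self_lt _ hx h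
    rw [abs_mul, abs_of_pos hx] at this
    linarith
  · rw [abs_of_nonneg (Real.log_nonneg h.le)]
    nlinarith [Real.log_le_sub_one_of_pos hx]

lemma memLp_profile_mul_psiLog (m : ℕ) :
    MemLp (fun r => ((profile m r * psiLog m r : ℝ) : ℂ)) 2 radMeasure := by
  obtain ⟨C, hC, h⟩ := exists_profile_mul_sq_le m
  refine memLp_of_sq_mul_le (C := C ^ 2 * (2 * m + 3) ^ 2) ?_ fun r hr => ?_
  · unfold psiLog
    exact (Measurable.aestronglyMeasurable (by fun_prop))
  · have hq := profile_nonneg m hr.le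
    rw [Complex.norm_real, Real.norm_eq_abs, sq_abs]
    have hlog : |psiLog m r| * Real.sqrt r ≤ (2 * m + 3) * (1 + r) := by
      have h1 : |psiLog m r| ≤ 1 + (m + 1) * |Real.log r| := by
        unfold psiLog
        refine (abs_add_le _ _).trans ?_
        rw [abs_one, abs_mul, abs_mul, abs_of_nonneg (show (0 : ℝ) ≤ m + 1 by positivity)]
        have := mul_le_mul_of_nonneg_left (abs_psi_le m r)
          (show 0 ≤ ((m : ℝ) + 1) * |Real.log r| by positivity)
        linarith
      have h2 : Real.sqrt r ≤ 1 + r := by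
        nlinarith [Real.sq_sqrt hr.le, sq_nonneg (Real.sqrt r - 1)]
      calc |psiLog m r| * Real.sqrt r ≤ (1 + (m + 1) * |Real.log r|) * Real.sqrt r := by gcongr
        _ = Real.sqrt r + (m + 1) * (|Real.log r| * Real.sqrt r) := by ring
        _ ≤ (1 + r) + (m + 1) * (2 * (1 + r)) := by
            exact add_le_add h2 (mul_le_mul_of_nonneg_left (abs_log_mul_sqrt_le hr) (by positivity))
        _ = _ := by ring
    calc (profile m r * psiLog m r) ^ 2 * r * (1 + r ^ 2)
        = profile m r ^ 2 * (|psiLog m r| * Real.sqrt r) ^ 2 * (1 + r ^ 2) := by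
          rw [mul_pow, mul_pow, Real.sq_sqrt hr.le, sq_abs]; ring
      _ ≤ profile m r ^ 2 * ((2 * m + 3) * (1 + r)) ^ 2 * (1 + r) ^ 2 := by
          gcongr
          nlinarith
      _ = (profile m r * (1 + r) ^ 2) ^ 2 * (2 * m + 3) ^ 2 := by ring
      _ ≤ C ^ 2 * (2 * m + 3) ^ 2 := by
          gcongr
          exact h r hr.le

/-- For m = 0 the coefficient is -2r/(1 + r²), regular at the origin; hence the weaker weight (1 +
r)⁻¹ suffices there. -/
lemma abs_coef_div_le (m : ℕ) {r : ℝ} (hr : 0 < r) :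
    |((m + 1) * psi m r - 1) / r| ≤ (m + 3) * weight m r := by
  rcases m with _ | m
  · have e : (((0 : ℕ) : ℝ) + 1) * psi 0 r - 1 = -(2 * r ^ 2) / (1 + r ^ 2) := by
      unfold psi; norm_num; field_simp; ring
    rw [e, abs_div, abs_div, abs_neg, abs_of_pos hr, abs_of_pos (show 0 < 1 + r ^ 2 by positivity),
      abs_of_pos (show 0 < 2 * r ^ 2 by positivity)]
    simp only [weight, if_true, CharP.cast_eq_zero, zero_add]
    rw [div_div, ← div_eq_mul_inv, div_le_div_iff₀ (by positivity) (by positivity)]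
    nlinarith [mul_nonneg hr.le (sq_nonneg (r - 1)), pow_pos hr 3]
  · simp only [weight, Nat.succ_ne_zero, if_false]
    rw [abs_div, abs_of_pos hr, div_eq_mul_inv]
    have := abs_coef_le (m + 1) r
    gcongr
    linarith

/-- Write Qf = (Q/w)(wf); the quotient Q/w ≤ Q(1 + r) is bounded, and Cauchy-Schwarz on (0, r) gives
the factor r. -/
lemma massInt_bound (m : ℕ) : ∃ C, 0 ≤ C ∧ ∀ f : ℝ → ℝ,
    MemLp (fun r => ((weight m r * f r : ℝ) : ℂ)) 2 radMeasure → ∀ r, 0 < r →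
      IntegrableOn (fun s => profile m s * f s * s) (Ioc 0 r) ∧
      |massInt m f r| ≤ C * l2norm (fun r => ((weight m r * f r : ℝ) : ℂ)) * r := by
  obtain ⟨C, hC, h⟩ := exists_profile_mul_sq_le m
  refine ⟨C, hC, fun f hf r hr => ?_⟩
  have hw : ∀ s, 0 < s → 0 < weight m s := fun s hs => by
    have := one_le_weight_mul m hs
    by_contra hcon
    nlinarith
  obtain ⟨h1, h2⟩ := radial_cauchy_schwarz (b := fun s => profile m s / weight m s) hC hf
    ((continuous_profile m).measurable.div (measurable_weight m)).aestronglyMeasurable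
    (fun s hs => by
      have hq := profile_nonneg m hs.le
      have hws := hw s hs
      rw [abs_of_nonneg (by positivity), div_le_iff₀ hws]
      have e1 := one_le_weight_mul m hs
      have e2 := h s hs.le
      calc profile m s ≤ profile m s * (weight m s * (1 + s)) := le_mul_of_one_le_right hq e1
        _ ≤ profile m s * (weight m s * (1 + s) ^ 2) := by
            gcongr
            nlinarith
        _ = profile m s * (1 + s) ^ 2 * weight m s := by ring
        _ ≤ C * weight m s := by gcongr) hr
  have e : ∀ s ∈ Ioc 0 r, profile m s / weight m s * (weight m s * f s) * s
      = profile m s * f s * s := fun s hs => by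
    have := (hw s hs.1).ne'
    field_simp
  refine ⟨h1.congr_fun e measurableSet_Ioc, ?_⟩
  rw [intervalIntegral.integral_of_le hr.le, setIntegral_congr_fun measurableSet_Ioc e] at h2
  rwa [massInt, intervalIntegral.integral_of_le hr.le]

/-- The zeroth-order part of `L_Q`. -/
def lowerOrder (m : ℕ) (f : ℝ → ℂ) (r : ℝ) : ℂ :=
  -((((m + 1) * psi m r - 1) / r : ℝ) * f r)
    + (profile m r * (massInt m (fun s => (f s).re) r / r) : ℝ)

lemma weakL_eq (m : ℕ) (f : ℝ → ℂ) {r : ℝ} (hr : 0 ≤ r) :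
    weakL m f r = weakDeriv f r + lowerOrder m f r := by
  rw [weakL, Lgen_Q m f _ hr, lowerOrder]; ring

lemma L_eq_add_lowerOrder (m : ℕ) (f : ℝ → ℂ) {r : ℝ} (hr : 0 ≤ r) :
    L m (Q m) f r = deriv f r + lowerOrder m f r := by
  rw [L_Q m f hr, lowerOrder]; ring

lemma memLp_weight_re {m : ℕ} {f : ℝ → ℂ} (hf : MemLp (fun r => weight m r • f r) 2 radMeasure) :
    MemLp (fun r => ((weight m r * (f r).re : ℝ) : ℂ)) 2 radMeasure ∧
      l2norm (fun r => ((weight m r * (f r).re : ℝ) : ℂ)) ≤ l2norm (fun r => weight m r • f r) := by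
  have := memLp_and_l2norm_le (f := fun r => ((weight m r * (f r).re : ℝ) : ℂ)) zero_le_one hf
    (by
      have h := (memLp_radMeasure_iff.1 hf).1.re
      refine Complex.continuous_ofReal.comp_aestronglyMeasurable ?_
      simpa using h)
    (.of_forall fun r => by
      rw [one_mul, Complex.norm_real, norm_smul, norm_mul]
      exact mul_le_mul_of_nonneg_left (Complex.abs_re_le_norm _) (norm_nonneg _))
  rwa [one_mul] at this

lemma isPrimitive_massInt {m : ℕ} {f : ℝ → ℝ}
    (h : ∀ r, 0 < r → IntegrableOn (fun s => profile m s * f s * s) (Ioc 0 r)) :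
    IsPrimitive (massInt m f) (fun s => profile m s * f s * s) where
  loc := by
    refine (locallyIntegrableOn_iff isOpen_Ioi.isLocallyClosed).2 fun K hK hKc => ?_
    obtain ⟨R, hR⟩ := hKc.bddAbove
    refine (h (max R 1) (by positivity)).mono_set fun x hx => ⟨hK hx, ?_⟩
    exact (hR hx).trans (le_max_left _ _)
  eqn a b ha hb := by
    have hi : ∀ c, 0 < c → IntervalIntegrable (fun s => profile m s * f s * s) volume 0 c :=
      fun c hc => (intervalIntegrable_iff_integrableOn_Ioc_of_le hc.le).2 (h c hc)
    exact intervalIntegral.integral_interval_sub_left (hi b hb) (hi a ha)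

/-- The zeroth-order part of `L_Q` is controlled by the weighted norm. -/
lemma lowerOrder_bound (m : ℕ) : ∃ C, 0 ≤ C ∧ ∀ f : ℝ → ℂ,
    MemLp (fun r => weight m r • f r) 2 radMeasure →
    AEStronglyMeasurable f (volume.restrict (Ioi 0)) →
      MemLp (lowerOrder m f) 2 radMeasure ∧
      l2norm (lowerOrder m f) ≤ C * l2norm (fun r => weight m r • f r) := by
  obtain ⟨C, hC, h⟩ := massInt_bound m
  refine ⟨m + 3 + C * l2norm (fun r => (profile m r : ℂ)),
    add_nonneg (by positivity) (mul_nonneg hC (l2norm_nonneg _)), fun f hf hfm => ?_⟩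
  obtain ⟨hre, hren⟩ := memLp_weight_re hf
  have hT := h _ hre
  set N := l2norm (fun r => weight m r • f r) with hN
  have hN0 : 0 ≤ N := l2norm_nonneg _
  obtain ⟨a1, a2⟩ := memLp_and_l2norm_le (C := m + 3)
    (f := fun r => -((((m + 1) * psi m r - 1) / r : ℝ) * f r)) (by positivity) hf
    (AEStronglyMeasurable.neg (AEStronglyMeasurable.mul (Measurable.aestronglyMeasurable (by fun_prop)) hfm))
    (by
      filter_upwards [ae_restrict_mem measurableSet_Ioi] with r hr
      have hr0 : 0 < r := hr
      rw [norm_neg, norm_mul, Complex.norm_real, norm_smul, Real.norm_eq_abs, Real.norm_eq_abs,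
        abs_of_nonneg (weight_nonneg m hr0), ← mul_assoc]
      exact mul_le_mul_of_nonneg_right (abs_coef_div_le m hr0) (norm_nonneg _))
  obtain ⟨b1, b2⟩ := memLp_and_l2norm_le (C := C * N)
    (f := fun r => ((profile m r * (massInt m (fun s => (f s).re) r / r) : ℝ) : ℂ))
    (by positivity) (memLp_profile m)
    (by
      refine Complex.continuous_ofReal.comp_aestronglyMeasurable ?_
      refine (continuous_profile m).aestronglyMeasurable.mul ?_
      refine ContinuousOn.aestronglyMeasurable ?_ measurableSet_Ioi
      exact (isPrimitive_massInt fun r hr => (hT r hr).1).continuousOn.div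
        continuousOn_id fun x hx => (ne_of_gt hx))
    (by
      filter_upwards [ae_restrict_mem measurableSet_Ioi] with r hr
      have hr0 : 0 < r := hr
      rw [Complex.norm_real, Complex.norm_real, norm_mul, mul_comm]
      refine mul_le_mul_of_nonneg_right ?_ (norm_nonneg _)
      rw [norm_div, Real.norm_eq_abs, Real.norm_eq_abs, abs_of_pos hr0, div_le_iff₀ hr0]
      refine (hT r hr0).2.trans ?_
      gcongr)
  refine ⟨a1.add b1, (l2norm_add_le a1 b1).trans ?_⟩
  have := add_le_add a2 b2
  linarith

lemma energySpace_spec {m : ℕ} {f : ℝ → ℂ} (hf : f ∈ energySpace m) :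
    IsWeakDeriv f (weakDeriv f) ∧ MemLp (weakDeriv f) 2 radMeasure ∧
      MemLp (fun r => weight m r • f r) 2 radMeasure := by
  obtain ⟨f', h1, h2, h3⟩ := hf
  exact ⟨isWeakDeriv_weakDeriv h1, (memLp_congr_ae (radMeasure_ac.ae_le (weakDeriv_ae_eq h1))).2 h2,
    h3⟩

lemma IsWeakDeriv.aestronglyMeasurable {f f' : ℝ → ℂ} (h : IsWeakDeriv f f') :
    AEStronglyMeasurable f (volume.restrict (Ioi 0)) := h.loc.aestronglyMeasurable

lemma one_le_energy_const (m : ℕ) : (1 : ℝ) ≤ if m = 0 then 1 else (m : ℝ) ^ 2 := by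
  split_ifs with h
  · exact le_rfl
  · have : (1 : ℝ) ≤ m := by exact_mod_cast Nat.one_le_iff_ne_zero.2 h
    nlinarith

lemma l2norm_weakDeriv_le (m : ℕ) (f : ℝ → ℂ) :
    l2norm (weakDeriv f) ≤ Real.sqrt (energySq m f) := by
  refine Real.le_sqrt_of_sq_le ?_
  unfold energySq
  have := one_le_energy_const m
  have : 0 ≤ (if m = 0 then 1 else (m : ℝ) ^ 2) * l2norm (fun r => weight m r • f r) ^ 2 := by
    positivity
  linarith

lemma l2norm_weight_le (m : ℕ) (f : ℝ → ℂ) :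
    l2norm (fun r => weight m r • f r) ≤ Real.sqrt (energySq m f) := by
  refine Real.le_sqrt_of_sq_le ?_
  unfold energySq
  have := mul_le_mul_of_nonneg_right (one_le_energy_const m)
    (sq_nonneg (l2norm (fun r => weight m r • f r)))
  nlinarith [sq_nonneg (l2norm (weakDeriv f))]

lemma weakL_ae_eq (m : ℕ) (f : ℝ → ℂ) :
    weakL m f =ᵐ[volume.restrict (Ioi 0)] weakDeriv f + lowerOrder m f := by
  filter_upwards [ae_restrict_mem measurableSet_Ioi] with r hr
  exact weakL_eq m f (le_of_lt hr)

/-- `L_Q` is bounded from the energy space to `L²`. -/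
lemma weakL_bounded (m : ℕ) : ∃ C : ℝ, ∀ f : energySpace m,
    MemLp (weakL m f) 2 radMeasure ∧ l2norm (weakL m f) ≤ C * Real.sqrt (energySq m f) := by
  obtain ⟨C, hC, h⟩ := lowerOrder_bound m
  refine ⟨1 + C, fun ⟨f, hf⟩ => ?_⟩
  obtain ⟨h1, h2, h3⟩ := energySpace_spec hf
  obtain ⟨h4, h5⟩ := h f h3 h1.aestronglyMeasurable
  refine ⟨(memLp_congr_ae (radMeasure_ac.ae_le (weakL_ae_eq m f))).2 (h2.add h4), ?_⟩
  rw [l2norm_congr (weakL_ae_eq m f)]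
  have e1 := l2norm_weakDeriv_le m f
  have e2 := mul_le_mul_of_nonneg_left (l2norm_weight_le m f) hC
  have e3 := l2norm_add_le h2 h4
  simp only
  linarith

/-! ### Coercivity of `L_Q` modulo its kernel -/

/-- `en` vanishes like a positive power of r at the origin and of 1/r at infinity, which beats the
logarithm at both ends. -/
lemma abs_log_mul_en_le (m : ℕ) {r : ℝ} (hr : 0 < r) : |Real.log r * en m r| ≤ 4 * (m + 1) := by
  have he := en_nonneg m r
  have ht : 0 ≤ r ^ (2 * (m + 1)) := by positivity
  rw [abs_mul, abs_of_nonneg he]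
  rcases le_or_gt r 1 with h | h
  · have h1 : en m r ≤ 4 * (m + 1) * r := by
      have e : r ^ (2 * (m + 1)) ≤ r := by
        simpa using pow_le_pow_of_le_one hr.le h (show 1 ≤ 2 * (m + 1) by omega)
      unfold en
      rw [div_le_iff₀ (pow_pos (den_pos m r) 2)]
      calc 4 * ((m : ℝ) + 1) * r ^ (2 * (m + 1)) ≤ 4 * (m + 1) * r * 1 := by
            rw [mul_one]; gcongr
        _ ≤ 4 * (m + 1) * r * (1 + r ^ (2 * (m + 1))) ^ 2 := by
            gcongr
            exact one_le_pow₀ (by linarith)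
    have h2 := Real.abs_log_mul_self_lt r hr h
    rw [abs_mul, abs_of_pos hr] at h2
    calc |Real.log r| * en m r ≤ |Real.log r| * (4 * (m + 1) * r) := by gcongr
      _ = 4 * (m + 1) * (|Real.log r| * r) := by ring
      _ ≤ 4 * (m + 1) * 1 := by gcongr
      _ = _ := mul_one _
  · have h1 : |Real.log r| ≤ r ^ (2 * (m + 1)) := by
      rw [abs_of_nonneg (Real.log_nonneg h.le)]
      have : r ≤ r ^ (2 * (m + 1)) := by
        simpa using pow_le_pow_right₀ h.le (show 1 ≤ 2 * (m + 1) by omega)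
      linarith [Real.log_le_sub_one_of_pos hr]
    calc |Real.log r| * en m r ≤ r ^ (2 * (m + 1)) * en m r := by gcongr
      _ ≤ _ := by rw [mul_comm]; exact en_mul_le m hr.le

lemma abs_enLog_le (m : ℕ) {r : ℝ} (hr : 0 < r) :
    |enLog m r| ≤ (m + 1) * (1 + 4 * (m + 1)) := by
  unfold enLog
  rw [abs_mul, abs_of_nonneg (show (0 : ℝ) ≤ m + 1 by positivity)]
  gcongr
  refine (abs_add_le _ _).trans (add_le_add ?_ (abs_log_mul_en_le m hr))
  rw [abs_neg]
  exact abs_psi_le m r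

section variation

variable {m : ℕ} {F g h : ℝ → ℝ}

lemma contDiffOn_div_profile {p : ℝ → ℝ} (hp : ContDiffOn ℝ 1 p (Ioi 0)) :
    ContDiffOn ℝ 1 (fun r => p r / profile m r) (Ioi 0) :=
  hp.div (contDiff_infty.1 (contDiff_profile m) 1).contDiffOn fun _ hr => (profile_pos m hr).ne'

lemma contDiffOn_psiLog (m : ℕ) : ContDiffOn ℝ 1 (psiLog m) (Ioi 0) := by
  unfold psiLog
  have h1 : ContDiffOn ℝ 1 (psi m) (Ioi 0) := (contDiff_infty.1 (contDiff_psi m) 1).contDiffOn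
  have h2 : ContDiffOn ℝ 1 Real.log (Ioi 0) := fun x hx =>
    (Real.contDiffAt_log.2 (ne_of_gt hx)).contDiffWithinAt
  fun_prop

lemma contDiffOn_enLog (m : ℕ) : ContDiffOn ℝ 1 (enLog m) (Ioi 0) := by
  unfold enLog
  have h1 : ContDiffOn ℝ 1 (psi m) (Ioi 0) := (contDiff_infty.1 (contDiff_psi m) 1).contDiffOn
  have h3 : ContDiffOn ℝ 1 (en m) (Ioi 0) := (contDiff_infty.1 (contDiff_en m) 1).contDiffOn
  have h2 : ContDiffOn ℝ 1 Real.log (Ioi 0) := fun x hx =>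
    (Real.contDiffAt_log.2 (ne_of_gt hx)).contDiffWithinAt
  fun_prop

/-- Variation of constants for weak solutions. The pair `(p, e)` is `(ψ, en)` or
`(psiLog, enLog)`. -/
lemma IsPrimitive.variation {p e : ℝ → ℝ} (hF : IsPrimitive F g)
    (hT : IsPrimitive (massInt m F) fun s => profile m s * F s * s)
    (hh : ∀ᵐ r ∂volume.restrict (Ioi (0 : ℝ)), h r = g r - ((m + 1) * psi m r - 1) / r * F r
      + profile m r * (massInt m F r / r))
    (hp : ContDiffOn ℝ 1 p (Ioi 0)) (he : ContDiffOn ℝ 1 e (Ioi 0))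
    (dp : ∀ r, 0 < r → HasDerivAt p (-(e r) / r) r)
    (de : ∀ r, 0 < r → HasDerivAt e (2 * (m + 1) * en m r * p r / r) r) :
    IsPrimitive (fun r => e r / profile m r * F r - p r * massInt m F r)
      (fun r => h r * (e r / profile m r)) := by
  refine ((hF.mul (contDiffOn_div_profile (m := m) he)).sub (hT.mul hp)).congr_right ?_
  filter_upwards [hh, ae_restrict_mem measurableSet_Ioi] with r hr hr0
  have hr0 : 0 < r := hr0
  have hq := (profile_pos m hr0).ne'
  have d := ((de r hr0).div (hasDerivAt_profile m hr0) hq).deriv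
  have d' : deriv (fun r => e r / profile m r) r = _ := d
  rw [d', (dp r hr0).deriv, hr]
  have := sq_mul_profile_sq m r
  field_simp
  linear_combination (-(F r * p r)) * this

/-- If c ≠ 0, then en/Q ≲ r² forces |F| ≳ r^(-2) near 0, so (wF)² r ≳ 1/r is not integrable. For
energy-space functions this replaces continuity at the origin. -/
lemma eq_zero_of_abs_sub_le {c K : ℝ} (hw : MemLp (fun r => ((weight m r * F r : ℝ) : ℂ)) 2 radMeasure)
    (hK : 0 ≤ K)
    (h : ∀ r, 0 < r → |F r * (en m r / profile m r) - c| ≤ K * r) : c = 0 := by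
  by_contra hc
  obtain ⟨C, hC, hq⟩ := exists_profile_mul_sq_le m
  have hc0 : 0 < |c| := abs_pos.2 hc
  set δ := min 1 (|c| / (2 * (K + 1))) with hδ
  have hδ0 : 0 < δ := lt_min one_pos (by positivity)
  -- The first half absorbs the error Kr, C + 1 comes from en/Q ≤ C r², and the last half from
  -- weight ≥ 1/2 on (0, 1].
  set A := |c| / 2 / (C + 1) / 2 with hA
  have hA0 : 0 < A := by positivity
  have hlow : ∀ r ∈ Ioc 0 δ, A ^ 2 * r⁻¹ ≤ (weight m r * F r) ^ 2 * r := by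
    intro r hr
    have hr0 : 0 < r := hr.1
    have hr1 : r ≤ 1 := hr.2.trans (min_le_left _ _)
    have hr2 : r * (2 * (K + 1)) ≤ |c| := by
      rw [← le_div_iff₀ (by positivity)]; exact hr.2.trans (min_le_right _ _)
    have h1 := h r hr0
    have h2 : |c| / 2 ≤ |F r * (en m r / profile m r)| := by
      have := abs_sub_abs_le_abs_sub c (F r * (en m r / profile m r))
      rw [abs_sub_comm] at this
      nlinarith
    have hqr := profile_nonneg m hr0.le
    have h3 : en m r / profile m r ≤ C * r ^ 2 := by
      rw [en_div_profile m hr0, div_le_iff₀ (by positivity)]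
      have e1 : profile m r ≤ C := (le_mul_of_one_le_right hqr
        (one_le_pow₀ (by linarith))).trans (hq r hr0.le)
      have e2 : (1 : ℝ) ≤ 2 * (m + 1) := by have := Nat.cast_nonneg (α := ℝ) m; linarith
      calc r ^ 2 * profile m r ≤ r ^ 2 * C := by gcongr
        _ ≤ C * r ^ 2 * (2 * (m + 1)) := by
          rw [mul_comm]; exact le_mul_of_one_le_right (by positivity) e2
    have h4 : |c| / 2 ≤ |F r| * ((C + 1) * r ^ 2) := by
      rw [abs_mul, abs_of_nonneg (div_nonneg (en_nonneg m r) hqr)] at h2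
      refine h2.trans ?_
      gcongr
      nlinarith [sq_nonneg r]
    have h5 : 2 * A ≤ |F r| * r ^ 2 := by
      rw [hA]
      have : |c| / 2 / (C + 1) ≤ |F r| * r ^ 2 := by
        rw [div_le_iff₀ (by positivity)]; linarith
      linarith
    have h6 : 1 ≤ 2 * weight m r := by
      have := one_le_weight_mul m hr0
      have := weight_nonneg m hr0
      nlinarith
    have h7 : A ≤ weight m r * |F r| * r := by
      have e : |F r| * r ^ 2 ≤ |F r| * r := by
        refine mul_le_mul_of_nonneg_left ?_ (abs_nonneg _)
        nlinarith
      have e2 : |F r| * r ≤ (2 * weight m r) * (|F r| * r) := le_mul_of_one_le_left (by positivity) h6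
      linarith
    have h8 : A ^ 2 ≤ (weight m r * |F r| * r) ^ 2 := by gcongr
    rw [← div_eq_mul_inv, div_le_iff₀ hr0]
    rw [mul_pow, mul_pow, sq_abs] at h8
    linarith [show (weight m r * F r) ^ 2 * r * r = weight m r ^ 2 * F r ^ 2 * r ^ 2 by ring]
  have hi := (memLp_radMeasure_iff.1 hw).2
  simp only [Complex.norm_real, Real.norm_eq_abs, sq_abs] at hi
  have hi' : IntegrableOn (fun r => (weight m r * F r) ^ 2 * r) (Ioc 0 δ) :=
    hi.mono_set fun x hx => hx.1
  have hinv : IntegrableOn (fun r : ℝ => A ^ 2 * r⁻¹) (Ioc 0 δ) := by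
    refine Integrable.mono' hi' (Measurable.aestronglyMeasurable (by fun_prop)) ?_
    filter_upwards [ae_restrict_mem measurableSet_Ioc] with r hr
    have : 0 < r := hr.1
    rw [Real.norm_eq_abs, abs_of_nonneg (by positivity)]
    exact hlow r hr
  have h2 : IntervalIntegrable (fun r : ℝ => r⁻¹) volume 0 δ := by
    rw [intervalIntegrable_iff_integrableOn_Ioc_of_le hδ0.le]
    have := hinv.const_mul (A ^ 2)⁻¹
    refine IntegrableOn.congr_fun this (fun x _ => ?_) measurableSet_Ioc
    field_simp
  rcases intervalIntegrable_inv_iff.1 h2 with h' | h'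
  · exact hδ0.ne h'
  · exact h' left_mem_uIcc

end variation

/-- Control of the real part of `f`, modulo `ΛQ`, by the real part of `L_Q f`. -/
lemma exists_real_bound (m : ℕ) : ∃ C, 0 ≤ C ∧ ∀ F g h : ℝ → ℝ, IsPrimitive F g →
    MemLp (fun r => ((weight m r * F r : ℝ) : ℂ)) 2 radMeasure →
    MemLp (fun r => (h r : ℂ)) 2 radMeasure →
    (∀ᵐ r ∂volume.restrict (Ioi (0 : ℝ)), h r = g r - ((m + 1) * psi m r - 1) / r * F r
      + profile m r * (massInt m F r / r)) →
    ∃ β : ℝ, MemLp (fun r => ((weight m r * (F r - β * (psi m r * profile m r)) : ℝ) : ℂ)) 2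
        radMeasure ∧
      l2norm (fun r => ((weight m r * (F r - β * (psi m r * profile m r)) : ℝ) : ℂ))
        ≤ C * l2norm (fun r => (h r : ℂ)) := by
  obtain ⟨CT, hCT, hT⟩ := massInt_bound m
  have hn : (0 : ℝ) < m + 1 := by positivity
  set E₀ : ℝ := (m + 1) * (1 + 4 * (m + 1)) with hE₀
  have hE0 : 0 ≤ E₀ := by positivity
  refine ⟨l2norm (fun r => ((profile m r * psiLog m r : ℝ) : ℂ)) + 2 * E₀,
    add_nonneg (l2norm_nonneg _) (by positivity), fun F g h hF hw hh hfg => ?_⟩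
  have hTi := fun r hr => (hT F hw r hr)
  have hTp := isPrimitive_massInt fun r hr => (hTi r hr).1
  have hU := hF.variation hTp hfg (contDiff_infty.1 (contDiff_psi m) 1).contDiffOn
    (contDiff_infty.1 (contDiff_en m) 1).contDiffOn (fun r => hasDerivAt_psi m)
    (fun r => hasDerivAt_en m)
  have hV := hF.variation hTp hfg (contDiffOn_psiLog m) (contDiffOn_enLog m)
    (fun r => hasDerivAt_psiLog m) (fun r => hasDerivAt_enLog m)
  set N := l2norm (fun r => (h r : ℂ)) with hN
  have hN0 : 0 ≤ N := l2norm_nonneg _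
  -- the integral of `h en / Q` from the origin
  have hb : ∀ r, 0 < r → |r * profile m r / (2 * (m + 1))| ≤ m + 1 := by
    intro r hr
    have hq := profile_nonneg m hr.le
    rw [abs_of_nonneg (by positivity), div_le_iff₀ (by positivity)]
    have e1 := sq_mul_profile_sq m r
    have e2 := en_le m r
    have : (r * profile m r) ^ 2 ≤ ((m + 1) * (2 * (m + 1))) ^ 2 := by
      calc (r * profile m r) ^ 2 = 2 * (m + 1) * en m r := by rw [← e1]; ring
        _ ≤ 2 * (m + 1) * (m + 1) := by gcongr
        _ ≤ ((m + 1) * (2 * (m + 1))) ^ 2 := by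
          have h1 : (1 : ℝ) ≤ (m + 1) * (2 * (m + 1)) := by
            have := Nat.cast_nonneg (α := ℝ) m
            nlinarith
          calc 2 * ((m : ℝ) + 1) * (m + 1) = (m + 1) * (2 * (m + 1)) := by ring
            _ ≤ _ := le_self_pow₀ h1 two_ne_zero
    exact le_of_sq_le_sq this (by positivity)
  -- Here h·en/Q is h times a bounded factor times s, so its integral from the origin is O(‖h‖ r).
  have hJ := fun r (hr : 0 < r) => radial_cauchy_schwarz (u := h)
    (b := fun r => r * profile m r / (2 * (m + 1))) hn.le hh
    (Continuous.aestronglyMeasurable (by fun_prop)) hb hr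
  have hJe : ∀ s, 0 < s → s * profile m s / (2 * (m + 1)) * h s * s = h s * (en m s / profile m s) :=
    fun s hs => by rw [en_div_profile m hs]; ring
  set J : ℝ → ℝ := fun r => ∫ s in (0 : ℝ)..r, s * profile m s / (2 * (m + 1)) * h s * s with hJdef
  have hJi : ∀ r, 0 < r → IntervalIntegrable (fun s => s * profile m s / (2 * (m + 1)) * h s * s)
      volume 0 r := fun r hr => (intervalIntegrable_iff_integrableOn_Ioc_of_le hr.le).2 (hJ r hr).1
  have hUJ : ∃ c, ∀ r, 0 < r → en m r / profile m r * F r - psi m r * massInt m F r = c + J r := by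
    refine ⟨en m 1 / profile m 1 * F 1 - psi m 1 * massInt m F 1 - J 1, fun r hr => ?_⟩
    have e1 := hU.eqn 1 r one_pos hr
    have e2 : ∫ s in (1 : ℝ)..r, h s * (en m s / profile m s) = J r - J 1 := by
      rw [hJdef]
      simp only
      rw [intervalIntegral.integral_interval_sub_left (hJi r hr) (hJi 1 one_pos)]
      refine intervalIntegral.integral_congr fun s hs => ?_
      exact (hJe s (uIcc_subset_Ioi one_pos hr hs)).symm
    linarith
  obtain ⟨c, hc⟩ := hUJ
  have hc0 : c = 0 := by
    refine eq_zero_of_abs_sub_le hw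
      (K := (m + 1) * N + CT * l2norm (fun r => ((weight m r * F r : ℝ) : ℂ)))
      (add_nonneg (by positivity) (mul_nonneg hCT (l2norm_nonneg _))) fun r hr => ?_
    have e : F r * (en m r / profile m r) - c = J r + psi m r * massInt m F r := by
      linarith [hc r hr]
    rw [e]
    refine (abs_add_le _ _).trans ?_
    rw [add_mul]
    refine add_le_add (hJ r hr).2 ?_
    rw [abs_mul]
    exact (mul_le_of_le_one_left (abs_nonneg _) (abs_psi_le m r)).trans (hTi r hr).2
  set V₁ := enLog m 1 / profile m 1 * F 1 - psiLog m 1 * massInt m F 1 with hV₁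
  set I₂ : ℝ → ℝ := fun r => ∫ s in (1 : ℝ)..r, h s * (enLog m s / profile m s) with hI₂
  -- Solving the two variation identities by the Wronskian, the constant V₁ multiplies ψQ: it is the
  -- kernel component to be removed.
  have rep : ∀ r, 0 < r → F r - -V₁ / (m + 1) * (psi m r * profile m r)
      = profile m r / (m + 1) * (J r * psiLog m r - psi m r * I₂ r) := by
    intro r hr
    have hq := (profile_pos m hr).ne'
    have e1 := hc r hr
    rw [hc0, zero_add] at e1
    have e2 := hV.eqn 1 r one_pos hr
    have e3 := wronskian m r
    have e4 : enLog m r / profile m r * F r - psiLog m r * massInt m F r = V₁ + I₂ r := by linarith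
    have e5 : (m + 1) * (F r / profile m r) = psiLog m r * J r - psi m r * (V₁ + I₂ r) := by
      rw [← e1, ← e4, ← e3]; ring
    have e6 : F r = profile m r / (m + 1) * ((m + 1) * (F r / profile m r)) := by field_simp
    rw [e6, e5]
    field_simp
    ring
  have hEh := memLp_and_l2norm_le (f := fun r => ((E₀ * h r : ℝ) : ℂ)) hE0 hh
    (Complex.continuous_ofReal.comp_aestronglyMeasurable
      ((memLp_radMeasure_iff.1 hh).1.re.const_mul E₀))
    (.of_forall fun r => by
      rw [Complex.norm_real, Complex.norm_real, norm_mul, Real.norm_eq_abs, abs_of_nonneg hE0])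
  -- Since |enLog| ≤ E₀, the integral `I₂` falls under the Hardy inequality with datum E₀ h.
  obtain ⟨k1, k2⟩ := hardy (m := m) hEh.1 (fun s hs => by
    have hq := profile_pos m hs
    rw [abs_mul, abs_div, abs_of_pos hq, abs_mul, abs_of_nonneg hE0, mul_div_assoc', mul_comm |h s|]
    gcongr
    exact abs_enLog_le m hs) hV.loc
  -- Here weight·|J| ≤ (m+1)‖h‖ is bounded, and square-integrability is provided by Q psiLog.
  have l1 := memLp_and_l2norm_le (C := N)
    (f := fun r => ((weight m r * (profile m r / (m + 1) * (J r * psiLog m r)) : ℝ) : ℂ))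
    hN0 (memLp_profile_mul_psiLog m)
    (by
      refine Complex.continuous_ofReal.comp_aestronglyMeasurable ?_
      refine (measurable_weight m).aestronglyMeasurable.mul
        (AEStronglyMeasurable.mul ((continuous_profile m).div_const _).aestronglyMeasurable ?_)
      have hJc : ContinuousOn J (Ioi 0) := by
        refine hU.continuousOn.congr fun r hr => ?_
        have := hc r hr
        rw [hc0, zero_add] at this
        exact this.symm
      exact (hJc.mul (contDiffOn_psiLog m).continuousOn).aestronglyMeasurable measurableSet_Ioi)
    (by
      filter_upwards [ae_restrict_mem measurableSet_Ioi] with r hr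
      have hr0 : 0 < r := hr
      have hw0 := weight_nonneg m hr0
      have hq := profile_nonneg m hr0.le
      rw [Complex.norm_real, Complex.norm_real, Real.norm_eq_abs, Real.norm_eq_abs]
      have e : weight m r * (profile m r / (m + 1) * (J r * psiLog m r))
          = (weight m r * J r / (m + 1)) * (profile m r * psiLog m r) := by ring
      rw [e, abs_mul]
      refine mul_le_mul_of_nonneg_right ?_ (abs_nonneg _)
      rw [abs_div, abs_mul, abs_of_nonneg hw0, abs_of_pos hn, div_le_iff₀ hn]
      calc weight m r * |J r| ≤ weight m r * ((m + 1) * N * r) := by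
            gcongr; exact (hJ r hr0).2
        _ = (weight m r * r) * (N * (m + 1)) := by ring
        _ ≤ 1 * (N * (m + 1)) := by gcongr; exact weight_mul_le_one m hr0
        _ = _ := one_mul _)
  have l2 := memLp_and_l2norm_le (C := 1)
    (f := fun r => ((-(psi m r / (m + 1)) * (weight m r * profile m r * I₂ r) : ℝ) : ℂ))
    zero_le_one k1
    (by
      have := (memLp_radMeasure_iff.1 k1).1.re
      refine Complex.continuous_ofReal.comp_aestronglyMeasurable ?_
      exact (Continuous.aestronglyMeasurable (by fun_prop)).mul this)
    (.of_forall fun r => by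
      rw [Complex.norm_real, Complex.norm_real, norm_mul]
      refine mul_le_mul_of_nonneg_right ?_ (norm_nonneg _)
      rw [norm_neg, norm_div, Real.norm_eq_abs, Real.norm_eq_abs, abs_of_pos hn, div_le_one hn]
      have := Nat.cast_nonneg (α := ℝ) m
      linarith [abs_psi_le m r])
  have hsum : (fun r => ((weight m r * (F r - -V₁ / (m + 1) * (psi m r * profile m r)) : ℝ) : ℂ))
      =ᵐ[volume.restrict (Ioi 0)]
      (fun r => ((weight m r * (profile m r / (m + 1) * (J r * psiLog m r)) : ℝ) : ℂ))
        + fun r => ((-(psi m r / (m + 1)) * (weight m r * profile m r * I₂ r) : ℝ) : ℂ) := by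
    filter_upwards [ae_restrict_mem measurableSet_Ioi] with r hr
    rw [Pi.add_apply, ← Complex.ofReal_add, rep r hr]
    congr 1
    ring
  refine ⟨-V₁ / (m + 1), (memLp_congr_ae (radMeasure_ac.ae_le hsum)).2 (l1.1.add l2.1), ?_⟩
  rw [l2norm_congr hsum]
  refine (l2norm_add_le l1.1 l2.1).trans ?_
  have e1 := l1.2
  have e2 := l2.2
  have e3 := hEh.2
  rw [one_mul] at e2
  have e4 := e2.trans k2
  linarith

/-- Control of the imaginary part of `f`, modulo `iQ`, by the imaginary part of `L_Q f`. -/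
lemma exists_imag_bound {m : ℕ} {F g h : ℝ → ℝ} (hF : IsPrimitive F g)
    (hh : MemLp (fun r => (h r : ℂ)) 2 radMeasure)
    (hfg : ∀ᵐ r ∂volume.restrict (Ioi (0 : ℝ)), h r = g r - ((m + 1) * psi m r - 1) / r * F r) :
    ∃ α : ℝ, MemLp (fun r => ((weight m r * (F r - α * profile m r) : ℝ) : ℂ)) 2 radMeasure ∧
      l2norm (fun r => ((weight m r * (F r - α * profile m r) : ℝ) : ℂ))
        ≤ 2 * l2norm (fun r => (h r : ℂ)) := by
  -- (F/Q)' = h/Q, so the component to subtract is the value of F/Q at 1.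
  have hW : IsPrimitive (fun r => 1 / profile m r * F r) (fun r => h r / profile m r) := by
    refine (hF.mul (contDiffOn_div_profile (m := m) contDiffOn_const)).congr_right ?_
    filter_upwards [hfg, ae_restrict_mem measurableSet_Ioi] with r hr hr0
    have hr0 : 0 < r := hr0
    have hq := (profile_pos m hr0).ne'
    have d : deriv (fun r => 1 / profile m r) r = _ :=
      ((hasDerivAt_const r (1 : ℝ)).div (hasDerivAt_profile m hr0) hq).deriv
    rw [d, hr]
    field_simp
    ring
  obtain ⟨k1, k2⟩ := hardy (m := m) hh (fun s hs => by
    rw [abs_div, abs_of_pos (profile_pos m hs)]) hW.loc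
  have e : (fun r => ((weight m r * (F r - 1 / profile m 1 * F 1 * profile m r) : ℝ) : ℂ))
      =ᵐ[volume.restrict (Ioi 0)]
      fun r => ((weight m r * profile m r * ∫ s in (1 : ℝ)..r, h s / profile m s : ℝ) : ℂ) := by
    filter_upwards [ae_restrict_mem measurableSet_Ioi] with r hr
    have hr0 : 0 < r := hr
    have hq := (profile_pos m hr0).ne'
    rw [← hW.eqn 1 r one_pos hr0]
    congr 1
    field_simp
  refine ⟨1 / profile m 1 * F 1, (memLp_congr_ae (radMeasure_ac.ae_le e)).2 k1, ?_⟩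
  rwa [l2norm_congr e]

section energy

variable {m : ℕ} {f g : ℝ → ℂ}

lemma weakDeriv_add_smul (hf : f ∈ energySpace m) (hg : g ∈ energySpace m) (c : ℝ) :
    weakDeriv (f + c • g) =ᵐ[volume.restrict (Ioi 0)] weakDeriv f + c • weakDeriv g :=
  weakDeriv_ae_eq ((energySpace_spec hf).1.add ((energySpace_spec hg).1.smul c))

lemma lowerOrder_add_smul (hf : f ∈ energySpace m) (hg : g ∈ energySpace m) (c : ℝ) {r : ℝ}
    (hr : 0 < r) : lowerOrder m (f + c • g) r = lowerOrder m f r + c • lowerOrder m g r := by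
  obtain ⟨C, -, h⟩ := massInt_bound m
  have hi : ∀ {u : ℝ → ℂ}, u ∈ energySpace m →
      IntervalIntegrable (fun s => profile m s * (u s).re * s) volume 0 r := fun hu =>
    (intervalIntegrable_iff_integrableOn_Ioc_of_le hr.le).2
      (h _ (memLp_weight_re (energySpace_spec hu).2.2).1 r hr).1
  have e : massInt m (fun s => ((f + c • g) s).re) r
      = massInt m (fun s => (f s).re) r + c * massInt m (fun s => (g s).re) r := by
    unfold massInt
    rw [← intervalIntegral.integral_const_mul, ← intervalIntegral.integral_add (hi hf)
      ((hi hg).const_mul c)]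
    congr 1
    funext s
    simp only [Pi.add_apply, Pi.smul_apply, Complex.add_re, Complex.real_smul, Complex.re_ofReal_mul]
    ring
  unfold lowerOrder
  rw [e]
  simp only [Pi.add_apply, Pi.smul_apply, Complex.real_smul]
  push_cast
  ring

lemma weakL_add_smul (hf : f ∈ energySpace m) (hg : g ∈ energySpace m) (c : ℝ) :
    weakL m (f + c • g) =ᵐ[volume.restrict (Ioi 0)] weakL m f + c • weakL m g := by
  filter_upwards [weakDeriv_add_smul hf hg c, ae_restrict_mem measurableSet_Ioi] with r h1 hr
  have hr0 : 0 < r := hr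
  simp only [Pi.add_apply, Pi.smul_apply] at h1 ⊢
  rw [weakL_eq m _ hr0.le, weakL_eq m f hr0.le, weakL_eq m g hr0.le, h1,
    lowerOrder_add_smul hf hg c hr0, smul_add]
  ring

lemma l2norm_weakDeriv_add_smul_le (hf : f ∈ energySpace m) (hg : g ∈ energySpace m) (c : ℝ) :
    l2norm (weakDeriv (f + c • g)) ≤ l2norm (weakDeriv f) + |c| * l2norm (weakDeriv g) := by
  rw [l2norm_congr (weakDeriv_add_smul hf hg c), ← l2norm_smul]
  exact l2norm_add_le (energySpace_spec hf).2.1 ((energySpace_spec hg).2.1.const_smul c)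

lemma l2norm_weight_add_smul_le (hf : f ∈ energySpace m) (hg : g ∈ energySpace m) (c : ℝ) :
    l2norm (fun r => weight m r • (f + c • g) r)
      ≤ l2norm (fun r => weight m r • f r) + |c| * l2norm (fun r => weight m r • g r) := by
  have e : (fun r => weight m r • (f + c • g) r)
      = (fun r => weight m r • f r) + c • fun r => weight m r • g r := by
    funext r
    simp only [Pi.add_apply, Pi.smul_apply, smul_add, smul_comm (weight m r) c]
  rw [e, ← l2norm_smul]
  exact l2norm_add_le (energySpace_spec hf).2.2 ((energySpace_spec hg).2.2.const_smul c)

/-- Smooth elements of the kernel of `L_Q` lie in the energy space as soon as their weighted norm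
is finite. -/
lemma mem_energySpace_of_L_eq_zero (hf : ContDiff ℝ 1 f) (h0 : ∀ r, 0 < r → L m (Q m) f r = 0)
    (hw : MemLp (fun r => weight m r • f r) 2 radMeasure) :
    f ∈ energySpace m ∧ weakL m f =ᵐ[volume.restrict (Ioi 0)] 0 := by
  obtain ⟨C, -, h⟩ := lowerOrder_bound m
  obtain ⟨h1, -⟩ := h f hw hf.continuous.aestronglyMeasurable
  have hd := isWeakDeriv_of_contDiff hf
  have e : deriv f =ᵐ[volume.restrict (Ioi 0)] -lowerOrder m f := by
    filter_upwards [ae_restrict_mem measurableSet_Ioi] with r hr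
    have := h0 r hr
    rw [L_eq_add_lowerOrder m f (le_of_lt hr)] at this
    exact eq_neg_of_add_eq_zero_left this
  refine ⟨⟨deriv f, hd, (memLp_congr_ae (radMeasure_ac.ae_le e)).2 h1.neg, hw⟩, ?_⟩
  filter_upwards [weakDeriv_ae_eq hd, ae_restrict_mem measurableSet_Ioi] with r h2 hr
  rw [weakL_eq m f (le_of_lt hr), h2, ← L_eq_add_lowerOrder m f (le_of_lt hr), h0 r hr,
    Pi.zero_apply]

end energy

lemma iQ_energy (m : ℕ) :
    iQ m ∈ energySpace m ∧ weakL m (iQ m) =ᵐ[volume.restrict (Ioi 0)] 0 := by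
  have hc : ContDiff ℝ 1 (iQ m) := contDiff_const.mul (contDiff_infty.1 (contDiff_Q m) 1)
  refine mem_energySpace_of_L_eq_zero hc (fun r hr => ?_) ?_
  · rw [← L_kernel m 1 0 hr]
    exact L_congr m (fun s _ => by simp [iQ, Q_eq]) hr
  · refine (memLp_and_l2norm_le zero_le_one (memLp_weight_mul_profile m)
      ((measurable_weight m).aestronglyMeasurable.smul hc.continuous.aestronglyMeasurable)
      (.of_forall fun r => ?_)).1
    rw [one_mul, Pi.smul_apply', norm_smul, Complex.norm_real, norm_mul, iQ, norm_mul, Complex.norm_I, one_mul, Q_eq,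
      Complex.norm_real]

lemma LamQ_energy (m : ℕ) :
    LamQ m ∈ energySpace m ∧ weakL m (LamQ m) =ᵐ[volume.restrict (Ioi 0)] 0 := by
  have hc : ContDiff ℝ 1 (LamQ m) := by
    have h1 : ContDiff ℝ 1 (Q m) := contDiff_infty.1 (contDiff_Q m) 1
    have h2 : ContDiff ℝ 1 (deriv (Q m)) :=
      contDiff_infty.1 (contDiff_infty_iff_deriv.1 (contDiff_Q m)).2 1
    have h3 : ContDiff ℝ 1 fun r : ℝ => (r : ℂ) := Complex.ofRealCLM.contDiff
    exact h1.add (h3.mul h2)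
  refine mem_energySpace_of_L_eq_zero hc (fun r hr => ?_) ?_
  · rw [← L_kernel m 0 (m + 1) hr]
    exact L_congr m (fun s hs => by rw [LamQ_eq m hs.le]; push_cast; ring) hr
  · refine (memLp_and_l2norm_le (C := m + 1) (by positivity) (memLp_weight_mul_profile m)
      ((measurable_weight m).aestronglyMeasurable.smul hc.continuous.aestronglyMeasurable) ?_).1
    filter_upwards [ae_restrict_mem measurableSet_Ioi] with r hr
    rw [Pi.smul_apply', LamQ_eq m (le_of_lt hr), norm_smul, Complex.norm_real, Complex.norm_real, norm_mul, norm_mul,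
      norm_mul, Real.norm_eq_abs ((m : ℝ) + 1), abs_of_nonneg (by positivity : (0 : ℝ) ≤ m + 1)]
    have h1 : ‖psi m r‖ ≤ 1 := abs_psi_le m r
    calc ‖weight m r‖ * ((m + 1) * ‖psi m r‖ * ‖profile m r‖)
        ≤ ‖weight m r‖ * ((m + 1) * 1 * ‖profile m r‖) := by gcongr
      _ = _ := by ring

/-- Modulo the kernel of `L_Q`, the weighted norm is controlled by `L_Q f`. -/
lemma exists_weight_bound (m : ℕ) : ∃ C, 0 ≤ C ∧ ∀ f ∈ energySpace m, ∃ a b : ℝ,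
    l2norm (fun r => weight m r • (f + a • iQ m + b • LamQ m) r) ≤ C * l2norm (weakL m f) := by
  obtain ⟨C, hC, h⟩ := exists_real_bound m
  obtain ⟨_, hL⟩ := weakL_bounded m
  refine ⟨C + 2, by positivity, fun f hf => ?_⟩
  obtain ⟨h1, h2, h3⟩ := energySpace_spec hf
  -- The real and imaginary parts are replaced by absolutely continuous representatives; `massInt`
  -- does not see null sets.
  obtain ⟨F₁, p1, q1⟩ := h1.re.exists_primitive
  obtain ⟨F₂, p2, q2⟩ := h1.im.exists_primitive
  have hLf := (hL ⟨f, hf⟩).1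
  have hLm := (memLp_radMeasure_iff.1 hLf).1
  obtain ⟨r1, r2⟩ := memLp_and_l2norm_le (f := fun r => (((weakL m f r).re : ℝ) : ℂ)) zero_le_one hLf
    (Complex.continuous_ofReal.comp_aestronglyMeasurable hLm.re)
    (.of_forall fun r => by
      rw [one_mul, Complex.norm_real]; exact Complex.abs_re_le_norm _)
  obtain ⟨i1, i2⟩ := memLp_and_l2norm_le (f := fun r => (((weakL m f r).im : ℝ) : ℂ)) zero_le_one hLf
    (Complex.continuous_ofReal.comp_aestronglyMeasurable hLm.im)
    (.of_forall fun r => by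
      rw [one_mul, Complex.norm_real]; exact Complex.abs_im_le_norm _)
  rw [one_mul] at r2 i2
  have hw1 : MemLp (fun r => ((weight m r * F₁ r : ℝ) : ℂ)) 2 radMeasure := by
    refine (memLp_congr_ae (radMeasure_ac.ae_le ?_)).1 (memLp_weight_re h3).1
    filter_upwards [q1] with r hr
    rw [hr]
  have hmass : ∀ r, 0 < r → massInt m (fun s => (f s).re) r = massInt m F₁ r := fun r hr => by
    unfold massInt
    refine intervalIntegral.integral_congr_ae ?_
    have := (ae_restrict_iff' measurableSet_Ioi).1 q1
    filter_upwards [this] with s hs hsr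
    rw [uIoc_of_le hr.le] at hsr
    rw [hs hsr.1]
  obtain ⟨β, b1, b2⟩ := h F₁ _ (fun r => (weakL m f r).re) p1 hw1 r1 (by
    filter_upwards [q1, ae_restrict_mem measurableSet_Ioi] with r hr hr0
    rw [weakL_eq m f (le_of_lt hr0), lowerOrder, ← hmass r hr0, ← hr]
    simp only [Complex.add_re, Complex.neg_re, Complex.ofReal_re, Complex.re_ofReal_mul]
    ring)
  obtain ⟨α, a1, a2⟩ := exists_imag_bound (m := m) (h := fun r => (weakL m f r).im) p2 i1 (by
    filter_upwards [q2, ae_restrict_mem measurableSet_Ioi] with r hr hr0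
    rw [weakL_eq m f (le_of_lt hr0), lowerOrder, ← hr]
    simp only [Complex.add_im, Complex.neg_im, Complex.ofReal_im, Complex.im_ofReal_mul]
    ring)
  refine ⟨-α, -(β / (m + 1)), ?_⟩
  obtain ⟨c1, c2⟩ := memLp_and_l2norm_le
    (f := fun r => I * ((weight m r * (F₂ r - α * profile m r) : ℝ) : ℂ)) zero_le_one a1
    ((memLp_radMeasure_iff.1 a1).1.const_mul I) (.of_forall fun r => by
      rw [norm_mul, Complex.norm_I])
  have e : (fun r => weight m r • (f + -α • iQ m + -(β / (m + 1)) • LamQ m) r)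
      =ᵐ[volume.restrict (Ioi 0)]
      (fun r => ((weight m r * (F₁ r - β * (psi m r * profile m r)) : ℝ) : ℂ))
        + fun r => I * ((weight m r * (F₂ r - α * profile m r) : ℝ) : ℂ) := by
    filter_upwards [q1, q2, ae_restrict_mem measurableSet_Ioi] with r h1 h2 hr
    have hn : (m : ℂ) + 1 ≠ 0 := by exact_mod_cast Nat.succ_ne_zero m
    simp only [Pi.add_apply, Pi.smul_apply, Complex.real_smul, LamQ_eq m (le_of_lt hr), iQ, Q_eq]
    rw [← h1, ← h2, ← Complex.re_add_im (f r)]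
    simp only [Complex.add_re, Complex.add_im, Complex.ofReal_re, Complex.ofReal_im, Complex.mul_re,
      Complex.mul_im, Complex.I_re, Complex.I_im]
    push_cast
    field_simp
    ring
  rw [l2norm_congr e]
  refine (l2norm_add_le b1 c1).trans ?_
  have := mul_le_mul_of_nonneg_left r2 hC
  linarith

/-- Modulo the kernel of `L_Q`, the energy norm is controlled by `L_Q f`. -/
lemma exists_energy_bound (m : ℕ) : ∃ C, 0 ≤ C ∧ ∀ f ∈ energySpace m, ∃ a b : ℝ,
    l2norm (weakDeriv (f + a • iQ m + b • LamQ m)) ≤ C * l2norm (weakL m f) ∧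
    l2norm (fun r => weight m r • (f + a • iQ m + b • LamQ m) r) ≤ C * l2norm (weakL m f) := by
  obtain ⟨C, hC, hmain⟩ := exists_weight_bound m
  obtain ⟨CL, hCL, hlow⟩ := lowerOrder_bound m
  obtain ⟨_, hL⟩ := weakL_bounded m
  refine ⟨1 + C + CL * C, by positivity, fun f hf => ?_⟩
  obtain ⟨a, b, hab⟩ := hmain f hf
  have hX0 : 0 ≤ l2norm (weakL m f) := l2norm_nonneg _
  have hCX : 0 ≤ CL * C * l2norm (weakL m f) := by positivity
  refine ⟨a, b, ?_, by linarith⟩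
  have hf1 : f + a • iQ m ∈ energySpace m :=
    add_mem hf (Submodule.smul_mem _ a (iQ_energy m).1)
  have hue : f + a • iQ m + b • LamQ m ∈ energySpace m :=
    add_mem hf1 (Submodule.smul_mem _ b (LamQ_energy m).1)
  have hLu : weakL m (f + a • iQ m + b • LamQ m) =ᵐ[volume.restrict (Ioi 0)] weakL m f := by
    filter_upwards [weakL_add_smul hf1 (LamQ_energy m).1 b, weakL_add_smul hf (iQ_energy m).1 a,
      (iQ_energy m).2, (LamQ_energy m).2] with r e1 e2 e3 e4
    rw [e1, Pi.add_apply, Pi.smul_apply, e2, Pi.add_apply, Pi.smul_apply, e3, e4]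
    simp
  obtain ⟨u1, u2, u3⟩ := energySpace_spec hue
  obtain ⟨v1, v2⟩ := hlow _ u3 u1.aestronglyMeasurable
  -- Adding kernel elements leaves L_Q f unchanged, so the derivative of the corrected function is
  -- L_Q f minus its own zeroth-order part.
  have e : weakDeriv (f + a • iQ m + b • LamQ m) =ᵐ[volume.restrict (Ioi 0)]
      weakL m f + (-1 : ℝ) • lowerOrder m (f + a • iQ m + b • LamQ m) := by
    filter_upwards [hLu, ae_restrict_mem measurableSet_Ioi] with r e1 hr
    rw [Pi.add_apply, Pi.smul_apply, ← e1, weakL_eq m _ (le_of_lt hr)]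
    simp
  rw [l2norm_congr e]
  refine (l2norm_add_le (hL ⟨f, hf⟩).1 (v1.const_smul _)).trans ?_
  rw [l2norm_smul, abs_neg, abs_one, one_mul]
  have := mul_le_mul_of_nonneg_left hab hCL
  have := mul_nonneg hC hX0
  simp only
  linarith

lemma energySq_le {m : ℕ} {f : ℝ → ℂ} {A : ℝ} (h1 : l2norm (weakDeriv f) ≤ A)
    (h2 : l2norm (fun r => weight m r • f r) ≤ A) :
    energySq m f ≤ (1 + if m = 0 then 1 else (m : ℝ) ^ 2) * A ^ 2 := by
  unfold energySq
  have hκ := one_le_energy_const m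
  rw [add_mul, one_mul]
  exact add_le_add (pow_le_pow_left₀ (l2norm_nonneg _) h1 2)
    (mul_le_mul_of_nonneg_left (pow_le_pow_left₀ (l2norm_nonneg _) h2 2) (by linarith))

lemma abs_le_of_cramer {a b a₁ b₁ a₂ b₂ s₁ s₂ T : ℝ} (hD : a₁ * b₂ - b₁ * a₂ ≠ 0)
    (h1 : s₁ = a * a₁ + b * b₁) (h2 : s₂ = a * a₂ + b * b₂) (k1 : |s₁| ≤ T) (k2 : |s₂| ≤ T) :
    |a| ≤ (|a₁| + |b₁| + |a₂| + |b₂|) / |a₁ * b₂ - b₁ * a₂| * T ∧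
      |b| ≤ (|a₁| + |b₁| + |a₂| + |b₂|) / |a₁ * b₂ - b₁ * a₂| * T := by
  have hD0 : 0 < |a₁ * b₂ - b₁ * a₂| := abs_pos.2 hD
  have hT : 0 ≤ T := (abs_nonneg _).trans k1
  have key : ∀ x y : ℝ, |x * s₁ - y * s₂| ≤ (|x| + |y|) * T := fun x y => by
    refine (abs_sub _ _).trans ?_
    rw [abs_mul, abs_mul, add_mul]
    gcongr
  have e1 : a * (a₁ * b₂ - b₁ * a₂) = b₂ * s₁ - b₁ * s₂ := by rw [h1, h2]; ring
  have e2 : b * (a₁ * b₂ - b₁ * a₂) = -(a₂ * s₁ - a₁ * s₂) := by rw [h1, h2]; ring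
  have n1 := mul_nonneg (abs_nonneg a₁) hT
  have n2 := mul_nonneg (abs_nonneg a₂) hT
  have n3 := mul_nonneg (abs_nonneg b₁) hT
  have n4 := mul_nonneg (abs_nonneg b₂) hT
  rw [div_mul_eq_mul_div, le_div_iff₀ hD0, le_div_iff₀ hD0, ← abs_mul, ← abs_mul, e1, e2, abs_neg]
  constructor
  · linarith [key b₂ b₁]
  · linarith [key a₂ a₁]

/-- Coercivity of `L_Q` under two transversal orthogonality conditions. -/
lemma weakL_coercive (m : ℕ) (hQ : iQ m ∈ energySpace m) (hΛ : LamQ m ∈ energySpace m)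
    {ψ₁ ψ₂ : energySpace m →ₗ[ℝ] ℝ} (hψ₁ : IsBoundedFunctional m ψ₁)
    (hψ₂ : IsBoundedFunctional m ψ₂)
    (hdet : Matrix.det !![ψ₁ ⟨iQ m, hQ⟩, ψ₁ ⟨LamQ m, hΛ⟩; ψ₂ ⟨iQ m, hQ⟩, ψ₂ ⟨LamQ m, hΛ⟩] ≠ 0) :
    ∃ c : ℝ, 0 < c ∧ ∀ f : energySpace m, ψ₁ f = 0 → ψ₂ f = 0 →
      c * energySq m f ≤ l2norm (weakL m f) ^ 2 := by
  obtain ⟨C, hC, hmain⟩ := exists_energy_bound m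
  obtain ⟨K₁, hK₁⟩ := hψ₁
  obtain ⟨K₂, hK₂⟩ := hψ₂
  rw [Matrix.det_fin_two_of] at hdet
  -- As κ ≥ 1, κ can replace κ² under the square root, so the energy norm is bounded without taking
  -- roots.
  obtain ⟨κ, hκ, hκ1⟩ : ∃ κ : ℝ, κ = 1 + (if m = 0 then 1 else (m : ℝ) ^ 2) ∧ 1 ≤ κ :=
    ⟨_, rfl, by linarith [one_le_energy_const m]⟩
  obtain ⟨G, hG⟩ : ∃ G, G = (|ψ₁ ⟨iQ m, hQ⟩| + |ψ₁ ⟨LamQ m, hΛ⟩| + |ψ₂ ⟨iQ m, hQ⟩|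
    + |ψ₂ ⟨LamQ m, hΛ⟩|) / |ψ₁ ⟨iQ m, hQ⟩ * ψ₂ ⟨LamQ m, hΛ⟩ - ψ₁ ⟨LamQ m, hΛ⟩ * ψ₂ ⟨iQ m, hQ⟩| :=
    ⟨_, rfl⟩
  have hG0 : 0 ≤ G := by rw [hG]; positivity
  obtain ⟨A, hA⟩ : ∃ A, A = G * ((|K₁| + |K₂|) * (κ * C)) := ⟨_, rfl⟩
  have hA0 : 0 ≤ A := by rw [hA]; positivity
  obtain ⟨S, hS⟩ : ∃ S, S = l2norm (weakDeriv (iQ m)) + l2norm (weakDeriv (LamQ m))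
      + l2norm (fun r => weight m r • iQ m r) + l2norm (fun r => weight m r • LamQ m r) := ⟨_, rfl⟩
  have s1 := l2norm_nonneg (weakDeriv (iQ m))
  have s2 := l2norm_nonneg (weakDeriv (LamQ m))
  have s3 := l2norm_nonneg (fun r => weight m r • iQ m r)
  have s4 := l2norm_nonneg (fun r => weight m r • LamQ m r)
  have hS0 : 0 ≤ S := by rw [hS]; positivity
  refine ⟨(κ * (C + A * S) ^ 2 + 1)⁻¹, by positivity, fun ⟨f, hf⟩ h1 h2 => ?_⟩
  simp only
  obtain ⟨X, hX⟩ : ∃ X, X = l2norm (weakL m f) := ⟨_, rfl⟩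
  have hX0 : 0 ≤ X := hX ▸ l2norm_nonneg _
  obtain ⟨a, b, hDu, hWu⟩ := hmain f hf
  rw [← hX] at hDu hWu ⊢
  obtain ⟨u, hu⟩ : ∃ u, u = f + a • iQ m + b • LamQ m := ⟨_, rfl⟩
  rw [← hu] at hDu hWu
  have hue : u ∈ energySpace m :=
    hu ▸ add_mem (add_mem hf (Submodule.smul_mem _ a hQ)) (Submodule.smul_mem _ b hΛ)
  have hEu : Real.sqrt (energySq m u) ≤ κ * C * X := by
    refine Real.sqrt_le_iff.2 ⟨by positivity, (energySq_le hDu hWu).trans ?_⟩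
    rw [← hκ, mul_assoc κ, mul_pow κ]
    gcongr
    exact le_self_pow₀ hκ1 two_ne_zero
  -- The functionals kill f, so on u they see only the kernel component. As u is controlled by L_Q
  -- f, Cramer's rule then bounds a and b.
  have hψ : ∀ (ψ : energySpace m →ₗ[ℝ] ℝ), ψ ⟨f, hf⟩ = 0 →
      ψ ⟨u, hue⟩ = a * ψ ⟨iQ m, hQ⟩ + b * ψ ⟨LamQ m, hΛ⟩ := fun ψ h0 => by
    have : (⟨u, hue⟩ : energySpace m) = ⟨f, hf⟩ + a • ⟨iQ m, hQ⟩ + b • ⟨LamQ m, hΛ⟩ :=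
      Subtype.ext hu
    rw [this, map_add, map_add, map_smul, map_smul, h0, zero_add, smul_eq_mul, smul_eq_mul]
  have bound : ∀ {K t : ℝ}, |K| ≤ |K₁| + |K₂| → |t| ≤ K * Real.sqrt (energySq m u) →
      |t| ≤ (|K₁| + |K₂|) * (κ * C * X) := fun {K t} hK h => by
    calc |t| ≤ K * Real.sqrt (energySq m u) := h
      _ ≤ (|K₁| + |K₂|) * Real.sqrt (energySq m u) :=
        mul_le_mul_of_nonneg_right ((le_abs_self K).trans hK) (Real.sqrt_nonneg _)
      _ ≤ _ := by gcongr
  obtain ⟨ha, hb⟩ := abs_le_of_cramer hdet (hψ ψ₁ h1) (hψ ψ₂ h2)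
    (bound (le_add_of_nonneg_right (abs_nonneg _)) (hK₁ ⟨u, hue⟩))
    (bound (le_add_of_nonneg_left (abs_nonneg _)) (hK₂ ⟨u, hue⟩))
  have hAX : G * ((|K₁| + |K₂|) * (κ * C * X)) = A * X := by rw [hA]; ring
  rw [← hG, hAX] at ha hb
  have hfu : f = u + -a • iQ m + -b • LamQ m := by rw [hu]; module
  have hu1 : u + -a • iQ m ∈ energySpace m := add_mem hue (Submodule.smul_mem _ _ hQ)
  have comb : ∀ {x y z p q : ℝ}, 0 ≤ p → 0 ≤ q → p + q ≤ S → x ≤ y + |b| * q → y ≤ z + |a| * p →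
      z ≤ C * X → x ≤ (C + A * S) * X := fun {x y z p q} hp hq hpq h1 h2 h3 => by
    have e1 := mul_le_mul_of_nonneg_right ha hp
    have e2 := mul_le_mul_of_nonneg_right hb hq
    have e3 := mul_le_mul_of_nonneg_left hpq (mul_nonneg hA0 hX0)
    linarith
  have hDf : l2norm (weakDeriv f) ≤ (C + A * S) * X := by
    have e1 := l2norm_weakDeriv_add_smul_le hu1 hΛ (-b)
    have e2 := l2norm_weakDeriv_add_smul_le hue hQ (-a)
    rw [← hfu] at e1
    rw [abs_neg] at e1 e2
    exact comb s1 s2 (by linarith) e1 e2 hDu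
  have hWf : l2norm (fun r => weight m r • f r) ≤ (C + A * S) * X := by
    have e1 := l2norm_weight_add_smul_le hu1 hΛ (-b)
    have e2 := l2norm_weight_add_smul_le hue hQ (-a)
    rw [← hfu] at e1
    rw [abs_neg] at e1 e2
    exact comb s3 s4 (by linarith) e1 e2 hWu
  rw [inv_mul_le_iff₀ (by positivity)]
  refine (energySq_le hDf hWf).trans ?_
  rw [← hκ, mul_pow]
  linarith [sq_nonneg X]

end CSS

end

theorem lemma3p7 (m : ℕ) :
    -- `L_Q^*` is the formal real adjoint of `L_Q`
    (∀ φ χ : ℝ → ℂ, CSS.IsTest φ → CSS.IsTest χ →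
      CSS.rinner (CSS.L m (CSS.Q m) φ) χ = CSS.rinner φ (CSS.Lstar m (CSS.Q m) χ)) ∧
    -- `𝓛_Q` is the linearization of the equation at `Q`
    (∀ F : ℂ → ℂ, CSS.SmoothEquivariant m F →
      MeasureTheory.MemLp (CSS.rad F) 2 CSS.radMeasure →
      MeasureTheory.MemLp (deriv (CSS.rad F)) 2 CSS.radMeasure →
      ∀ r : ℝ, 0 < r →
        HasDerivAt (fun s : ℝ => CSS.cssRHS m (fun x => CSS.Q m x + (s : ℂ) * CSS.rad F x) r)
          (CSS.linOp m (CSS.Q m) (CSS.rad F) r) 0) ∧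
    -- the factorization `𝓛_Q = L_Q^* L_Q`
    (∀ (ε : ℝ → ℂ) (r : ℝ), 0 < r →
      CSS.linOp m (CSS.Q m) ε r = CSS.Lstar m (CSS.Q m) (CSS.L m (CSS.Q m) ε) r) ∧
    -- the kernel of `L_Q`
    CSS.kerL m =
      (Submodule.span ℝ {CSS.ext m (CSS.iQ m), CSS.ext m (CSS.LamQ m)} : Set (ℂ → ℂ)) ∧
    -- the generalized eigenmode `ρ` and the generalized null space of `i𝓛_Q`
    (∃ ρ : ℝ → ℝ, CSS.IsRho m ρ ∧
      (1 ≤ m →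
        MeasureTheory.Integrable (fun r => ((ρ r : ℂ) * (starRingEnd ℂ) (CSS.Q m r)).re)
          CSS.radMeasure ∧
        MeasureTheory.MemLp (CSS.L m (CSS.Q m) (fun r => (ρ r : ℂ))) 2 CSS.radMeasure ∧
        CSS.rinner (fun r => (ρ r : ℂ)) (CSS.Q m) =
          CSS.l2norm (CSS.L m (CSS.Q m) (fun r => (ρ r : ℂ))) ^ 2 ∧
        CSS.l2norm (CSS.L m (CSS.Q m) (fun r => (ρ r : ℂ))) ^ 2 ≠ 0) ∧
      (∀ r : ℝ, 0 < r →
        Complex.I * CSS.linOp m (CSS.Q m) (fun s => (ρ s : ℂ)) r = CSS.iQ m r ∧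
        Complex.I * CSS.linOp m (CSS.Q m) (CSS.irrQ m) r = 4 * CSS.LamQ m r ∧
        Complex.I * CSS.linOp m (CSS.Q m) (CSS.iQ m) r = 0 ∧
        Complex.I * CSS.linOp m (CSS.Q m) (CSS.LamQ m) r = 0) ∧
      LinearIndependent ℝ ![CSS.ext m (CSS.iQ m), CSS.ext m (CSS.LamQ m),
        CSS.ext m (CSS.irrQ m), CSS.ext m (fun r => (ρ r : ℂ))] ∧
      ∀ σ : ℝ, -(m : ℝ) ≤ σ → σ < m + 2 →
        {F | CSS.GenNull m σ F} =
          (Submodule.span ℝ (Set.range ![CSS.ext m (CSS.iQ m), CSS.ext m (CSS.LamQ m),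
            CSS.ext m (CSS.irrQ m), CSS.ext m (fun r => (ρ r : ℂ))]) : Set (ℂ → ℂ))) ∧
    -- boundedness of `L_Q` on the energy space
    (∃ C : ℝ, ∀ f : CSS.energySpace m,
      MeasureTheory.MemLp (CSS.weakL m f) 2 CSS.radMeasure ∧
      CSS.l2norm (CSS.weakL m f) ≤ C * Real.sqrt (CSS.energySq m f)) ∧
    -- coercivity of `L_Q` under two transversal orthogonality conditions
    (∃ (hQ : CSS.iQ m ∈ CSS.energySpace m) (hΛ : CSS.LamQ m ∈ CSS.energySpace m),
      ∀ ψ₁ ψ₂ : CSS.energySpace m →ₗ[ℝ] ℝ,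
        CSS.IsBoundedFunctional m ψ₁ → CSS.IsBoundedFunctional m ψ₂ →
        Matrix.det !![ψ₁ ⟨CSS.iQ m, hQ⟩, ψ₁ ⟨CSS.LamQ m, hΛ⟩;
          ψ₂ ⟨CSS.iQ m, hQ⟩, ψ₂ ⟨CSS.LamQ m, hΛ⟩] ≠ 0 →
        ∃ c : ℝ, 0 < c ∧ ∀ f : CSS.energySpace m, ψ₁ f = 0 → ψ₂ f = 0 →
          c * CSS.energySq m f ≤ CSS.l2norm (CSS.weakL m f) ^ 2) := by
  exact ⟨fun φ χ hφ hχ => CSS.rinner_L m hφ hχ,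
    fun F hF h1 h2 r hr => CSS.hasDerivAt_cssRHS (contDiff_infty.1 hF.contDiff_rad 2) h1 h2 hr,
    fun ε r hr => CSS.linOp_eq m ε hr, CSS.kerL_eq m,
    ⟨CSS.rho m, CSS.isRho_rho m, fun hm => CSS.rho_pairing hm,
      fun r hr => CSS.mode_identities m hr, CSS.linearIndependent_modes m,
      fun σ h1 h2 => CSS.genNull_eq m h1 h2⟩,
    CSS.weakL_bounded m, (CSS.iQ_energy m).1, (CSS.LamQ_energy m).1,
    fun ψ₁ ψ₂ h1 h2 h3 => CSS.weakL_coercive m _ _ h1 h2 h3⟩
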